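/- Let $k,d\ge 0$ be integers and $n=k+d$, let $\Theta$ be a real antisymmetric $n\times n$ matrix and let $\Theta_d$ be its lower-right $d\times d$ block. For $x,y\in\mathbb Z^n$ put $\sigma_\Theta(x,y)=e^{-\pi i\langle x,\Theta y\rangle}$. For $p\in\mathbb N^n$ (with $0\in\mathbb N$) let $L_p$ be the isometry of $\ell^2(\mathbb N^n)$ with $L_p\delta_q=\sigma_\Theta(p,q)\delta_{p+q}$, and let $\mathcal T_r(\mathbb N^n,\sigma_\Theta)$ be the C*-algebra generated by all $L_p$; define $\mathcal T_r(\mathbb N^d,\sigma_{\Theta_d})$ in the same way. Let $r=(r_1,\dots,r_k,0,\dots,0)\in\mathbb R^n$ with $r_1,\dots,r_k>0$, and let $\alpha^r$ be the dynamics on $\mathcal T_r(\mathbb N^n,\sigma_\Theta)$ given by $\alpha^r_t=\mathrm{Ad}(u^r_t)$, where $u^r_t\delta_q=e^{i\langle q,r\rangle t}\delta_q$, so that $\alpha^r_t(L_p)=e^{i\langle p,r\rangle t}L_p$. For $\beta>0$, a $\mathrm{KMS}_\beta$ state is a state $\varphi$ with $\varphi(AB)=\varphi(B\,\alpha^r_{i\beta}(A))$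 for all $\alpha^r$-analytic (entire) $A$ and all $B$; the set of these states carries the weak* topology. Let $\mathcal A_{\Theta_d}$ be the noncommutative torus, realised as the C*-algebra generated by the unitaries $U_x$, $x\in\mathbb Z^d$, on $\ell^2(\mathbb Z^d)$ with $U_x\delta_y=\sigma_{\Theta_d}(x,y)\delta_{x+y}$; thus $U_xU_y=\sigma_{\Theta_d}(x,y)U_{x+y}$. Let $H=\{x\in\mathbb Z^d : \langle x,\Theta_d y\rangle\in\mathbb Z\text{ for all }y\in\mathbb Z^d\}$ and let $m=\operatorname{rank}H$ be the degeneracy index of $\Theta_d$. **Theorem.** For each $\beta>0$: 1. There is an affine homeomorphism of the space $M_1(\mathbb T^m)$ of Borel probability measures on $\mathbb T^m$, with the weak* topology, onto the space of $\mathrm{KMS}_\beta$ states of $(\mathcal T_r(\mathbb N^n,\sigma_\Theta),\alpha^r)$. 2. There is a unital $*$-homomorphism $\pi:\mathcal T_r(\mathbb N^d,\sigma_{\Theta_d})\to\mathcal A_{\Theta_d}$ with $\pi(L_{e_i})=U_{e_i}$ for $i=1,\dots,d$ (it is then unique), such that the following holds. Let $\{p_1,\dots,p_d\}$ be a basis of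 $\mathbb Z^d$ and $a_1,\dots,a_m$ positive integers such that $\{a_1p_1,\dots,a_mp_m\}$ is a basis of $H$. For $x,y\in\mathbb N^d$ with $x-y\in H$ let $c=(c_1,\dots,c_m)\in\mathbb Z^m$ be the coefficient vector of $x-y$ with respect to this basis of $H$. Then there are $\lambda_{x,y}\in\{-1,1\}$ with $$\pi(L_xL_y^*)=\lambda_{x,y}\,U_{a_1p_1}^{c_1}\cdots U_{a_mp_m}^{c_m}\qquad(x,y\in\mathbb N^d,\ x-y\in H),$$ and the affine homeomorphism in 1 can be chosen so that, for every $z\in\mathbb T^m$, the state $\varphi_{\beta,z}$ associated to the unit point mass at $z$ is an extreme point of the set of $\mathrm{KMS}_\beta$ states and satisfies $$\varphi_{\beta,z}(L_pL_xL_y^*L_q^*)=\delta_{p,q}\,[x-y\in H]\,\lambda_{x,y}\,z^c\prod_{j=1}^k\frac{e^{-\beta r_jp_j}(1-e^{-\beta r_j})}{1-e^{-\beta r_j+2\pi i\langle\Theta(x-y),e_j\rangle}}$$ for all $p,q\in\mathbb N^k\times 0_d$ and $x,y\in 0_k\times\mathbb N^d\cong\mathbb N^d$, where $z^c=\prod_{j=1}^m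 z_j^{c_j}$ and the right-hand side is $0$ if $p\ne q$ or $x-y\notin H$. -/

import Mathlib

open MeasureTheory
open scoped ComplexOrder NNReal

noncomputable section

namespace ToeplitzTorus

/-! ### Weighted translations on `ℓ²(P)` -/

/-- The Hilbert space `ℓ²(P)`. -/
abbrev EllTwo (P : Type*) : Type _ := lp (fun _ : P => ℂ) 2

/-- The bounded operators on `ℓ²(P)`. -/
abbrev BddOp (P : Type*) : Type _ := EllTwo P →L[ℂ] EllTwo P

open Classical in
/-- The canonical orthonormal basis vector `δ_q` of `ℓ²(P)`. -/
def delta {P : Type*} (q : P) : EllTwo P := lp.single 2 q (1 : ℂ)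

theorem orthonormal_weighted {P : Type*} (w : P → Circle) (s : P ↪ P) :
    Orthonormal ℂ (fun q : P => (w q : ℂ) • (delta (s q) : EllTwo P)) := by
  classical
  rw [orthonormal_iff_ite]
  intro i j
  rw [inner_smul_left, inner_smul_right]
  unfold delta
  rw [lp.inner_single_left, lp.single_apply]
  by_cases h : i = j
  · subst h
    have h1 : (starRingEnd ℂ) (w i : ℂ) * (w i : ℂ) = 1 := by
      rw [← Circle.coe_inv_eq_conj, ← Circle.coe_mul, inv_mul_cancel, Circle.coe_one]
    simp [h1]
  · have h' : s i ≠ s j := fun e => h (s.injective e)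
    simp [h, h']

/-- The isometry of `ℓ²(P)` with `δ_q ↦ w(q) δ_{s(q)}`, for an injective map `s` and
unimodular weights `w`; see `weightedShift_delta`. -/
def weightedShift {P : Type*} (w : P → Circle) (s : P ↪ P) : EllTwo P →ₗᵢ[ℂ] EllTwo P :=
  (orthonormal_weighted w s).orthogonalFamily.linearIsometry

theorem weightedShift_delta {P : Type*} (w : P → Circle) (s : P ↪ P) (q : P) :
    weightedShift w s (delta q) = (w q : ℂ) • (delta (s q) : EllTwo P) := by
  classical
  have h := (orthonormal_weighted w s).orthogonalFamily.linearIsometry_apply_single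
    (i := q) (1 : ℂ)
  have h2 : (delta q : EllTwo P) = lp.single 2 q (1 : ℂ) := by
    unfold delta
    convert rfl
  rw [weightedShift, h2, h]
  simp

theorem ext_delta {P : Type*} {A B : BddOp P} (h : ∀ q, A (delta q) = B (delta q)) : A = B := by
  classical
  refine lp.ext_continuousLinearMap (by simp) fun q => ?_
  ext
  have h2 : (delta q : EllTwo P) = lp.single 2 q (1 : ℂ) := by
    unfold delta
    convert rfl
  have h3 := h q
  rw [h2] at h3
  change (A (lp.single 2 q (1 : ℂ))) _ = (B (lp.single 2 q (1 : ℂ))) _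
  rw [h3]

theorem star_weightedShift_mul_self {P : Type*} (w : P → Circle) (s : P ↪ P) :
    star ((weightedShift w s).toContinuousLinearMap : BddOp P) *
      (weightedShift w s).toContinuousLinearMap = 1 := by
  rw [ContinuousLinearMap.star_eq_adjoint]
  exact (ContinuousLinearMap.norm_map_iff_adjoint_comp_self _).1
    (weightedShift w s).norm_map

/-- A weighted translation along a bijection is a unitary operator. -/
theorem weightedShift_mem_unitary {P : Type*} (w : P → Circle) (s : P ≃ P) :
    ((weightedShift w s.toEmbedding).toContinuousLinearMap : BddOp P) ∈ unitary (BddOp P) := by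
  refine ⟨star_weightedShift_mul_self w _, ?_⟩
  set V : BddOp P := (weightedShift w s.toEmbedding).toContinuousLinearMap with hV
  have h1 : star V * V = 1 := star_weightedShift_mul_self w _
  let W : BddOp P :=
    (weightedShift (fun q => (w (s.symm q))⁻¹) s.symm.toEmbedding).toContinuousLinearMap
  have h2 : V * W = 1 := by
    refine ext_delta fun q => ?_
    change weightedShift w s.toEmbedding (weightedShift _ s.symm.toEmbedding (delta q)) = delta q
    rw [weightedShift_delta, map_smul, weightedShift_delta, smul_smul]
    simp
  have h3 : star V = W := left_inv_eq_right_inv h1 h2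
  rw [h3, h2]

/-! ### Twisted semigroup algebras -/

/-- The operator `L_p` of the left regular `σ`-representation, `L_p δ_q = σ(p,q) δ_{p+q}`. -/
def leftReg {P : Type*} [AddCancelCommMonoid P] (σ : P → P → Circle) (p : P) : BddOp P :=
  (weightedShift (σ p) (addLeftEmbedding p)).toContinuousLinearMap

theorem leftReg_delta {P : Type*} [AddCancelCommMonoid P] (σ : P → P → Circle) (p q : P) :
    leftReg σ p (delta q) = (σ p q : ℂ) • (delta (p + q) : EllTwo P) :=
  weightedShift_delta _ _ _

/-- The reduced C*-algebra of `P` twisted by `σ`: the C*-algebra of operators on `ℓ²(P)`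
generated by the operators `L_p`, `p ∈ P`. -/
def reducedAlg {P : Type*} [AddCancelCommMonoid P] (σ : P → P → Circle) :
    StarSubalgebra ℂ (BddOp P) :=
  (StarAlgebra.adjoin ℂ (Set.range (leftReg σ))).topologicalClosure

theorem leftReg_mem {P : Type*} [AddCancelCommMonoid P] (σ : P → P → Circle) (p : P) :
    leftReg σ p ∈ reducedAlg σ :=
  StarSubalgebra.le_topologicalClosure _ (StarAlgebra.subset_adjoin ℂ _ ⟨p, rfl⟩)

/-! ### Cocycles of antisymmetric matrices, Toeplitz noncommutative tori and
noncommutative tori -/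

/-- `σ_Θ(x,y) = exp(-π i ⟨x, Θ y⟩)` for real vectors `x`, `y`. -/
def cocycle {ι : Type*} [Fintype ι] (Θ : Matrix ι ι ℝ) (x y : ι → ℝ) : Circle :=
  Circle.exp (-Real.pi * (x ⬝ᵥ Θ.mulVec y))

/-- The restriction of `σ_Θ` to `ℕ^ι`. -/
def cocycleNat {ι : Type*} [Fintype ι] (Θ : Matrix ι ι ℝ) (p q : ι → ℕ) : Circle :=
  cocycle Θ (fun i => (p i : ℝ)) (fun i => (q i : ℝ))

/-- The restriction of `σ_Θ` to `ℤ^ι`. -/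
def cocycleInt {ι : Type*} [Fintype ι] (Θ : Matrix ι ι ℝ) (x y : ι → ℤ) : Circle :=
  cocycle Θ (fun i => (x i : ℝ)) (fun i => (y i : ℝ))

/-- The Toeplitz noncommutative torus `𝒯_r(ℕ^ι, σ_Θ)`. -/
abbrev Toeplitz {ι : Type*} [Fintype ι] (Θ : Matrix ι ι ℝ) : StarSubalgebra ℂ (BddOp (ι → ℕ)) :=
  reducedAlg (cocycleNat Θ)

/-- The canonical generating isometry `L_p` of `𝒯_r(ℕ^ι, σ_Θ)`. -/
def L {ι : Type*} [Fintype ι] (Θ : Matrix ι ι ℝ) (p : ι → ℕ) : Toeplitz Θ :=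
  ⟨leftReg (cocycleNat Θ) p, leftReg_mem _ p⟩

/-- The noncommutative torus `𝒜_Θ`, realised as the twisted group C*-algebra of `ℤ^ι` acting on
`ℓ²(ℤ^ι)` through the left regular `σ_Θ`-representation. -/
abbrev NCTorus {ι : Type*} [Fintype ι] (Θ : Matrix ι ι ℝ) : StarSubalgebra ℂ (BddOp (ι → ℤ)) :=
  reducedAlg (cocycleInt Θ)

theorem leftReg_int_mem_unitary {ι : Type*} [Fintype ι] (Θ : Matrix ι ι ℝ) (x : ι → ℤ) :
    leftReg (cocycleInt Θ) x ∈ unitary (BddOp (ι → ℤ)) :=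
  weightedShift_mem_unitary (cocycleInt Θ x) (Equiv.addLeft x)

/-- The unitary `U_x` of `𝒜_Θ`, `x ∈ ℤ^ι`, given by the canonical unitary `σ_Θ`-representation
of `ℤ^ι`, so that `U_x U_y = σ_Θ(x,y) U_{x+y}`. -/
def U {ι : Type*} [Fintype ι] (Θ : Matrix ι ι ℝ) (x : ι → ℤ) : unitary (NCTorus Θ) :=
  ⟨⟨leftReg (cocycleInt Θ) x, leftReg_mem _ x⟩,
    Subtype.ext (leftReg_int_mem_unitary Θ x).1, Subtype.ext (leftReg_int_mem_unitary Θ x).2⟩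

/-! ### The dynamics -/

/-- The diagonal unitary `u_t^r`, `u_t^r δ_q = exp(i ⟨q, r⟩ t) δ_q`. -/
def dynUnitary {ι : Type*} [Fintype ι] (r : ι → ℝ) (t : ℝ) : unitary (BddOp (ι → ℕ)) :=
  ⟨(weightedShift (fun q : ι → ℕ => Circle.exp (((fun i => (q i : ℝ)) ⬝ᵥ r) * t))
      (Equiv.refl (ι → ℕ)).toEmbedding).toContinuousLinearMap,
    weightedShift_mem_unitary _ (Equiv.refl _)⟩

theorem dynUnitary_delta {ι : Type*} [Fintype ι] (r : ι → ℝ) (t : ℝ) (q : ι → ℕ) :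
    (dynUnitary r t : BddOp (ι → ℕ)) (delta q) =
      (Circle.exp (((fun i => (q i : ℝ)) ⬝ᵥ r) * t) : ℂ) • (delta q : EllTwo (ι → ℕ)) :=
  weightedShift_delta _ _ _

theorem dynUnitary_neg_mul {ι : Type*} [Fintype ι] (r : ι → ℝ) (t : ℝ) :
    (dynUnitary r (-t) : BddOp (ι → ℕ)) * (dynUnitary r t : BddOp (ι → ℕ)) = 1 := by
  refine ext_delta fun q => ?_
  change (dynUnitary r (-t) : BddOp (ι → ℕ)) ((dynUnitary r t : BddOp (ι → ℕ)) (delta q)) = delta q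
  rw [dynUnitary_delta, map_smul, dynUnitary_delta, smul_smul,
    ← Circle.coe_mul, ← Circle.exp_add]
  simp

theorem star_dynUnitary {ι : Type*} [Fintype ι] (r : ι → ℝ) (t : ℝ) :
    star (dynUnitary r t : BddOp (ι → ℕ)) = dynUnitary r (-t) :=
  (left_inv_eq_right_inv (dynUnitary_neg_mul r t) (dynUnitary r t).2.2).symm

theorem dynUnitary_conj_leftReg {ι : Type*} [Fintype ι] (Θ : Matrix ι ι ℝ) (r : ι → ℝ) (t : ℝ)
    (p : ι → ℕ) :
    (dynUnitary r t : BddOp (ι → ℕ)) * leftReg (cocycleNat Θ) p *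
        star (dynUnitary r t : BddOp (ι → ℕ)) =
      (Circle.exp (((fun i => (p i : ℝ)) ⬝ᵥ r) * t) : ℂ) • leftReg (cocycleNat Θ) p := by
  rw [star_dynUnitary]
  refine ext_delta fun q => ?_
  change (dynUnitary r t : BddOp (ι → ℕ)) (leftReg (cocycleNat Θ) p
      ((dynUnitary r (-t) : BddOp (ι → ℕ)) (delta q))) =
    (Circle.exp (((fun i => (p i : ℝ)) ⬝ᵥ r) * t) : ℂ) • leftReg (cocycleNat Θ) p (delta q)
  simp only [dynUnitary_delta, leftReg_delta, map_smul, smul_smul, ← Circle.coe_mul]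
  congr 2
  rw [mul_right_comm, ← Circle.exp_add]
  congr 2
  have : (fun i => ((p + q) i : ℝ)) = (fun i => (p i : ℝ)) + fun i => (q i : ℝ) := by
    ext i; simp
  rw [this, add_dotProduct]
  ring

theorem dynUnitary_conj_mem {ι : Type*} [Fintype ι] (Θ : Matrix ι ι ℝ) (r : ι → ℝ) (t : ℝ)
    (A : BddOp (ι → ℕ)) (hA : A ∈ Toeplitz Θ) :
    Unitary.conjStarAlgAut ℂ (BddOp (ι → ℕ)) (dynUnitary r t) A ∈ Toeplitz Θ := by
  let φ : BddOp (ι → ℕ) →⋆ₐ[ℂ] BddOp (ι → ℕ) :=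
    (Unitary.conjStarAlgAut ℂ (BddOp (ι → ℕ)) (dynUnitary r t) :
      BddOp (ι → ℕ) →⋆ₐ[ℂ] BddOp (ι → ℕ))
  have hφ : Continuous φ := by
    change Continuous fun B : BddOp (ι → ℕ) =>
      (dynUnitary r t : BddOp (ι → ℕ)) * B * star (dynUnitary r t : BddOp (ι → ℕ))
    fun_prop
  have hle : Toeplitz Θ ≤ (Toeplitz Θ).comap φ := by
    refine StarSubalgebra.topologicalClosure_minimal ?_ ?_
    · refine StarAlgebra.adjoin_le ?_
      rintro _ ⟨p, rfl⟩
      change (dynUnitary r t : BddOp (ι → ℕ)) * leftReg (cocycleNat Θ) p *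
        star (dynUnitary r t : BddOp (ι → ℕ)) ∈ Toeplitz Θ
      rw [dynUnitary_conj_leftReg]
      exact (Toeplitz Θ).smul_mem (leftReg_mem _ p) _
    · exact (StarSubalgebra.isClosed_topologicalClosure _).preimage hφ
  exact hle hA

/-- Conjugation by `u_t^r`, as an endomorphism of `𝒯_r(ℕ^ι, σ_Θ)`. -/
def dynHom {ι : Type*} [Fintype ι] (Θ : Matrix ι ι ℝ) (r : ι → ℝ) (t : ℝ) :
    Toeplitz Θ →⋆ₐ[ℂ] Toeplitz Θ :=
  StarAlgHom.codRestrict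
    ((Unitary.conjStarAlgAut ℂ (BddOp (ι → ℕ)) (dynUnitary r t) :
      BddOp (ι → ℕ) →⋆ₐ[ℂ] BddOp (ι → ℕ)).comp (Toeplitz Θ).subtype)
    (Toeplitz Θ) fun A => dynUnitary_conj_mem Θ r t A A.2

theorem dynHom_coe {ι : Type*} [Fintype ι] (Θ : Matrix ι ι ℝ) (r : ι → ℝ) (t : ℝ)
    (A : Toeplitz Θ) :
    (dynHom Θ r t A : BddOp (ι → ℕ)) =
      (dynUnitary r t : BddOp (ι → ℕ)) * A * star (dynUnitary r t : BddOp (ι → ℕ)) := rfl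

theorem dynHom_neg_comp {ι : Type*} [Fintype ι] (Θ : Matrix ι ι ℝ) (r : ι → ℝ) (t : ℝ) :
    (dynHom Θ r (-t)).comp (dynHom Θ r t) = StarAlgHom.id ℂ _ := by
  ext1 A
  apply Subtype.ext
  have h := dynUnitary_neg_mul r t
  change (dynUnitary r (-t) : BddOp (ι → ℕ)) * ((dynUnitary r t : BddOp (ι → ℕ)) * A *
    star (dynUnitary r t : BddOp (ι → ℕ))) * star (dynUnitary r (-t) : BddOp (ι → ℕ)) = A
  rw [star_dynUnitary, star_dynUnitary, neg_neg]
  calc _ = ((dynUnitary r (-t) : BddOp (ι → ℕ)) * (dynUnitary r t : BddOp (ι → ℕ))) * A *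
        ((dynUnitary r (-t) : BddOp (ι → ℕ)) * (dynUnitary r t : BddOp (ι → ℕ))) := by
        simp only [mul_assoc]
    _ = A := by rw [h, one_mul, mul_one]

/-- The dynamics `α^r` on `𝒯_r(ℕ^ι, σ_Θ)`: `α_t^r` is conjugation by `u_t^r`; it satisfies
`α_t^r(L_p) = exp(i ⟨p, r⟩ t) L_p`. -/
def dynamics {ι : Type*} [Fintype ι] (Θ : Matrix ι ι ℝ) (r : ι → ℝ) (t : ℝ) :
    Toeplitz Θ ≃⋆ₐ[ℂ] Toeplitz Θ :=
  StarAlgEquiv.ofStarAlgHom (dynHom Θ r t) (dynHom Θ r (-t)) (dynHom_neg_comp Θ r t)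
    (by simpa using dynHom_neg_comp Θ r (-t))

/-! ### KMS states -/

/-- The state space of a unital C*-algebra, as a set of functionals with the weak* topology. -/
def states (A : Type*) [NormedRing A] [StarRing A] [NormedAlgebra ℂ A] : Set (WeakDual ℂ A) :=
  {φ | (∀ a : A, 0 ≤ φ (star a * a)) ∧ φ 1 = 1}

/-- The `KMS_β` states of `(A, α)`: states with `φ(a b) = φ(b α_{iβ}(a))` for all `α`-analytic `a`
and all `b`. An element `a` is analytic if `t ↦ α_t(a)` extends to an entire function `F`, and then
`α_z(a) = F(z)`. -/
def kmsStates {A : Type*} [NormedRing A] [StarRing A] [NormedAlgebra ℂ A]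
    (α : ℝ → (A ≃⋆ₐ[ℂ] A)) (β : ℝ) : Set (WeakDual ℂ A) :=
  {φ | φ ∈ states A ∧ ∀ (a : A) (F : ℂ → A), Differentiable ℂ F → (∀ t : ℝ, F t = α t a) →
    ∀ b : A, φ (a * b) = φ (b * F (Complex.I * β))}

/-- A map from probability measures to functionals is affine if it preserves convex
combinations. -/
def IsAffineOnMeasures {X A : Type*} [MeasurableSpace X] [NormedRing A] [NormedAlgebra ℂ A]
    (Φ : ProbabilityMeasure X → WeakDual ℂ A) : Prop :=
  ∀ (μ ν ρ : ProbabilityMeasure X) (s t : ℝ≥0), s + t = 1 →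
    (ρ : Measure X) = s • (μ : Measure X) + t • (ν : Measure X) →
      Φ ρ = (s : ℂ) • Φ μ + (t : ℂ) • Φ ν

/-! ### The degeneracy index -/

/-- `H = {x ∈ ℤ^d | ⟨x, D y⟩ ∈ ℤ for all y ∈ ℤ^d}`. -/
def degeneracyGroup {d : ℕ} (D : Matrix (Fin d) (Fin d) ℝ) : Submodule ℤ (Fin d → ℤ) where
  carrier := {x | ∀ y : Fin d → ℤ, ∃ N : ℤ,
    (fun i => (x i : ℝ)) ⬝ᵥ D.mulVec (fun i => (y i : ℝ)) = N}
  zero_mem' := fun y => ⟨0, by simp [dotProduct]⟩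
  add_mem' := by
    intro x x' hx hx' y
    obtain ⟨N, hN⟩ := hx y
    obtain ⟨N', hN'⟩ := hx' y
    refine ⟨N + N', ?_⟩
    have : (fun i => ((x + x') i : ℝ)) = (fun i => (x i : ℝ)) + fun i => (x' i : ℝ) := by
      ext i; simp
    rw [this, add_dotProduct, hN, hN']
    push_cast; rfl
  smul_mem' := by
    intro c x hx y
    obtain ⟨N, hN⟩ := hx y
    refine ⟨c * N, ?_⟩
    have : (fun i => ((c • x) i : ℝ)) = (c : ℝ) • (fun i => (x i : ℝ)) := by
      ext i; simp
    rw [this, smul_dotProduct, hN]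
    push_cast; rfl

/-- The degeneracy index of `D`: the rank of `H`. -/
def degeneracyIndex {d : ℕ} (D : Matrix (Fin d) (Fin d) ℝ) : ℕ :=
  Module.finrank ℤ (degeneracyGroup D)

theorem degeneracyIndex_le {d : ℕ} (D : Matrix (Fin d) (Fin d) ℝ) : degeneracyIndex D ≤ d := by
  simpa [degeneracyIndex] using Submodule.finrank_le (degeneracyGroup D)

/-- `x - y ∈ ℤ^d` for `x, y ∈ ℕ^d`. -/
def natDiff {d : ℕ} (x y : Fin d → ℕ) : Fin d → ℤ := fun i => (x i : ℤ) - (y i : ℤ)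

/-! ### The splitting `ℕ^n = ℕ^k × ℕ^d` -/

/-- `p ∈ ℕ^k`, viewed in `ℕ^k × 0_d`. -/
def inK {k : ℕ} (d : ℕ) (p : Fin k → ℕ) : Fin k ⊕ Fin d → ℕ := Sum.elim p 0

/-- `x ∈ ℕ^d`, viewed in `0_k × ℕ^d`. -/
def inD (k : ℕ) {d : ℕ} (x : Fin d → ℕ) : Fin k ⊕ Fin d → ℕ := Sum.elim 0 x

/-- The vector `r = (r_1, …, r_k, 0, …, 0)`. -/
def extendZero {k : ℕ} (d : ℕ) (r : Fin k → ℝ) : Fin k ⊕ Fin d → ℝ := Sum.elim r 0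

/-- `⟨Θ (0_k, v), e_j⟩` for `v ∈ ℤ^d` and `1 ≤ j ≤ k`. -/
def pairing {k d : ℕ} (Θ : Matrix (Fin k ⊕ Fin d) (Fin k ⊕ Fin d) ℝ) (v : Fin d → ℤ)
    (j : Fin k) : ℝ :=
  Θ.mulVec (Sum.elim 0 fun i => (v i : ℝ)) (Sum.inl j)

/-- The Euler product
`∏_j e^{-β r_j p_j} (1 - e^{-β r_j}) / (1 - e^{-β r_j + 2 π i ⟨Θ v, e_j⟩})`. -/
def eulerProduct {k d : ℕ} (Θ : Matrix (Fin k ⊕ Fin d) (Fin k ⊕ Fin d) ℝ) (r : Fin k → ℝ)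
    (β : ℝ) (p : Fin k → ℕ) (v : Fin d → ℤ) : ℂ :=
  ∏ j : Fin k, Complex.exp (-β * r j * p j) * (1 - Complex.exp (-β * r j)) /
    (1 - Complex.exp (-β * r j + 2 * Real.pi * Complex.I * pairing Θ v j))

/-- The torus `𝕋^m`. -/
abbrev Torus (m : ℕ) : Type := Fin m → Circle

/-- The Borel σ-algebra of `𝕋`. -/
instance : MeasurableSpace Circle := borel Circle

instance : BorelSpace Circle := ⟨rfl⟩

/-- The character `z^c = ∏_j z_j^{c_j}`. -/
def torusChar {m : ℕ} (z : Torus m) (c : Fin m → ℤ) : ℂ := ((∏ j, z j ^ c j : Circle) : ℂ)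

end ToeplitzTorus

end

open ToeplitzTorus

/-! Normalised as `mono Θ s t`, the products L_s L_t^* become truncated translations by s - t whose
phase is bilinear in s - t and the point moved. Their products (`mono_mul`) and the dynamics
(`dynamics_mono`) are then explicit, and the KMS condition reduces to identities between phases and
energies (`mem_kmsStates_iff`).

KMS states are rigid. The KMS condition scales φ(L_a X L_a^*) by e^{-β⟨a,r⟩} and a commutation phase
(`MonoKMS.shift`). In the ℕ^d directions the energy is zero, so the range projections of the L_b
have mass one and φ treats L_b as a unitary (`MonoKMS.apply_add`). Hence φ on the ℕ^d part depends
only on v = x - y, and comparison with the commutation phase forces it to vanish for v outside H. In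
the ℕ^k directions only equal exponents survive, with geometric weights (`MonoKMS.apply_mono`). So φ
is determined by one function on H ≅ ℤ^m.

That function, divided by the Euler product `gibbsFactor` and corrected by a sign, is positive
definite: evaluating φ under the vacuum projection ∏(1 - L_{e_j} L_{e_j}^*) clears exactly the
denominators of the Euler product (`MonoKMS.kmsFourier_posDef`). By the Herglotz–Bochner theorem
(`exists_measure_of_posDef`) it is the Fourier transform of a probability measure on the torus.

Conversely, each z gives a functional τ as a limit of vector functionals on growing boxes of H
(`exists_tracial_functional`). Averaging τ(L_p^* · L_p) over p ∈ ℕ^k with weights proportional to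
e^{-β⟨p,r⟩} gives twisted geometric series that sum to the Euler product (`exists_kms_functional`).
Integrating over z yields an affine continuous bijection from a compact space to a Hausdorff one,
hence a homeomorphism.

The signs arise because ⟨x, Θ_d y⟩ is an integer for x ∈ H: the U_x with x ∈ H commute and their
cocycle takes values ±1. The sign function of `exists_latticeSign` compares the ordered words in the
U_{h_j} with the single unitaries U_x, and the same sign enters both π(L_x L_y^*) and the value of
the state. -/

noncomputable section

namespace ToeplitzTorus

/-! ### Normal form of the Toeplitz algebra: monomials and their product rule -/

section

/-! ### Phases and the bilinear form of `Θ` -/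

/-- `exp(-π i t)`. -/
def phase (t : ℝ) : Circle := Circle.exp (-Real.pi * t)

theorem phase_add (s t : ℝ) : phase (s + t) = phase s * phase t := by
  simp [phase, mul_add, Circle.exp_add]

theorem coe_phase_add (s t : ℝ) : (phase (s + t) : ℂ) = phase s * phase t := by
  rw [phase_add, Circle.coe_mul]

@[simp] theorem phase_zero : phase 0 = 1 := by simp [phase]

theorem phase_neg (t : ℝ) : phase (-t) = (phase t)⁻¹ := by simp [phase, ← Circle.exp_neg]

theorem star_coe_phase (t : ℝ) : star (phase t : ℂ) = phase (-t) := by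
  rw [phase_neg, Circle.coe_inv_eq_conj]; rfl

theorem phase_coe_eq_exp (t : ℝ) : (phase t : ℂ) = Complex.exp (-Real.pi * t * Complex.I) := by
  simp [phase, Circle.coe_exp, Complex.exp_neg]

theorem phase_two_mul_int (N : ℤ) : phase (2 * N) = 1 := by
  apply Circle.ext
  rw [phase_coe_eq_exp, Circle.coe_one, Complex.exp_eq_one_iff]
  exact ⟨-N, by push_cast; ring⟩

theorem exists_int_of_phase_two_mul {t : ℝ} (h : phase (2 * t) = 1) : ∃ N : ℤ, t = N := by
  have h' := congrArg (fun z : Circle => (z : ℂ)) h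
  simp only [phase_coe_eq_exp, Circle.coe_one, Complex.exp_eq_one_iff] at h'
  obtain ⟨n, hn⟩ := h'
  refine ⟨-n, ?_⟩
  have hpi : (Real.pi : ℂ) ≠ 0 := by exact_mod_cast Real.pi_ne_zero
  have h2 : (t : ℂ) = ((-n : ℤ) : ℂ) := by
    have : (2 * Real.pi * Complex.I) * (t : ℂ) = (2 * Real.pi * Complex.I) * ((-n : ℤ) : ℂ) := by
      push_cast at hn ⊢
      linear_combination -hn
    exact mul_left_cancel₀ (by simp [hpi]) this
  exact_mod_cast h2

/-- The inclusion `ℕ^κ → ℤ^κ`. -/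
def toInt {κ : Type*} (p : κ → ℕ) : κ → ℤ := fun i => (p i : ℤ)

section toInt
variable {κ : Type*} {p q : κ → ℕ}

@[simp] theorem toInt_zero : toInt (0 : κ → ℕ) = 0 := by ext i; simp [toInt]

@[simp] theorem toInt_add (p q : κ → ℕ) : toInt (p + q) = toInt p + toInt q := by
  ext i; simp [toInt]

theorem toInt_sub (h : q ≤ p) : toInt (p - q) = toInt p - toInt q := by
  ext i
  have : q i ≤ p i := h i
  simp only [toInt, Pi.sub_apply]
  omega

theorem toInt_injective : Function.Injective (toInt : (κ → ℕ) → κ → ℤ) := by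
  intro p q h
  ext i
  have := congrFun h i
  simpa [toInt] using this

end toInt

variable {ι : Type*} [Fintype ι]

/-- The bilinear form `⟨x, Θ y⟩` on `ℤ^ι`. -/
def form (Θ : Matrix ι ι ℝ) (x y : ι → ℤ) : ℝ :=
  (fun i => (x i : ℝ)) ⬝ᵥ Θ.mulVec (fun i => (y i : ℝ))

section form
variable (Θ : Matrix ι ι ℝ) (x y z : ι → ℤ)

theorem form_add_left : form Θ (x + y) z = form Θ x z + form Θ y z := by
  rw [form, form, form, ← add_dotProduct]
  congr 1
  ext i
  simp

theorem form_add_right : form Θ x (y + z) = form Θ x y + form Θ x z := by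
  rw [form, form, form, ← dotProduct_add, ← Matrix.mulVec_add]
  congr 2
  ext i
  simp

theorem form_neg_left : form Θ (-x) y = -form Θ x y := by
  rw [form, form, ← neg_dotProduct]
  congr 1
  ext i
  simp

theorem form_neg_right : form Θ x (-y) = -form Θ x y := by
  rw [form, form, ← dotProduct_neg, ← Matrix.mulVec_neg]
  congr 2
  ext i
  simp

theorem form_sub_left : form Θ (x - y) z = form Θ x z - form Θ y z := by
  rw [sub_eq_add_neg, form_add_left, form_neg_left, sub_eq_add_neg]

theorem form_sub_right : form Θ x (y - z) = form Θ x y - form Θ x z := by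
  rw [sub_eq_add_neg, form_add_right, form_neg_right, sub_eq_add_neg]

@[simp] theorem form_zero_left : form Θ 0 y = 0 := by
  simpa using form_sub_left Θ 0 0 y

@[simp] theorem form_zero_right : form Θ x 0 = 0 := by
  simpa using form_sub_right Θ x 0 0

variable {Θ}

theorem form_swap (hΘ : Θ.transpose = -Θ) : form Θ y x = -form Θ x y := by
  rw [form, form, Matrix.dotProduct_mulVec, ← Matrix.mulVec_transpose, hΘ, Matrix.neg_mulVec,
    neg_dotProduct, dotProduct_comm]

theorem form_self (hΘ : Θ.transpose = -Θ) : form Θ x x = 0 := by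
  linarith [form_swap x x hΘ]

theorem cocycleInt_eq_phase : cocycleInt Θ x y = phase (form Θ x y) := rfl

end form

theorem cocycleNat_eq_phase (Θ : Matrix ι ι ℝ) (p q : ι → ℕ) :
    cocycleNat Θ p q = phase (form Θ (toInt p) (toInt q)) := by
  simp [cocycleNat, cocycle, phase, form, toInt]

/-! ### Matrix coefficients -/

theorem inner_delta {P : Type*} (q : P) (f : EllTwo P) : inner ℂ (delta q) f = f q := by
  classical
  rw [delta, lp.inner_single_left]
  simp

theorem delta_apply {P : Type*} [DecidableEq P] (p q : P) :
    (delta p : EllTwo P) q = if q = p then 1 else 0 := by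
  have h2 : (delta p : EllTwo P) = lp.single 2 p (1 : ℂ) := by
    unfold delta
    convert rfl
  rw [h2, lp.single_apply]
  by_cases h : q = p
  · subst h; simp
  · simp [h]

theorem star_leftReg_delta (Θ : Matrix ι ι ℝ) (t q : ι → ℕ) [Decidable (t ≤ q)] :
    star (leftReg (cocycleNat Θ) t) (delta q) =
      if t ≤ q then (phase (-form Θ (toInt t) (toInt q - toInt t)) : ℂ) •
        (delta (q - t) : EllTwo (ι → ℕ)) else 0 := by
  classical
  split_ifs with h
  · have h1 := leftReg_delta (cocycleNat Θ) t (q - t)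
    rw [add_tsub_cancel_of_le h, cocycleNat_eq_phase, toInt_sub h] at h1
    have h2 : (delta q : EllTwo (ι → ℕ)) =
        (phase (-form Θ (toInt t) (toInt q - toInt t)) : ℂ) •
          leftReg (cocycleNat Θ) t (delta (q - t)) := by
      rw [h1, smul_smul, ← Circle.coe_mul, ← phase_add]
      simp
    conv_lhs => rw [h2]
    rw [map_smul]
    congr 1
    exact DFunLike.congr_fun
      (star_weightedShift_mul_self (cocycleNat Θ t) (addLeftEmbedding t)) (delta (q - t))
  · ext m
    rw [← inner_delta, ContinuousLinearMap.star_eq_adjoint,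
      ContinuousLinearMap.adjoint_inner_right, leftReg_delta, inner_smul_left, inner_delta,
      delta_apply, if_neg]
    · simp
    · rintro rfl
      exact h le_self_add

/-! ### The spanning monomials of the Toeplitz algebra -/

/-- The element `σ(s,t) L_s L_t^*`. -/
def mono (Θ : Matrix ι ι ℝ) (s t : ι → ℕ) : Toeplitz Θ :=
  (phase (form Θ (toInt s) (toInt t)) : ℂ) • (L Θ s * star (L Θ t))

/-- The factor σ(s,t) in `mono` cancels the part of the phase that depends on s and t separately.
What remains is the phase of U_{s-t}, cut down to the basis vectors above t. -/
theorem mono_delta {Θ : Matrix ι ι ℝ} (hΘ : Θ.transpose = -Θ) (s t q : ι → ℕ)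
    [Decidable (t ≤ q)] :
    (mono Θ s t : BddOp (ι → ℕ)) (delta q) =
      if t ≤ q then (phase (form Θ (toInt s - toInt t) (toInt q)) : ℂ) •
        (delta (q - t + s) : EllTwo (ι → ℕ)) else 0 := by
  change (phase (form Θ (toInt s) (toInt t)) : ℂ) •
    leftReg (cocycleNat Θ) s (star (leftReg (cocycleNat Θ) t) (delta q)) = _
  rw [star_leftReg_delta]
  split_ifs with h
  · rw [map_smul, leftReg_delta, cocycleNat_eq_phase, smul_smul, smul_smul, ← coe_phase_add,
      ← coe_phase_add, add_comm s, toInt_sub h]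
    congr 3
    have h1 := form_self (toInt t) hΘ
    simp only [form_sub_left, form_sub_right]
    linarith
  · simp

theorem L_zero (Θ : Matrix ι ι ℝ) : L Θ 0 = 1 := by
  apply Subtype.ext
  refine ext_delta fun q => ?_
  change leftReg (cocycleNat Θ) 0 (delta q) = delta q
  rw [leftReg_delta, cocycleNat_eq_phase]
  simp

theorem L_eq_mono (Θ : Matrix ι ι ℝ) (s : ι → ℕ) : L Θ s = mono Θ s 0 := by
  simp [mono, L_zero]

@[simp] theorem mono_zero_zero (Θ : Matrix ι ι ℝ) : mono Θ 0 0 = 1 := by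
  rw [← L_eq_mono, L_zero]

/-- Since t + (u - t) = u + (t - u) is the supremum of t and u, the middle factor L_t^* L_u equals
L_{u-t} L_{t-u}^* up to a phase. Subtraction is truncated, so monomials are closed under
multiplication; the phase sees only the integer differences. -/
theorem mono_mul {Θ : Matrix ι ι ℝ} (hΘ : Θ.transpose = -Θ) (s t u v : ι → ℕ) :
    mono Θ s t * mono Θ u v =
      (phase (form Θ (toInt s - toInt t) (toInt u - toInt v)) : ℂ) •
        mono Θ (s + (u - t)) (v + (t - u)) := by
  classical
  apply Subtype.ext
  refine ext_delta fun q => ?_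
  change (mono Θ s t : BddOp (ι → ℕ)) ((mono Θ u v : BddOp (ι → ℕ)) (delta q)) =
    (phase (form Θ (toInt s - toInt t) (toInt u - toInt v)) : ℂ) •
      (mono Θ (s + (u - t)) (v + (t - u)) : BddOp (ι → ℕ)) (delta q)
  rw [mono_delta hΘ, mono_delta hΘ]
  have hdiff : toInt (s + (u - t)) - toInt (v + (t - u)) =
      (toInt s - toInt t) + (toInt u - toInt v) := by
    ext i
    simp only [toInt, Pi.add_apply, Pi.sub_apply]
    omega
  by_cases h1 : v ≤ q
  · rw [if_pos h1, map_smul, mono_delta hΘ]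
    by_cases h2 : t ≤ q - v + u
    · have h3 : v + (t - u) ≤ q := fun i => by
        have h1i : v i ≤ q i := h1 i
        have h2i : t i ≤ q i - v i + u i := h2 i
        change v i + (t i - u i) ≤ q i
        omega
      have hq : q - v + u - t + s = q - (v + (t - u)) + (s + (u - t)) := by
        ext i
        have h1i : v i ≤ q i := h1 i
        have h2i : t i ≤ q i - v i + u i := h2 i
        simp only [Pi.add_apply, Pi.sub_apply]
        omega
      rw [if_pos h2, if_pos h3, smul_smul, smul_smul, ← coe_phase_add, ← coe_phase_add, hdiff, hq]
      congr 3
      rw [toInt_add, toInt_sub h1]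
      simp only [form_sub_left, form_sub_right, form_add_left, form_add_right]
      ring
    · have h3 : ¬ v + (t - u) ≤ q := fun h => h2 fun i => by
        have h1i : v i ≤ q i := h1 i
        have hi : v i + (t i - u i) ≤ q i := h i
        change t i ≤ q i - v i + u i
        omega
      rw [if_neg h2, if_neg h3]
      simp
  · have h3 : ¬ v + (t - u) ≤ q := fun h => h1 (le_trans le_self_add h)
    rw [if_neg h1, if_neg h3]
    simp

theorem star_mono {Θ : Matrix ι ι ℝ} (hΘ : Θ.transpose = -Θ) (s t : ι → ℕ) :
    star (mono Θ s t) = mono Θ t s := by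
  rw [mono, mono, star_smul, star_mul, star_star, star_coe_phase, form_swap _ _ hΘ]
  simp

/-- The linear span of the monomials. -/
def monoSpan (Θ : Matrix ι ι ℝ) : Submodule ℂ (Toeplitz Θ) :=
  Submodule.span ℂ (Set.range fun p : (ι → ℕ) × (ι → ℕ) => mono Θ p.1 p.2)

theorem mono_mem_monoSpan (Θ : Matrix ι ι ℝ) (s t : ι → ℕ) : mono Θ s t ∈ monoSpan Θ :=
  Submodule.subset_span ⟨(s, t), rfl⟩

theorem mul_mem_monoSpan {Θ : Matrix ι ι ℝ} (hΘ : Θ.transpose = -Θ) {a b : Toeplitz Θ}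
    (ha : a ∈ monoSpan Θ) (hb : b ∈ monoSpan Θ) : a * b ∈ monoSpan Θ := by
  have h := Submodule.mul_mem_mul ha hb
  rw [monoSpan, Submodule.span_mul_span] at h
  refine Submodule.span_le.2 ?_ h
  rintro _ ⟨_, ⟨p, rfl⟩, _, ⟨q, rfl⟩, rfl⟩
  simp only [mono_mul hΘ]
  exact Submodule.smul_mem _ _ (mono_mem_monoSpan _ _ _)

theorem star_mem_monoSpan {Θ : Matrix ι ι ℝ} (hΘ : Θ.transpose = -Θ) {a : Toeplitz Θ}
    (ha : a ∈ monoSpan Θ) : star a ∈ monoSpan Θ := by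
  induction ha using Submodule.span_induction with
  | mem x hx =>
    obtain ⟨p, rfl⟩ := hx
    simp only [star_mono hΘ]
    exact mono_mem_monoSpan _ _ _
  | zero => simp
  | add x y _ _ hx hy => rw [star_add]; exact add_mem hx hy
  | smul c x _ hx => rw [star_smul]; exact Submodule.smul_mem _ _ hx

/-- The span is a unital *-subalgebra containing the generators, so its closure is everything. -/
theorem dense_monoSpan {Θ : Matrix ι ι ℝ} (hΘ : Θ.transpose = -Θ) :
    Dense (monoSpan Θ : Set (Toeplitz Θ)) := by
  let S : StarSubalgebra ℂ (Toeplitz Θ) :=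
    { carrier := monoSpan Θ
      mul_mem' := mul_mem_monoSpan hΘ
      add_mem' := add_mem
      algebraMap_mem' := fun c => by
        rw [Algebra.algebraMap_eq_smul_one, ← mono_zero_zero Θ]
        exact Submodule.smul_mem _ _ (mono_mem_monoSpan _ _ _)
      star_mem' := star_mem_monoSpan hΘ }
  have hle : StarAlgebra.adjoin ℂ (Set.range (leftReg (cocycleNat Θ))) ≤
      S.map (Toeplitz Θ).subtype := by
    refine StarAlgebra.adjoin_le ?_
    rintro _ ⟨p, rfl⟩
    refine ⟨L Θ p, ?_, rfl⟩
    change L Θ p ∈ monoSpan Θ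
    rw [L_eq_mono]
    exact mono_mem_monoSpan _ _ _
  intro A
  rw [Topology.IsInducing.subtypeVal.closure_eq_preimage_closure_image]
  exact closure_mono hle A.2

end

/-! ### Norm comparison and the quotient map to the noncommutative torus -/

section

variable {ι : Type*} [Fintype ι] {Θ : Matrix ι ι ℝ}

/-! ### Density arguments -/

theorem toeplitz_induction (hΘ : Θ.transpose = -Θ) {P : Toeplitz Θ → Prop}
    (hP : IsClosed {a | P a}) (hmono : ∀ s t, P (mono Θ s t))
    (hzero : P 0) (hadd : ∀ a b, P a → P b → P (a + b)) (hsmul : ∀ (c : ℂ) a, P a → P (c • a))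
    (a : Toeplitz Θ) : P a := by
  have hsub : (monoSpan Θ : Set (Toeplitz Θ)) ⊆ {a | P a} := by
    intro b hb
    induction hb using Submodule.span_induction with
    | mem x hx => obtain ⟨p, rfl⟩ := hx; exact hmono _ _
    | zero => exact hzero
    | add x y _ _ hx hy => exact hadd _ _ hx hy
    | smul c x _ hx => exact hsmul _ _ hx
  exact hP.closure_subset_iff.2 hsub (dense_monoSpan hΘ a)

theorem toeplitz_clm_ext (hΘ : Θ.transpose = -Θ) {F : Type*} [TopologicalSpace F]
    [AddCommMonoid F] [Module ℂ F] [T2Space F] {f g : Toeplitz Θ →L[ℂ] F}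
    (h : ∀ s t, f (mono Θ s t) = g (mono Θ s t)) : f = g := by
  ext a
  refine toeplitz_induction hΘ (P := fun a => f a = g a) (isClosed_eq f.continuous g.continuous)
    h (by simp) (fun a b ha hb => ?_) (fun c a ha => ?_) a
  · simp only [map_add, ha, hb]
  · simp only [map_smul, ha]

theorem smul_delta {P : Type*} [DecidableEq P] (p : P) (c : ℂ) :
    c • (delta p : EllTwo P) = lp.single 2 p c := by
  ext q
  rw [lp.coeFn_smul, Pi.smul_apply, delta_apply, lp.single_apply]
  by_cases h : q = p
  · subst h; simp
  · simp [h]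

theorem dense_span_delta (P : Type*) :
    Dense (Submodule.span ℂ (Set.range (delta : P → EllTwo P)) : Set (EllTwo P)) := by
  classical
  intro f
  refine mem_closure_of_tendsto (lp.hasSum_single (by simp) f) (Filter.Eventually.of_forall ?_)
  intro s
  refine Submodule.sum_mem _ fun i _ => ?_
  rw [← smul_delta]
  exact Submodule.smul_mem _ _ (Submodule.subset_span ⟨i, rfl⟩)

theorem opNorm_le_of_span_delta {P : Type*} {F : Type*} [NormedAddCommGroup F] [NormedSpace ℂ F]
    (B : EllTwo P →L[ℂ] F) {C : ℝ} (hC : 0 ≤ C)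
    (h : ∀ ξ ∈ Submodule.span ℂ (Set.range (delta : P → EllTwo P)), ‖B ξ‖ ≤ C * ‖ξ‖) :
    ‖B‖ ≤ C := by
  refine B.opNorm_le_bound hC fun ξ => ?_
  have hcl : IsClosed {ξ : EllTwo P | ‖B ξ‖ ≤ C * ‖ξ‖} :=
    isClosed_le (by fun_prop) (by fun_prop)
  exact hcl.closure_subset_iff.2 (fun ξ hξ => h ξ hξ) (dense_span_delta P ξ)

/-! ### The homomorphism onto the noncommutative torus -/

theorem orthonormal_delta_comp {P Q : Type*} (w : P → Circle) (s : P ↪ Q) :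
    Orthonormal ℂ (fun p : P => (w p : ℂ) • (delta (s p) : EllTwo Q)) := by
  classical
  rw [orthonormal_iff_ite]
  intro i j
  rw [inner_smul_left, inner_smul_right, inner_delta, delta_apply]
  by_cases h : i = j
  · subst h
    simp [← Circle.coe_inv_eq_conj]
  · simp [h]

/-- The isometry `δ_n ↦ conj σ(n - w, w) δ_{n-w}` of `ℓ²(ℕ^ι)` into `ℓ²(ℤ^ι)`. -/
def shiftBack (Θ : Matrix ι ι ℝ) (w : ι → ℕ) : EllTwo (ι → ℕ) →ₗᵢ[ℂ] EllTwo (ι → ℤ) :=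
  (orthonormal_delta_comp (fun n : ι → ℕ => phase (-form Θ (toInt n - toInt w) (toInt w)))
    ⟨fun n => toInt n - toInt w, fun _ _ h =>
      toInt_injective (sub_left_injective h)⟩).orthogonalFamily.linearIsometry

theorem shiftBack_delta (w n : ι → ℕ) : shiftBack Θ w (delta n) =
    (phase (-form Θ (toInt n - toInt w) (toInt w)) : ℂ) •
      (delta (toInt n - toInt w) : EllTwo (ι → ℤ)) := by
  classical
  have h2 : (delta n : EllTwo (ι → ℕ)) = lp.single 2 n (1 : ℂ) := by
    unfold delta
    convert rfl
  rw [shiftBack, h2, OrthogonalFamily.linearIsometry_apply_single]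
  simp
  rfl

/-- Above t the truncation in `mono` is invisible, and the phase in `shiftBack` makes translation by
-w intertwine the two twisted translations. -/
theorem shiftBack_mono_delta (hΘ : Θ.transpose = -Θ) (s t w n : ι → ℕ) (h : t ≤ n) :
    shiftBack Θ w ((mono Θ s t : BddOp (ι → ℕ)) (delta n)) =
      ((U Θ (toInt s - toInt t) : NCTorus Θ) : BddOp (ι → ℤ)) (shiftBack Θ w (delta n)) := by
  classical
  rw [mono_delta hΘ, if_pos h, map_smul, shiftBack_delta, shiftBack_delta, map_smul]
  change _ = _ • leftReg (cocycleInt Θ) _ (delta _)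
  rw [leftReg_delta, cocycleInt_eq_phase, smul_smul, smul_smul, ← coe_phase_add, ← coe_phase_add,
    toInt_add, toInt_sub h]
  have hn : toInt n - toInt t + toInt s - toInt w =
      toInt s - toInt t + (toInt n - toInt w) := by abel
  rw [hn]
  congr 3
  simp only [form_sub_left, form_sub_right, form_add_left]
  ring

/-- A finitely supported vector can be moved beyond any given T by a large enough translation. The
statement covers all large w so that it survives sums. -/
theorem exists_shiftBack_eq (Θ : Matrix ι ι ℝ) (T : ι → ℕ) (ξ : EllTwo (ι → ℤ))
    (hξ : ξ ∈ Submodule.span ℂ (Set.range (delta : (ι → ℤ) → EllTwo (ι → ℤ)))) :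
    ∃ w₀, ∀ w, w₀ ≤ w →
      ∃ η ∈ Submodule.span ℂ ((delta : (ι → ℕ) → EllTwo (ι → ℕ)) '' {n | T ≤ n}),
        shiftBack Θ w η = ξ := by
  induction hξ using Submodule.span_induction with
  | mem x hx =>
    obtain ⟨q, rfl⟩ := hx
    refine ⟨T + fun i => (q i).natAbs, fun w hw => ?_⟩
    have hw' : ∀ i, T i + (q i).natAbs ≤ w i := hw
    set n : ι → ℕ := fun i => (q i + w i).toNat with hn
    have hnq : toInt n - toInt w = q := by
      ext i
      have := hw' i
      simp only [hn, toInt, Pi.sub_apply]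
      omega
    have hTn : T ≤ n := fun i => by
      have := hw' i
      simp only [hn]
      omega
    refine ⟨(phase (form Θ q (toInt w)) : ℂ) • delta n,
      Submodule.smul_mem _ _ (Submodule.subset_span ⟨n, hTn, rfl⟩), ?_⟩
    rw [map_smul, shiftBack_delta, smul_smul, ← coe_phase_add, hnq]
    simp
  | zero => exact ⟨0, fun w _ => ⟨0, Submodule.zero_mem _, map_zero _⟩⟩
  | add x y _ _ hx hy =>
    obtain ⟨w₁, h₁⟩ := hx
    obtain ⟨w₂, h₂⟩ := hy
    refine ⟨w₁ ⊔ w₂, fun w hw => ?_⟩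
    obtain ⟨η₁, hη₁, e₁⟩ := h₁ w (le_sup_left.trans hw)
    obtain ⟨η₂, hη₂, e₂⟩ := h₂ w (le_sup_right.trans hw)
    exact ⟨η₁ + η₂, add_mem hη₁ hη₂, by rw [map_add, e₁, e₂]⟩
  | smul c x _ hx =>
    obtain ⟨w₁, h₁⟩ := hx
    refine ⟨w₁, fun w hw => ?_⟩
    obtain ⟨η₁, hη₁, e₁⟩ := h₁ w hw
    exact ⟨c • η₁, Submodule.smul_mem _ _ hη₁, by rw [map_smul, e₁]⟩

/-- Linear combinations of monomials. -/
def monoComb (Θ : Matrix ι ι ℝ) : ((ι → ℕ) × (ι → ℕ) →₀ ℂ) →ₗ[ℂ] Toeplitz Θ :=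
  Finsupp.linearCombination ℂ fun p => mono Θ p.1 p.2

theorem denseRange_monoComb (hΘ : Θ.transpose = -Θ) : DenseRange (monoComb Θ) := by
  have h : Set.range (monoComb Θ) = (monoSpan Θ : Set (Toeplitz Θ)) := by
    rw [monoSpan, ← Finsupp.range_linearCombination]
    rfl
  rw [DenseRange, h]
  exact dense_monoSpan hΘ

/-- The linear combinations of the unitaries `U_{s-t}`. -/
def torusComb (Θ : Matrix ι ι ℝ) : ((ι → ℕ) × (ι → ℕ) →₀ ℂ) →ₗ[ℂ] NCTorus Θ :=
  Finsupp.linearCombination ℂ fun p => (U Θ (toInt p.1 - toInt p.2) : NCTorus Θ)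

/-- Far inside the positive cone a finite combination of monomials acts exactly like the
corresponding combination of the U_{s-t}. Moving a test vector there by an isometry bounds the torus
norm by the Toeplitz norm, and this lets the quotient map extend by continuity. -/
theorem norm_torusComb_le (hΘ : Θ.transpose = -Θ) (c : (ι → ℕ) × (ι → ℕ) →₀ ℂ) :
    ‖torusComb Θ c‖ ≤ ‖monoComb Θ c‖ := by
  refine opNorm_le_of_span_delta (torusComb Θ c : BddOp (ι → ℤ)) (norm_nonneg _) fun ξ hξ => ?_
  -- Any common upper bound of the finitely many truncation points would serve; the sum is one.
  let T : ι → ℕ := ∑ p ∈ c.support, p.2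
  obtain ⟨w, hw⟩ := exists_shiftBack_eq Θ T ξ hξ
  obtain ⟨η, hη, rfl⟩ := hw w le_rfl
  have key : ((torusComb Θ c : NCTorus Θ) : BddOp (ι → ℤ)) (shiftBack Θ w η) =
      shiftBack Θ w ((monoComb Θ c : BddOp (ι → ℕ)) η) := by
    have hcoe1 : ((torusComb Θ c : NCTorus Θ) : BddOp (ι → ℤ)) =
        ∑ p ∈ c.support, c p • ((U Θ (toInt p.1 - toInt p.2) : NCTorus Θ) : BddOp (ι → ℤ)) := by
      simp [torusComb, Finsupp.linearCombination_apply, Finsupp.sum]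
    have hcoe2 : ((monoComb Θ c : Toeplitz Θ) : BddOp (ι → ℕ)) =
        ∑ p ∈ c.support, c p • (mono Θ p.1 p.2 : BddOp (ι → ℕ)) := by
      simp [monoComb, Finsupp.linearCombination_apply, Finsupp.sum]
    clear hw hξ
    induction hη using Submodule.span_induction with
    | mem x hx =>
      obtain ⟨n, hn, rfl⟩ := hx
      rw [hcoe1, hcoe2, sum_apply, sum_apply, map_sum]
      refine Finset.sum_congr rfl fun p hp => ?_
      rw [smul_apply, smul_apply, map_smul,
        shiftBack_mono_delta hΘ]
      exact le_trans (Finset.single_le_sum (f := fun p : (ι → ℕ) × (ι → ℕ) => p.2)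
        (fun _ _ => zero_le) hp) hn
    | zero => simp
    | add x y _ _ hx hy => simp only [map_add, hx, hy]
    | smul a x _ hx => simp only [map_smul, hx]
  rw [key, (shiftBack Θ w).norm_map, (shiftBack Θ w).norm_map]
  exact ContinuousLinearMap.le_opNorm _ _

instance {P : Type*} [AddCancelCommMonoid P] (σ : P → P → Circle) :
    CompleteSpace (reducedAlg σ) :=
  (StarSubalgebra.isClosed_topologicalClosure _).completeSpace_coe

/-- The continuous linear map with `σ(s,t) L_s L_t^* ↦ U_{s-t}`. -/
def toTorusLin (Θ : Matrix ι ι ℝ) : Toeplitz Θ →L[ℂ] NCTorus Θ :=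
  (torusComb Θ).extendOfNorm (monoComb Θ)

theorem toTorusLin_mono (hΘ : Θ.transpose = -Θ) (s t : ι → ℕ) :
    toTorusLin Θ (mono Θ s t) = (U Θ (toInt s - toInt t) : NCTorus Θ) := by
  have h := LinearMap.extendOfNorm_eq (f := torusComb Θ) (e := monoComb Θ)
    (denseRange_monoComb hΘ) ⟨1, fun x => by rw [one_mul]; exact norm_torusComb_le hΘ x⟩
    (Finsupp.single (s, t) 1)
  simpa [monoComb, torusComb, toTorusLin] using h

theorem U_mul (Θ : Matrix ι ι ℝ) (x y : ι → ℤ) :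
    ((U Θ x : NCTorus Θ) * (U Θ y : NCTorus Θ)) =
      (phase (form Θ x y) : ℂ) • (U Θ (x + y) : NCTorus Θ) := by
  apply Subtype.ext
  refine ext_delta fun q => ?_
  change leftReg (cocycleInt Θ) x (leftReg (cocycleInt Θ) y (delta q)) =
    (phase (form Θ x y) : ℂ) • leftReg (cocycleInt Θ) (x + y) (delta q)
  simp only [leftReg_delta, map_smul, smul_smul, cocycleInt_eq_phase, ← coe_phase_add,
    form_add_left, form_add_right, add_assoc]
  congr 3
  ring

theorem U_zero (Θ : Matrix ι ι ℝ) : U Θ 0 = 1 := by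
  apply Subtype.ext
  apply Subtype.ext
  refine ext_delta fun q => ?_
  change leftReg (cocycleInt Θ) 0 (delta q) = delta q
  rw [leftReg_delta, cocycleInt_eq_phase]
  simp

theorem star_U (hΘ : Θ.transpose = -Θ) (x : ι → ℤ) :
    star (U Θ x : NCTorus Θ) = (U Θ (-x) : NCTorus Θ) := by
  refine left_inv_eq_right_inv (U Θ x).2.1 ?_
  rw [U_mul, form_neg_right, form_self x hΘ]
  simp [U_zero]

/-- The unital `*`-homomorphism `𝒯_r(ℕ^ι, σ_Θ) → 𝒜_Θ` with `L_p ↦ U_p`. -/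
def toTorus (hΘ : Θ.transpose = -Θ) : Toeplitz Θ →⋆ₐ[ℂ] NCTorus Θ :=
  have hone : toTorusLin Θ 1 = 1 := by
    rw [← mono_zero_zero, toTorusLin_mono hΘ]
    simp [U_zero]
  have hmul : ∀ a b, toTorusLin Θ (a * b) = toTorusLin Θ a * toTorusLin Θ b := by
    intro a b
    refine toeplitz_induction hΘ
      (P := fun a => toTorusLin Θ (a * b) = toTorusLin Θ a * toTorusLin Θ b)
      (isClosed_eq (by fun_prop) (by fun_prop)) (fun s t => ?_) (by simp)
      (fun a a' h h' => by simp only [add_mul, map_add, h, h'])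
      (fun c a h => by simp only [smul_mul_assoc, map_smul, h]) a
    refine toeplitz_induction hΘ
      (P := fun b => toTorusLin Θ (mono Θ s t * b) = toTorusLin Θ (mono Θ s t) * toTorusLin Θ b)
      (isClosed_eq (by fun_prop) (by fun_prop)) (fun u v => ?_) (by simp)
      (fun a a' h h' => by simp only [mul_add, map_add, h, h'])
      (fun c a h => by simp only [mul_smul_comm, map_smul, h]) b
    rw [mono_mul hΘ, map_smul, toTorusLin_mono hΘ, toTorusLin_mono hΘ, toTorusLin_mono hΘ, U_mul]
    congr 4
    ext i
    simp only [toInt, Pi.add_apply, Pi.sub_apply]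
    omega
  have hstar : ∀ a, toTorusLin Θ (star a) = star (toTorusLin Θ a) := by
    intro a
    refine toeplitz_induction hΘ (P := fun a => toTorusLin Θ (star a) = star (toTorusLin Θ a))
      (isClosed_eq (by fun_prop) (by fun_prop)) (fun s t => ?_) (by simp)
      (fun a a' h h' => by simp only [star_add, map_add, h, h'])
      (fun c a h => by simp only [star_smul, map_smul, h]) a
    rw [star_mono hΘ, toTorusLin_mono hΘ, toTorusLin_mono hΘ, star_U hΘ, neg_sub]
  { toFun := toTorusLin Θ
    map_one' := hone
    map_mul' := hmul
    map_zero' := map_zero _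
    map_add' := map_add _
    commutes' := fun c => by
      simp only [Algebra.algebraMap_eq_smul_one, map_smul, hone]
    map_star' := hstar }

theorem toTorus_mono (hΘ : Θ.transpose = -Θ) (s t : ι → ℕ) :
    toTorus hΘ (mono Θ s t) = (U Θ (toInt s - toInt t) : NCTorus Θ) :=
  toTorusLin_mono hΘ s t

theorem toTorus_L (hΘ : Θ.transpose = -Θ) (s : ι → ℕ) :
    toTorus hΘ (L Θ s) = (U Θ (toInt s) : NCTorus Θ) := by
  rw [L_eq_mono, toTorus_mono]
  simp

end

section

variable {ι : Type*} [Fintype ι] {Θ : Matrix ι ι ℝ}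

/-! ### The KMS condition on monomials -/

/-- The pairing `⟨x, r⟩`. -/
def energy (r : ι → ℝ) (x : ι → ℤ) : ℝ := ∑ i, (x i : ℝ) * r i

theorem energy_add (r : ι → ℝ) (x y : ι → ℤ) : energy r (x + y) = energy r x + energy r y := by
  simp [energy, add_mul, Finset.sum_add_distrib]

theorem energy_neg (r : ι → ℝ) (x : ι → ℤ) : energy r (-x) = -energy r x := by
  simp [energy]

theorem energy_sub (r : ι → ℝ) (x y : ι → ℤ) : energy r (x - y) = energy r x - energy r y := by
  rw [sub_eq_add_neg, energy_add, energy_neg, sub_eq_add_neg]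

theorem energy_eq_dotProduct (r : ι → ℝ) (p : ι → ℕ) :
    (fun i => (p i : ℝ)) ⬝ᵥ r = energy r (toInt p) := by
  simp [dotProduct, energy, toInt]

theorem dynamics_L (r : ι → ℝ) (t : ℝ) (s : ι → ℕ) :
    dynamics Θ r t (L Θ s) = (Circle.exp (energy r (toInt s) * t) : ℂ) • L Θ s := by
  apply Subtype.ext
  change (dynUnitary r t : BddOp (ι → ℕ)) * leftReg (cocycleNat Θ) s *
    star (dynUnitary r t : BddOp (ι → ℕ)) = _
  rw [dynUnitary_conj_leftReg, energy_eq_dotProduct]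
  rfl

theorem dynamics_mono (r : ι → ℝ) (t : ℝ) (u v : ι → ℕ) :
    dynamics Θ r t (mono Θ u v) =
      Complex.exp (Complex.I * t * energy r (toInt u - toInt v)) • mono Θ u v := by
  have hs : dynamics Θ r t (star (L Θ v)) = star (dynamics Θ r t (L Θ v)) :=
    map_star (dynHom Θ r t) _
  rw [mono, map_smul, map_mul, hs, dynamics_L, dynamics_L, star_smul, smul_mul_smul_comm,
    smul_comm]
  congr 1
  have h : star (Circle.exp (energy r (toInt v) * t) : ℂ) =
      Circle.exp (-(energy r (toInt v) * t)) := by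
    rw [Circle.exp_neg, Circle.coe_inv_eq_conj]; rfl
  rw [h, ← Circle.coe_mul, ← Circle.exp_add, Circle.coe_exp, energy_sub]
  refine congrArg Complex.exp ?_
  push_cast
  ring

theorem continuous_dynamics (r : ι → ℝ) (t : ℝ) : Continuous (dynamics Θ r t) := by
  refine continuous_induced_rng.2 ?_
  change Continuous fun A : Toeplitz Θ => (dynUnitary r t : BddOp (ι → ℕ)) * A *
    star (dynUnitary r t : BddOp (ι → ℕ))
  fun_prop

theorem entire_eq_of_eq_on_real {f g : ℂ → ℂ} (hf : Differentiable ℂ f) (hg : Differentiable ℂ g)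
    (h : ∀ t : ℝ, f t = g t) : f = g := by
  have hfa : AnalyticOnNhd ℂ f Set.univ := fun z _ => hf.analyticAt z
  have hga : AnalyticOnNhd ℂ g Set.univ := fun z _ => hg.analyticAt z
  refine hfa.eq_of_frequently_eq hga (z₀ := 0) ?_
  have hc : Filter.Tendsto (fun n : ℕ => (((1 / ((n : ℝ) + 1)) : ℝ) : ℂ)) Filter.atTop
      (nhdsWithin 0 {0}ᶜ) := by
    refine tendsto_nhdsWithin_iff.2 ⟨?_, Filter.Eventually.of_forall fun n => ?_⟩
    · have := (Complex.continuous_ofReal.tendsto 0).comp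
        (tendsto_one_div_add_atTop_nhds_zero_nat (𝕜 := ℝ))
      simpa [Function.comp_def] using this
    · simp only [Set.mem_compl_iff, Set.mem_singleton_iff, Complex.ofReal_eq_zero]
      positivity
  exact hc.frequently (Filter.Frequently.of_forall fun n => h _)

/-- Monomials are eigenvectors of the dynamics, so one direction is evaluation at iβ. Conversely the
monomial identity passes by density to an arbitrary first factor, and the identity theorem for
entire functions identifies F(iβ) inside φ. -/
theorem mem_kmsStates_iff (hΘ : Θ.transpose = -Θ) (r : ι → ℝ) (β : ℝ) (hβ : 0 < β)
    (φ : WeakDual ℂ (Toeplitz Θ)) :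
    φ ∈ kmsStates (dynamics Θ r) β ↔ φ ∈ states (Toeplitz Θ) ∧ ∀ s t u v,
      φ (mono Θ s t * mono Θ u v) =
        Complex.exp (β * energy r (toInt u - toInt v)) * φ (mono Θ u v * mono Θ s t) := by
  refine and_congr_right fun _ => ⟨fun h s t u v => ?_, fun h a F hF hFa b => ?_⟩
  · have h1 := h (mono Θ u v)
      (fun z => Complex.exp (Complex.I * z * energy r (toInt u - toInt v)) • mono Θ u v)
      (by fun_prop) (fun t => (dynamics_mono r t u v).symm) (mono Θ s t)
    rw [h1, mul_smul_comm, map_smul, smul_eq_mul, ← mul_assoc, ← Complex.exp_add]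
    have h2 : (β * energy r (toInt u - toInt v) +
        Complex.I * (Complex.I * β) * energy r (toInt u - toInt v) : ℂ) = 0 := by
      linear_combination (β * energy r (toInt u - toInt v) : ℂ) * Complex.I_sq
    rw [h2, Complex.exp_zero, one_mul]
  · have hφ : Continuous φ := map_continuous φ
    -- Invariance under the dynamics: taking the other monomial to be 1 gives φ(m) = e^{βE} φ(m), so
    -- φ kills every monomial of nonzero energy.
    have hinv : ∀ (t : ℝ) x, φ (dynamics Θ r t x) = φ x := by
      intro t x
      refine toeplitz_induction hΘ (P := fun x => φ (dynamics Θ r t x) = φ x)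
        (isClosed_eq (hφ.comp (continuous_dynamics r t)) hφ) (fun u v => ?_) (by simp)
        (fun a b ha hb => by simp only [map_add, ha, hb])
        (fun c a ha => by simp only [map_smul, ha]) x
      have h0 := h 0 0 u v
      rw [mono_zero_zero, one_mul, mul_one] at h0
      rw [dynamics_mono, map_smul, smul_eq_mul]
      by_cases hz : energy r (toInt u - toInt v) = 0
      · simp [hz]
      · have h1 : Complex.exp (β * energy r (toInt u - toInt v)) ≠ 1 := by
          rw [← Complex.ofReal_mul, ← Complex.ofReal_exp]
          norm_cast
          rw [Real.exp_eq_one_iff]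
          exact mul_ne_zero hβ.ne' hz
        have h2 : φ (mono Θ u v) = 0 := by
          have : (Complex.exp (β * energy r (toInt u - toInt v)) - 1) * φ (mono Θ u v) = 0 := by
            linear_combination -h0
          exact (mul_eq_zero.1 this).resolve_left (sub_ne_zero.2 h1)
        rw [h2, mul_zero]
    have hF' : Continuous fun b : Toeplitz Θ => φ (b * F (Complex.I * β)) := by fun_prop
    refine toeplitz_induction hΘ (P := fun b => φ (a * b) = φ (b * F (Complex.I * β)))
      (isClosed_eq (by fun_prop) hF') (fun u v => ?_) (by simp)
      (fun a b ha hb => by simp only [mul_add, add_mul, map_add, ha, hb])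
      (fun c a ha => by simp only [mul_smul_comm, smul_mul_assoc, map_smul, ha]) b
    have hswap : φ (a * mono Θ u v) =
        Complex.exp (β * energy r (toInt u - toInt v)) * φ (mono Θ u v * a) := by
      refine toeplitz_induction hΘ (P := fun a => φ (a * mono Θ u v) =
          Complex.exp (β * energy r (toInt u - toInt v)) * φ (mono Θ u v * a))
        (isClosed_eq (by fun_prop) (by fun_prop)) (fun s t => h s t u v) (by simp)
        (fun a b ha hb => by simp only [mul_add, add_mul, map_add, ha, hb])
        (fun c a ha => by
          simp only [mul_smul_comm, smul_mul_assoc, map_smul, ha, smul_eq_mul]; ring) a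
    -- Both sides are entire in z and agree for real z by invariance. At z = iβ the right side
    -- produces the factor e^{βE} of the monomial identity.
    have hG : (fun z => φ (mono Θ u v * F z)) = fun z =>
        Complex.exp (-(Complex.I * z * energy r (toInt u - toInt v))) * φ (mono Θ u v * a) := by
      refine entire_eq_of_eq_on_real ?_ (by fun_prop) fun t => ?_
      · have h1 : Differentiable ℂ fun z => mono Θ u v * F z := by fun_prop
        exact (ContinuousLinearMap.differentiable (WeakDual.toStrongDual φ)).comp h1
      · have h1 : mono Θ u v * dynamics Θ r t a =
            Complex.exp (-(Complex.I * t * energy r (toInt u - toInt v))) •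
              dynamics Θ r t (mono Θ u v * a) := by
          rw [map_mul, dynamics_mono, smul_mul_assoc, smul_smul, ← Complex.exp_add,
            neg_add_cancel, Complex.exp_zero, one_smul]
        rw [hFa, h1, map_smul, hinv, smul_eq_mul]
    rw [hswap, congrFun hG (Complex.I * β)]
    congr 2
    linear_combination (β * energy r (toInt u - toInt v) : ℂ) * Complex.I_sq

end

/-! ### The degeneracy lattice H: sign functions and Følner boxes -/

section

/-! ### Words in the unitaries of the degenerate directions -/

theorem form_zsmul_left {ι : Type*} [Fintype ι] (Θ : Matrix ι ι ℝ) (x y : ι → ℤ) (n : ℤ) :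
    form Θ (n • x) y = n * form Θ x y := by
  rw [form, form, ← smul_eq_mul, ← smul_dotProduct]
  congr 1
  ext i
  simp

/-- Antisymmetry makes the cocycle trivial on each line ℤx. -/
theorem U_zpow {ι : Type*} [Fintype ι] {Θ : Matrix ι ι ℝ} (hΘ : Θ.transpose = -Θ) (x : ι → ℤ)
    (n : ℤ) : U Θ x ^ n = U Θ (n • x) := by
  let f : Multiplicative ℤ →* unitary (NCTorus Θ) :=
    { toFun := fun n => U Θ (n.toAdd • x)
      map_one' := by simp [U_zero]
      map_mul' := fun a b => by
        apply Subtype.ext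
        have h0 : form Θ (a.toAdd • x) (b.toAdd • x) = 0 := by
          rw [form_zsmul_left, form_swap _ _ hΘ, form_zsmul_left, form_self x hΘ]
          simp
        change _ = (U Θ (a.toAdd • x) : NCTorus Θ) * (U Θ (b.toAdd • x) : NCTorus Θ)
        rw [U_mul, h0, toAdd_mul, add_smul]
        simp }
  have h := MonoidHom.apply_mint _ f (Multiplicative.ofAdd n)
  simpa [f] using h.symm

theorem prod_ofFn_mul {M : Type*} [Monoid M] {m : ℕ} (f g : Fin m → M)
    (h : ∀ i j, Commute (g i) (f j)) :
    (List.ofFn fun j => f j * g j).prod = (List.ofFn f).prod * (List.ofFn g).prod := by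
  induction m with
  | zero => simp
  | succ m ih =>
    simp only [List.ofFn_succ, List.prod_cons]
    rw [ih (fun j => f j.succ) (fun j => g j.succ) fun i j => h _ _]
    have hc : Commute (g 0) (List.ofFn fun j : Fin m => f j.succ).prod := by
      refine Commute.list_prod_right _ _ fun y hy => ?_
      obtain ⟨j, rfl⟩ := (List.mem_ofFn' _ _).1 hy
      exact h _ _
    calc f 0 * g 0 * ((List.ofFn fun j : Fin m => f j.succ).prod *
          (List.ofFn fun j : Fin m => g j.succ).prod)
        = f 0 * (g 0 * (List.ofFn fun j : Fin m => f j.succ).prod) *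
          (List.ofFn fun j : Fin m => g j.succ).prod := by simp only [mul_assoc]
      _ = _ := by rw [hc.eq]; simp only [mul_assoc]

variable {d m : ℕ} {D : Matrix (Fin d) (Fin d) ℝ}

theorem mem_degeneracyGroup {x : Fin d → ℤ} :
    x ∈ degeneracyGroup D ↔ ∀ y, ∃ N : ℤ, form D x y = N := Iff.rfl

theorem phase_two_mul_form {x : Fin d → ℤ} (hx : x ∈ degeneracyGroup D) (y : Fin d → ℤ) :
    phase (2 * form D x y) = 1 := by
  obtain ⟨N, hN⟩ := mem_degeneracyGroup.1 hx y
  rw [hN, phase_two_mul_int]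

theorem mem_degeneracyGroup_of_phase {x : Fin d → ℤ}
    (h : ∀ w : Fin d → ℕ, phase (2 * form D x (toInt w)) = 1) : x ∈ degeneracyGroup D := by
  intro y
  have hy : y = toInt (fun i => (y i).toNat) - toInt (fun i => (-y i).toNat) := by
    ext i
    simp only [toInt, Pi.sub_apply]
    omega
  obtain ⟨N, hN⟩ := exists_int_of_phase_two_mul (h fun i => (y i).toNat)
  obtain ⟨N', hN'⟩ := exists_int_of_phase_two_mul (h fun i => (-y i).toNat)
  refine ⟨N - N', ?_⟩
  change form D x y = _
  rw [hy, form_sub_right, hN, hN']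
  push_cast
  rfl

/-- Each merging of two unitaries costs a phase exp(-πi N) with N an integer, so the total phase
squares to one. -/
theorem exists_sign_prod_U (x : Fin m → Fin d → ℤ) (hx : ∀ j, x j ∈ degeneracyGroup D) :
    ∃ ε : Circle, ε ^ 2 = 1 ∧
      (((List.ofFn fun j => U D (x j)).prod : unitary (NCTorus D)) : NCTorus D) =
        (ε : ℂ) • (U D (∑ j, x j) : NCTorus D) := by
  induction m with
  | zero => exact ⟨1, by simp, by simp [U_zero]⟩
  | succ m ih =>
    obtain ⟨ε, hε, h⟩ := ih (fun j => x j.succ) fun j => hx _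
    refine ⟨ε * phase (form D (x 0) (∑ j : Fin m, x j.succ)), ?_, ?_⟩
    · rw [mul_pow, hε, one_mul, sq, ← phase_add, ← two_mul, phase_two_mul_form (hx 0)]
    · rw [List.ofFn_succ, List.prod_cons, Fin.sum_univ_succ]
      change (U D (x 0) : NCTorus D) *
        (((List.ofFn fun j : Fin m => U D (x j.succ)).prod : unitary (NCTorus D)) : NCTorus D) = _
      rw [h, mul_smul_comm, U_mul, smul_smul, Circle.coe_mul]

/-- The element of `H` with coordinates `c`. -/
def lat (h : Module.Basis (Fin m) ℤ (degeneracyGroup D)) (c : Fin m → ℤ) : Fin d → ℤ :=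
  (h.equivFun.symm c : degeneracyGroup D)

section lat
variable (h : Module.Basis (Fin m) ℤ (degeneracyGroup D))

theorem lat_mem (c : Fin m → ℤ) : lat h c ∈ degeneracyGroup D := Subtype.property _

theorem lat_add (a b : Fin m → ℤ) : lat h (a + b) = lat h a + lat h b := by
  rw [lat, map_add]
  rfl

@[simp] theorem lat_zero : lat h 0 = 0 := by simp [lat]

theorem lat_neg (a : Fin m → ℤ) : lat h (-a) = -lat h a := by
  simp [lat]

theorem lat_injective : Function.Injective (lat h) := fun _ _ e =>
  h.equivFun.symm.injective (Subtype.ext e)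

theorem lat_repr {v : Fin d → ℤ} (hv : v ∈ degeneracyGroup D) : lat h (h.repr ⟨v, hv⟩) = v := by
  have : h.equivFun.symm (h.equivFun ⟨v, hv⟩) = ⟨v, hv⟩ := LinearEquiv.symm_apply_apply _ _
  exact congrArg Subtype.val this

theorem repr_lat (c : Fin m → ℤ) : (h.repr ⟨lat h c, lat_mem h c⟩ : Fin m → ℤ) = c :=
  h.equivFun.apply_symm_apply c

theorem lat_eq_sum (c : Fin m → ℤ) : lat h c = ∑ j, c j • (h j : Fin d → ℤ) := by
  simp [lat, Module.Basis.equivFun_symm_apply]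

/-- A sign function turning `c ↦ ε(c) U_{h·c}` into a representation of `ℤ^m`. -/
structure IsLatticeSign (ε : (Fin m → ℤ) → Circle) : Prop where
  sq_eq_one : ∀ c, ε c ^ 2 = 1
  map_add_eq : ∀ a b, ε (a + b) = ε a * ε b * phase (form D (lat h a) (lat h b))

theorem smul_U_injective (x : Fin d → ℤ) {a b : ℂ}
    (e : a • (U D x : NCTorus D) = b • (U D x : NCTorus D)) : a = b := by
  have h1 := congrArg (fun A : NCTorus D => A * star (U D x : NCTorus D)) e
  simp only [smul_mul_assoc] at h1
  rw [show (U D x : NCTorus D) * star (U D x : NCTorus D) = 1 from (U D x).2.2] at h1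
  have h2 := congrArg (fun A : NCTorus D => ((A : BddOp (Fin d → ℤ)) (delta 0)) 0) h1
  simpa [delta_apply] using h2

/-- The sign is read off from the ordered word in the U_{h_j}. These commute, so the word is
multiplicative in its exponents; comparing coefficients of U at the sum gives the cocycle identity.
-/
theorem exists_latticeSign (hD : D.transpose = -D) : ∃ ε : (Fin m → ℤ) → Circle,
    IsLatticeSign h ε ∧ ∀ c : Fin m → ℤ,
      (((List.ofFn fun j => U D (h j) ^ c j).prod : unitary (NCTorus D)) : NCTorus D) =
        (ε c : ℂ) • (U D (lat h c) : NCTorus D) := by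
  have hex : ∀ c : Fin m → ℤ, ∃ ε : Circle, ε ^ 2 = 1 ∧
      (((List.ofFn fun j => U D (h j) ^ c j).prod : unitary (NCTorus D)) : NCTorus D) =
        (ε : ℂ) • (U D (lat h c) : NCTorus D) := fun c => by
    simp only [U_zpow hD, lat_eq_sum]
    exact exists_sign_prod_U _ fun j => Submodule.smul_mem _ _ (h j).2
  choose ε hε2 hε using hex
  refine ⟨ε, ⟨hε2, fun a b => ?_⟩, hε⟩
  -- The two orders differ by inverse phases, which coincide because on H these phases are ±1.
  have hcomm : ∀ i j, Commute (U D (h i)) (U D (h j)) := fun i j => by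
    apply Subtype.ext
    change (U D (h i) : NCTorus D) * (U D (h j) : NCTorus D) =
      (U D (h j) : NCTorus D) * (U D (h i) : NCTorus D)
    rw [U_mul, U_mul, add_comm, form_swap (h i : Fin d → ℤ) _ hD, phase_neg]
    have hinv : (phase (form D (h i) (h j)))⁻¹ = phase (form D (h i) (h j)) := by
      rw [inv_eq_iff_mul_eq_one, ← phase_add, ← two_mul, phase_two_mul_form (h i).2]
    rw [hinv]
  have hprod : (List.ofFn fun j => U D (h j) ^ (a + b) j).prod =
      (List.ofFn fun j => U D (h j) ^ a j).prod * (List.ofFn fun j => U D (h j) ^ b j).prod := by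
    rw [← prod_ofFn_mul]
    · simp only [Pi.add_apply, zpow_add]
    · exact fun i j => ((hcomm i j).zpow_right _).zpow_left _
  have h1 := congrArg (fun u : unitary (NCTorus D) => (u : NCTorus D)) hprod
  simp only [hε, Submonoid.coe_mul] at h1
  rw [smul_mul_smul_comm, U_mul, smul_smul, ← lat_add] at h1
  apply Circle.ext
  rw [Circle.coe_mul, Circle.coe_mul]
  exact smul_U_injective _ h1

variable {h} {ε : (Fin m → ℤ) → Circle}

theorem IsLatticeSign.zero (hε : IsLatticeSign h ε) : ε 0 = 1 := by
  have h1 := hε.map_add_eq 0 0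
  simp only [add_zero, lat_zero, form_zero_left, phase_zero, mul_one] at h1
  exact (mul_eq_left.1 h1.symm)

theorem IsLatticeSign.inv (hε : IsLatticeSign h ε) (c : Fin m → ℤ) : (ε c)⁻¹ = ε c := by
  rw [inv_eq_iff_mul_eq_one, ← sq, hε.sq_eq_one]

theorem IsLatticeSign.neg (hε : IsLatticeSign h ε) (hD : D.transpose = -D) (c : Fin m → ℤ) :
    ε (-c) = ε c := by
  have h1 := hε.map_add_eq c (-c)
  rw [add_neg_cancel, hε.zero, lat_neg, form_neg_right, form_self _ hD, neg_zero, phase_zero,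
    mul_one] at h1
  rw [← hε.inv c]
  exact (inv_eq_of_mul_eq_one_right h1.symm).symm

end lat

/-! ### Counting points in boxes -/

/-- The box `[0, N)^m` in `ℤ^m`. -/
def box (m N : ℕ) : Finset (Fin m → ℤ) := Fintype.piFinset fun _ => Finset.Ico (0 : ℤ) N

theorem mem_box {N : ℕ} {a : Fin m → ℤ} : a ∈ box m N ↔ ∀ j, 0 ≤ a j ∧ a j < N := by
  simp [box, Fintype.mem_piFinset]

theorem card_box (m N : ℕ) : (box m N).card = N ^ m := by
  simp [box, Fintype.card_piFinset]

/-- The Følner property of boxes. It serves twice: for the almost eigenvectors and for the Fejér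
densities. -/
theorem tendsto_card_box_inter (c : Fin m → ℤ) :
    Filter.Tendsto (fun N : ℕ => (((box m N).filter fun a => a + c ∈ box m N).card : ℝ) / N ^ m)
      Filter.atTop (nhds 1) := by
  have hcard : ∀ N : ℕ, ((box m N).filter fun a => a + c ∈ box m N) =
      Fintype.piFinset fun j => Finset.Ico (max 0 (-c j)) (min (N : ℤ) (N - c j)) := by
    intro N
    ext a
    simp only [Finset.mem_filter, mem_box, Fintype.mem_piFinset, Finset.mem_Ico, Pi.add_apply,
      ← forall_and]
    refine forall_congr' fun j => ?_
    omega
  have hone : ∀ j, Filter.Tendsto (fun N : ℕ =>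
      ((Finset.Ico (max 0 (-c j)) (min (N : ℤ) (N - c j))).card : ℝ) / N)
      Filter.atTop (nhds 1) := by
    intro j
    have h1 : Filter.Tendsto (fun N : ℕ => 1 - (|c j| : ℝ) * (1 / (N : ℝ))) Filter.atTop
        (nhds (1 - (|c j| : ℝ) * 0)) :=
      tendsto_const_nhds.sub (tendsto_one_div_atTop_nhds_zero_nat.const_mul _)
    rw [mul_zero, sub_zero] at h1
    refine h1.congr' ?_
    filter_upwards [Filter.eventually_ge_atTop ((c j).natAbs + 1)] with N hN
    have hN0 : (N : ℝ) ≠ 0 := by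
      have : 0 < N := by omega
      positivity
    have h2 : ((Finset.Ico (max 0 (-c j)) (min (N : ℤ) (N - c j))).card : ℤ) = N - |c j| := by
      rw [Int.card_Ico]
      have := abs_eq_max_neg (a := c j)
      omega
    have h3 : ((Finset.Ico (max 0 (-c j)) (min (N : ℤ) (N - c j))).card : ℝ) = N - |(c j : ℝ)| := by
      have := congrArg (fun z : ℤ => (z : ℝ)) h2
      push_cast at this
      exact this
    rw [h3]
    field_simp
  have h := tendsto_finsetProd (Finset.univ : Finset (Fin m)) fun j _ => hone j
  simp only [Finset.prod_const_one] at h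
  refine h.congr fun N => ?_
  rw [hcard, Fintype.card_piFinset, Finset.prod_div_distrib]
  simp

end

/-! ### Functionals attached to the characters of H -/

section

/-! ### Positive functionals as limits -/

section limits
variable {ι : Type*} [Fintype ι] {Θ : Matrix ι ι ℝ}

/-- The vector functional `A ↦ ⟨ξ, A ξ⟩`. -/
def vecFunctional (Θ : Matrix ι ι ℝ) (ξ : EllTwo (ι → ℕ)) : Toeplitz Θ →L[ℂ] ℂ :=
  LinearMap.mkContinuous
    { toFun := fun A => inner ℂ ξ ((A : BddOp (ι → ℕ)) ξ)
      map_add' := fun A B => by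
        change inner ℂ ξ ((A : BddOp (ι → ℕ)) ξ + (B : BddOp (ι → ℕ)) ξ) = _
        rw [inner_add_right]
      map_smul' := fun c A => by
        change inner ℂ ξ (c • (A : BddOp (ι → ℕ)) ξ) = _
        rw [inner_smul_right]
        rfl }
    (‖ξ‖ ^ 2) fun A => by
      change ‖inner ℂ ξ ((A : BddOp (ι → ℕ)) ξ)‖ ≤ ‖ξ‖ ^ 2 * ‖(A : BddOp (ι → ℕ))‖
      calc ‖inner ℂ ξ ((A : BddOp (ι → ℕ)) ξ)‖ ≤ ‖ξ‖ * ‖(A : BddOp (ι → ℕ)) ξ‖ :=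
            norm_inner_le_norm _ _
        _ ≤ ‖ξ‖ * (‖(A : BddOp (ι → ℕ))‖ * ‖ξ‖) := by
            gcongr
            exact ContinuousLinearMap.le_opNorm _ _
        _ = _ := by ring

theorem vecFunctional_apply (ξ : EllTwo (ι → ℕ)) (A : Toeplitz Θ) :
    vecFunctional Θ ξ A = inner ℂ ξ ((A : BddOp (ι → ℕ)) ξ) := rfl

theorem norm_vecFunctional_le (ξ : EllTwo (ι → ℕ)) : ‖vecFunctional Θ ξ‖ ≤ ‖ξ‖ ^ 2 :=
  LinearMap.mkContinuous_norm_le _ (by positivity) _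

theorem vecFunctional_star_mul_self (ξ : EllTwo (ι → ℕ)) (A : Toeplitz Θ) :
    0 ≤ vecFunctional Θ ξ (star A * A) := by
  change 0 ≤ inner ℂ ξ (star (A : BddOp (ι → ℕ)) ((A : BddOp (ι → ℕ)) ξ))
  rw [ContinuousLinearMap.star_eq_adjoint, ContinuousLinearMap.adjoint_inner_right,
    inner_self_eq_norm_sq_to_K]
  simp only [Complex.coe_algebraMap]
  norm_cast
  positivity

/-- By Banach–Alaoglu, a limit along a nonprincipal ultrafilter exists in the unit ball. Positivity
is a closed condition, and the values on monomials are the prescribed limits. -/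
theorem exists_positive_of_tendsto (ω : ℕ → Toeplitz Θ →L[ℂ] ℂ)
    (hpos : ∀ n a, 0 ≤ ω n (star a * a)) (hnorm : ∀ n, ‖ω n‖ ≤ 1) {κ : (ι → ℕ) → (ι → ℕ) → ℂ}
    (hlim : ∀ s t, Filter.Tendsto (fun n => ω n (mono Θ s t)) Filter.atTop (nhds (κ s t))) :
    ∃ φ : Toeplitz Θ →L[ℂ] ℂ, (∀ a, 0 ≤ φ (star a * a)) ∧ ‖φ‖ ≤ 1 ∧
      ∀ s t, φ (mono Θ s t) = κ s t := by
  let F : Ultrafilter ℕ := Filter.hyperfilter ℕ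
  let ω' : ℕ → WeakDual ℂ (Toeplitz Θ) := fun n => StrongDual.toWeakDual (ω n)
  have hF : (F : Filter ℕ) ≤ Filter.atTop := Nat.cofinite_eq_atTop ▸ Filter.hyperfilter_le_cofinite
  have hc := WeakDual.isCompact_closedBall (𝕜 := ℂ) (0 : StrongDual ℂ (Toeplitz Θ)) 1
  obtain ⟨φ, hφ, hle⟩ := hc.ultrafilter_le_nhds (F.map ω') (by
    rw [Filter.le_principal_iff]
    refine Filter.mem_map.2 (Filter.univ_mem' fun n => ?_)
    simpa [ω'] using hnorm n)
  have hev : ∀ a, Filter.Tendsto (fun n => ω n a) F (nhds (φ a)) := fun a =>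
    ((WeakDual.eval_continuous a).tendsto φ).comp hle
  refine ⟨WeakDual.toStrongDual φ, fun a => ?_, by simpa using hφ, fun s t => ?_⟩
  · exact ge_of_tendsto' (hev _) fun n => hpos n a
  · exact tendsto_nhds_unique (hev _) ((hlim s t).mono_left hF)

end limits

variable {k d m : ℕ} {Θ : Matrix (Fin k ⊕ Fin d) (Fin k ⊕ Fin d) ℝ}

theorem form_elim_elim (x y : Fin d → ℤ) :
    form Θ (Sum.elim 0 x) (Sum.elim 0 y) = form Θ.toBlocks₂₂ x y := by
  simp [form, dotProduct, Matrix.mulVec, Fintype.sum_sum_type, Matrix.toBlocks₂₂]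

theorem toBlocks_transpose (hΘ : Θ.transpose = -Θ) :
    Θ.toBlocks₂₂.transpose = -Θ.toBlocks₂₂ := by
  ext i j
  exact congrFun (congrFun hΘ (Sum.inr i)) (Sum.inr j)

/-! ### The characters of the torus -/

/-- `z^c` as an element of the circle. -/
def circleChar (z : Torus m) (c : Fin m → ℤ) : Circle := ∏ j, z j ^ c j

theorem torusChar_eq (z : Torus m) (c : Fin m → ℤ) : torusChar z c = circleChar z c := rfl

theorem circleChar_add (z : Torus m) (a b : Fin m → ℤ) :
    circleChar z (a + b) = circleChar z a * circleChar z b := by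
  simp [circleChar, zpow_add, Finset.prod_mul_distrib]

theorem circleChar_neg (z : Torus m) (a : Fin m → ℤ) :
    circleChar z (-a) = (circleChar z a)⁻¹ := by
  simp [circleChar]

@[simp] theorem circleChar_zero (z : Torus m) : circleChar z 0 = 1 := by simp [circleChar]

theorem continuous_torusChar (c : Fin m → ℤ) : Continuous fun z : Torus m => torusChar z c := by
  unfold torusChar
  fun_prop

/-! ### The tracial functionals attached to points of the torus -/

section tracial

variable (h : Module.Basis (Fin m) ℤ (degeneracyGroup Θ.toBlocks₂₂)) (ε : (Fin m → ℤ) → Circle)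

open Classical in
/-- The value at `U_v` of the tracial state attached to `z`. -/
def torusValue (z : Torus m) (v : Fin d → ℤ) : ℂ :=
  if hv : v ∈ degeneracyGroup Θ.toBlocks₂₂ then
    ε (h.repr ⟨v, hv⟩) * torusChar z (h.repr ⟨v, hv⟩) else 0

theorem torusValue_of_mem (z : Torus m) {v : Fin d → ℤ}
    (hv : v ∈ degeneracyGroup Θ.toBlocks₂₂) :
    torusValue h ε z v = ε (h.repr ⟨v, hv⟩) * torusChar z (h.repr ⟨v, hv⟩) := by
  rw [torusValue, dif_pos hv]

theorem torusValue_of_notMem (z : Torus m) {v : Fin d → ℤ}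
    (hv : v ∉ degeneracyGroup Θ.toBlocks₂₂) : torusValue h ε z v = 0 := by
  rw [torusValue, dif_neg hv]

theorem torusValue_lat (z : Torus m) (c : Fin m → ℤ) :
    torusValue h ε z (lat h c) = ε c * torusChar z c := by
  rw [torusValue_of_mem h ε z (lat_mem h c), repr_lat]

/-- A translation moving the image of the box of side `N` into `[N, ∞)^d`. -/
def boxShift (N : ℕ) : ℕ := N + ∑ a ∈ box m N, ∑ i, (lat h a i).natAbs

theorem le_boxShift {N : ℕ} {a : Fin m → ℤ} (ha : a ∈ box m N) (i : Fin d) :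
    (N : ℤ) ≤ 2 * boxShift h N + lat h a i := by
  have h1 : (lat h a i).natAbs ≤ ∑ i, (lat h a i).natAbs :=
    Finset.single_le_sum (f := fun i => (lat h a i).natAbs) (fun _ _ => Nat.zero_le _)
      (Finset.mem_univ i)
  have h2 : ∑ i, (lat h a i).natAbs ≤ ∑ a ∈ box m N, ∑ i, (lat h a i).natAbs :=
    Finset.single_le_sum (f := fun a => ∑ i, (lat h a i).natAbs) (fun _ _ => Nat.zero_le _) ha
  rw [boxShift]
  omega

/-- The translated lattice point in `0_k × ℕ^d`. -/
def boxPoint (N : ℕ) (a : Fin m → ℤ) : Fin k ⊕ Fin d → ℕ :=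
  Sum.elim 0 fun i => (2 * boxShift h N + lat h a i).toNat

theorem toInt_boxPoint {N : ℕ} {a : Fin m → ℤ} (ha : a ∈ box m N) :
    toInt (boxPoint (k := k) h N a) =
      Sum.elim (0 : Fin k → ℤ) ((2 : ℤ) • (fun _ => (boxShift h N : ℤ)) + lat h a) := by
  ext i
  rcases i with i | i
  · simp [toInt, boxPoint]
  · have := le_boxShift h ha i
    simp only [toInt, boxPoint, Sum.elim_inr, Pi.add_apply, Pi.smul_apply, smul_eq_mul]
    omega

/-- The (unnormalised) almost eigenvector of the degenerate directions. -/
def boxVector (z : Torus m) (N : ℕ) : EllTwo (Fin k ⊕ Fin d → ℕ) :=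
  ∑ a ∈ box m N, ((ε a * (circleChar z a)⁻¹ : Circle) : ℂ) • delta (boxPoint h N a)

variable {h ε}

/-- Box points vanish in the ℕ^k coordinates, so any ℕ^k part of s or t destroys the coefficient. In
the other coordinates they are at least N, so the truncation at t is harmless. -/
theorem boxVector_coeff (hΘ : Θ.transpose = -Θ) {s t : Fin k ⊕ Fin d → ℕ} {N : ℕ}
    (hN : ∀ i, t (Sum.inr i) ≤ N) {a b : Fin m → ℤ} (ha : a ∈ box m N) (hb : b ∈ box m N)
    [Decidable ((∀ j, s (Sum.inl j) = 0 ∧ t (Sum.inl j) = 0) ∧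
      lat h b = lat h a + fun i => (toInt s - toInt t) (Sum.inr i))] :
    inner ℂ (delta (boxPoint h N b)) ((mono Θ s t : BddOp _) (delta (boxPoint h N a))) =
      if (∀ j, s (Sum.inl j) = 0 ∧ t (Sum.inl j) = 0) ∧
        lat h b = lat h a + fun i => (toInt s - toInt t) (Sum.inr i) then
      (phase (form Θ (toInt s - toInt t) (toInt (boxPoint h N a))) : ℂ) else 0 := by
  classical
  rw [inner_delta, mono_delta hΘ]
  have hiff : (t ≤ boxPoint h N a ∧ boxPoint h N b = boxPoint h N a - t + s) ↔
      ((∀ j, s (Sum.inl j) = 0 ∧ t (Sum.inl j) = 0) ∧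
        lat h b = lat h a + fun i => (toInt s - toInt t) (Sum.inr i)) := by
    constructor
    · rintro ⟨hle, he⟩
      refine ⟨fun j => ?_, funext fun i => ?_⟩
      · have h1 : t (Sum.inl j) ≤ 0 := hle (Sum.inl j)
        have h2 : (0 : ℕ) = 0 - t (Sum.inl j) + s (Sum.inl j) := congrFun he (Sum.inl j)
        omega
      · have h1 : t (Sum.inr i) ≤ (2 * boxShift h N + lat h a i).toNat := hle (Sum.inr i)
        have h2 : (2 * boxShift h N + lat h b i).toNat =
          (2 * boxShift h N + lat h a i).toNat - t (Sum.inr i) + s (Sum.inr i) :=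
          congrFun he (Sum.inr i)
        have h3 := le_boxShift h ha i
        have h4 := le_boxShift h hb i
        simp only [Pi.add_apply, Pi.sub_apply, toInt]
        omega
    · rintro ⟨hK, hD⟩
      have hle : ∀ i, t (Sum.inr i) ≤ (2 * boxShift h N + lat h a i).toNat := fun i => by
        have := hN i
        have h3 := le_boxShift h ha i
        omega
      refine ⟨fun i => ?_, funext fun i => ?_⟩
      · rcases i with j | i
        · rw [(hK j).2]; exact Nat.zero_le _
        · exact hle i
      · rcases i with j | i
        · simp [boxPoint, hK j]
        · have h1 := hle i
          have h2 := congrFun hD i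
          simp only [Pi.add_apply, Pi.sub_apply, toInt] at h2
          have h3 := le_boxShift h ha i
          have h4 := le_boxShift h hb i
          simp only [boxPoint, Pi.add_apply, Pi.sub_apply, Sum.elim_inr]
          omega
  by_cases h1 : t ≤ boxPoint h N a
  · rw [if_pos h1, lp.coeFn_smul, Pi.smul_apply, delta_apply]
    by_cases h2 : boxPoint h N b = boxPoint h N a - t + s
    · rw [if_pos h2, if_pos (hiff.1 ⟨h1, h2⟩)]
      simp
    · rw [if_neg h2, if_neg fun hc => h2 (hiff.2 hc).2]
      simp
  · rw [if_neg h1, if_neg fun hc => h1 (hiff.2 hc).1]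
    rfl

/-- Translation by the lattice vector of c sends the a-th term to the (a + c)-th. The weights ε(a)
z^{-a} make every surviving pair contribute the same number ε(c) z^c, so only the pairs have to be
counted. -/
theorem inner_boxVector (hΘ : Θ.transpose = -Θ) (hε : IsLatticeSign h ε) (z : Torus m)
    {s t : Fin k ⊕ Fin d → ℕ} {N : ℕ} (hN : ∀ i, t (Sum.inr i) ≤ N)
    (hst : ∀ j, s (Sum.inl j) = 0 ∧ t (Sum.inl j) = 0) (c : Fin m → ℤ)
    (hc : (fun i => (toInt s - toInt t) (Sum.inr i)) = lat h c) :
    vecFunctional Θ (boxVector h ε z N) (mono Θ s t) =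
      (((box m N).filter fun a => a + c ∈ box m N).card : ℂ) * (ε c * torusChar z c) := by
  classical
  have hw : toInt s - toInt t = Sum.elim (0 : Fin k → ℤ) (lat h c) := by
    rw [← hc]
    ext i
    rcases i with j | i
    · simp [toInt, hst j]
    · simp
  rw [vecFunctional_apply, boxVector, map_sum, inner_sum]
  have hterm : ∀ a ∈ box m N, inner ℂ
      (∑ b ∈ box m N, ((ε b * (circleChar z b)⁻¹ : Circle) : ℂ) • delta (boxPoint h N b))
      ((mono Θ s t : BddOp _) (((ε a * (circleChar z a)⁻¹ : Circle) : ℂ) •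
        delta (boxPoint h N a))) =
      if a + c ∈ box m N then ε c * torusChar z c else 0 := by
    intro a ha
    rw [sum_inner]
    have hb : ∀ b ∈ box m N, inner ℂ
        (((ε b * (circleChar z b)⁻¹ : Circle) : ℂ) • (delta (boxPoint h N b) : EllTwo _))
        ((mono Θ s t : BddOp _) (((ε a * (circleChar z a)⁻¹ : Circle) : ℂ) •
          delta (boxPoint h N a))) =
        if b = a + c then ε c * torusChar z c else 0 := by
      intro b hb
      rw [map_smul, inner_smul_left, inner_smul_right, boxVector_coeff hΘ hN ha hb, hc,
        ← lat_add]
      by_cases hba : b = a + c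
      · rw [if_pos ⟨hst, congrArg _ hba⟩, if_pos hba, hw, toInt_boxPoint h ha, form_elim_elim,
          form_add_right, phase_add, hba, torusChar_eq, ← Circle.coe_inv_eq_conj]
        -- The box was translated by an even vector precisely so that its pairing with H gives a
        -- trivial phase.
        have h1 : phase (form Θ.toBlocks₂₂ (lat h c)
            ((2 : ℤ) • fun _ => (boxShift h N : ℤ))) = 1 := by
          rw [two_smul, form_add_right, ← two_mul, phase_two_mul_form (lat_mem h c)]
        have h2 := hε.map_add_eq c a
        have h3 := hε.inv c
        have h4 := hε.sq_eq_one a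
        rw [h1, one_mul, ← Circle.coe_mul, ← Circle.coe_mul, ← Circle.coe_mul]
        congr 1
        have h5 : ε (a + c) = ε (c + a) := by rw [add_comm]
        have h6 : phase (form Θ.toBlocks₂₂ (lat h c) (lat h a)) = ε (c + a) * (ε a * ε c) := by
          rw [h2]
          calc _ = (ε c ^ 2) * (ε a ^ 2) * phase (form Θ.toBlocks₂₂ (lat h c) (lat h a)) := by
                rw [h4, hε.sq_eq_one c, one_mul, one_mul]
            _ = _ := by
                simp only [sq, mul_comm, mul_assoc, mul_left_comm]
        rw [h6, h5, circleChar_add, mul_inv, inv_inv]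
        calc (ε (c + a))⁻¹ * (circleChar z a * circleChar z c) * (ε a * (circleChar z a)⁻¹ *
              (ε (c + a) * (ε a * ε c)))
            = ((ε (c + a))⁻¹ * ε (c + a)) * (circleChar z a * (circleChar z a)⁻¹) * (ε a ^ 2) *
              (ε c * circleChar z c) := by
              simp only [sq, mul_comm, mul_assoc, mul_left_comm]
          _ = _ := by rw [h4, inv_mul_cancel, mul_inv_cancel, one_mul, one_mul, one_mul]
      · rw [if_neg fun hcon => hba (lat_injective h hcon.2), if_neg hba]
        simp
    rw [Finset.sum_congr rfl hb, Finset.sum_ite_eq']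
  rw [Finset.sum_congr rfl hterm, ← Finset.sum_filter, Finset.sum_const, nsmul_eq_mul]

theorem inner_boxVector_of_not (hΘ : Θ.transpose = -Θ) (z : Torus m)
    {s t : Fin k ⊕ Fin d → ℕ} {N : ℕ} (hN : ∀ i, t (Sum.inr i) ≤ N)
    (hst : ¬ ((∀ j, s (Sum.inl j) = 0 ∧ t (Sum.inl j) = 0) ∧
      (fun i => (toInt s - toInt t) (Sum.inr i)) ∈ degeneracyGroup Θ.toBlocks₂₂)) :
    vecFunctional Θ (boxVector h ε z N) (mono Θ s t) = 0 := by
  classical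
  rw [vecFunctional_apply, boxVector, map_sum, inner_sum]
  refine Finset.sum_eq_zero fun a ha => ?_
  rw [sum_inner]
  refine Finset.sum_eq_zero fun b hb => ?_
  rw [map_smul, inner_smul_left, inner_smul_right, boxVector_coeff hΘ hN ha hb, if_neg]
  · simp
  · rintro ⟨h1, h2⟩
    refine hst ⟨h1, ?_⟩
    rw [← sub_eq_iff_eq_add'.2 h2]
    exact sub_mem (lat_mem h b) (lat_mem h a)

-- Limit of the box vector functionals divided by N^m; the Følner ratio tends to one and leaves ε(c)
-- z^c on H and zero elsewhere.
open Classical in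
theorem exists_tracial_functional (hΘ : Θ.transpose = -Θ) (hε : IsLatticeSign h ε) (z : Torus m) :
    ∃ τ : Toeplitz Θ →L[ℂ] ℂ, (∀ a, 0 ≤ τ (star a * a)) ∧ ‖τ‖ ≤ 1 ∧ ∀ s t, τ (mono Θ s t) =
      if ∀ j, s (Sum.inl j) = 0 ∧ t (Sum.inl j) = 0 then
        torusValue h ε z (fun i => (toInt s - toInt t) (Sum.inr i)) else 0 := by
  refine exists_positive_of_tendsto
    (fun N => ((1 / N ^ m : ℝ) : ℂ) • vecFunctional Θ (boxVector h ε z N)) (fun N a => ?_)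
    (fun N => ?_) fun s t => ?_
  · exact mul_nonneg (by exact_mod_cast (by positivity : (0 : ℝ) ≤ 1 / N ^ m))
      (vecFunctional_star_mul_self _ a)
  -- The unit monomial gives the squared norm N^m of the box vector, hence the norm bound.
  · have h1 := inner_boxVector hΘ hε z (s := 0) (t := 0) (N := N) (by simp) (by simp) 0
      (by ext i; simp)
    rw [mono_zero_zero, vecFunctional_apply] at h1
    simp only [add_zero, Finset.filter_mem_eq_inter, Finset.inter_self, card_box, hε.zero,
      torusChar_eq, circleChar_zero, Circle.coe_one, mul_one] at h1
    have h2 : ‖boxVector h ε z N‖ ^ 2 = (N : ℝ) ^ m := by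
      change inner ℂ (boxVector h ε z N) (boxVector h ε z N) = _ at h1
      rw [inner_self_eq_norm_sq_to_K] at h1
      simp only [Complex.coe_algebraMap] at h1
      exact_mod_cast h1
    refine ContinuousLinearMap.opNorm_le_bound _ zero_le_one fun a => ?_
    rw [smul_apply, norm_smul]
    calc ‖((1 / N ^ m : ℝ) : ℂ)‖ * ‖vecFunctional Θ (boxVector h ε z N) a‖
        ≤ (1 / N ^ m) * ((N : ℝ) ^ m * ‖a‖) := by
          gcongr
          · rw [Complex.norm_real, Real.norm_of_nonneg (by positivity)]
          · refine (ContinuousLinearMap.le_opNorm _ _).trans ?_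
            gcongr
            exact (norm_vecFunctional_le _).trans h2.le
      _ ≤ 1 * ‖a‖ := by
          rw [← mul_assoc, one_div, inv_mul_eq_div]
          gcongr
          exact div_self_le_one _
  · have hev : ∀ᶠ N : ℕ in Filter.atTop, ∀ i, t (Sum.inr i) ≤ N :=
      Filter.eventually_all.2 fun i => Filter.eventually_ge_atTop _
    by_cases hst : (∀ j, s (Sum.inl j) = 0 ∧ t (Sum.inl j) = 0) ∧
      (fun i => (toInt s - toInt t) (Sum.inr i)) ∈ degeneracyGroup Θ.toBlocks₂₂
    · let c : Fin m → ℤ := ⇑(h.repr ⟨_, hst.2⟩)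
      have hlat : (fun i => (toInt s - toInt t) (Sum.inr i)) = lat h c := (lat_repr h hst.2).symm
      rw [if_pos hst.1, hlat, torusValue_lat]
      have h1 := (Complex.continuous_ofReal.tendsto 1).comp (tendsto_card_box_inter c)
      have h2 := h1.mul_const (ε c * torusChar z c : ℂ)
      rw [Complex.ofReal_one, one_mul] at h2
      refine h2.congr' ?_
      filter_upwards [hev] with N hN
      rw [smul_apply, inner_boxVector hΘ hε z hN hst.1 c hlat, smul_eq_mul]
      simp only [Function.comp]
      push_cast
      ring
    · have h0 : (if ∀ j, s (Sum.inl j) = 0 ∧ t (Sum.inl j) = 0 then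
          torusValue h ε z (fun i => (toInt s - toInt t) (Sum.inr i)) else 0) = 0 := by
        split_ifs with h1
        · exact torusValue_of_notMem h ε z fun h2 => hst ⟨h1, h2⟩
        · rfl
      rw [h0]
      refine tendsto_const_nhds.congr' ?_
      filter_upwards [hev] with N hN
      rw [smul_apply, inner_boxVector_of_not hΘ z hN hst, smul_zero]

end tracial

end

/-! ### KMS functionals as Gibbs averages -/

section

variable {k d m : ℕ} {Θ : Matrix (Fin k ⊕ Fin d) (Fin k ⊕ Fin d) ℝ}

/-! ### The Gibbs weights -/

/-- `exp(-β r_j + 2 π i ⟨Θ v, e_j⟩)`. -/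
def gibbsRatio (Θ : Matrix (Fin k ⊕ Fin d) (Fin k ⊕ Fin d) ℝ) (r : Fin k → ℝ) (β : ℝ)
    (v : Fin d → ℤ) (j : Fin k) : ℂ :=
  Complex.exp (-β * r j + 2 * Real.pi * Complex.I * pairing Θ v j)

/-- The factor `∏_j (1 - e^{-β r_j}) / (1 - e^{-β r_j + 2 π i ⟨Θ v, e_j⟩})`. -/
def gibbsFactor (Θ : Matrix (Fin k ⊕ Fin d) (Fin k ⊕ Fin d) ℝ) (r : Fin k → ℝ) (β : ℝ)
    (v : Fin d → ℤ) : ℂ :=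
  ∏ j, (1 - Complex.exp (-β * r j)) / (1 - gibbsRatio Θ r β v j)

variable {r : Fin k → ℝ} {β : ℝ}

theorem norm_gibbsRatio (v : Fin d → ℤ) (j : Fin k) :
    ‖gibbsRatio Θ r β v j‖ = Real.exp (-β * r j) := by
  rw [gibbsRatio, Complex.norm_exp]
  congr 1
  simp

theorem norm_gibbsRatio_lt_one (hr : ∀ j, 0 < r j) (hβ : 0 < β) (v : Fin d → ℤ) (j : Fin k) :
    ‖gibbsRatio Θ r β v j‖ < 1 := by
  rw [norm_gibbsRatio, Real.exp_lt_one_iff]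
  have := mul_pos hβ (hr j)
  linarith

theorem one_sub_gibbsRatio_ne_zero (hr : ∀ j, 0 < r j) (hβ : 0 < β) (v : Fin d → ℤ) (j : Fin k) :
    1 - gibbsRatio Θ r β v j ≠ 0 := by
  intro h0
  have h1 := norm_gibbsRatio_lt_one (Θ := Θ) hr hβ v j
  rw [← sub_eq_zero.1 h0] at h1
  simp at h1

theorem one_sub_exp_ne_zero (hr : ∀ j, 0 < r j) (hβ : 0 < β) (j : Fin k) :
    1 - Complex.exp (-β * r j) ≠ 0 := by
  have := one_sub_gibbsRatio_ne_zero (Θ := (0 : Matrix (Fin k ⊕ Fin 0) (Fin k ⊕ Fin 0) ℝ))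
    hr hβ 0 j
  simpa [gibbsRatio, pairing] using this

theorem gibbsFactor_ne_zero (hr : ∀ j, 0 < r j) (hβ : 0 < β) (v : Fin d → ℤ) :
    gibbsFactor Θ r β v ≠ 0 :=
  Finset.prod_ne_zero_iff.2 fun j _ => div_ne_zero (one_sub_exp_ne_zero hr hβ j)
    (one_sub_gibbsRatio_ne_zero hr hβ v j)

theorem gibbsFactor_zero (hr : ∀ j, 0 < r j) (hβ : 0 < β) : gibbsFactor Θ r β 0 = 1 := by
  refine Finset.prod_eq_one fun j _ => ?_
  have h0 : gibbsRatio Θ r β 0 j = Complex.exp (-β * r j) := by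
    simp [gibbsRatio, pairing, Matrix.mulVec, dotProduct, Fintype.sum_sum_type]
  rw [h0]
  exact div_self (one_sub_exp_ne_zero hr hβ j)

theorem form_inK (hΘ : Θ.transpose = -Θ) (v : Fin d → ℤ) (p : Fin k → ℕ) :
    form Θ (Sum.elim (0 : Fin k → ℤ) v) (toInt (inK d p)) = -∑ j, p j * pairing Θ v j := by
  rw [form_swap _ _ hΘ]
  congr 1
  have h1 : (fun i => ((Sum.elim 0 v : Fin k ⊕ Fin d → ℤ) i : ℝ)) =
      Sum.elim (0 : Fin k → ℝ) fun i => (v i : ℝ) := by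
    ext i; rcases i with i | i <;> simp
  simp [form, dotProduct, Fintype.sum_sum_type, toInt, inK, pairing, h1]

theorem energy_inK (r : Fin k → ℝ) (p : Fin k → ℕ) :
    energy (extendZero d r) (toInt (inK d p)) = ∑ j, p j * r j := by
  simp [energy, Fintype.sum_sum_type, toInt, inK, extendZero]

/-- Each ratio combines a Boltzmann factor with the phase from moving L_{e_j} past a translation by
v, so its powers collect the total energy and the total commutation phase. -/
theorem prod_gibbsRatio_pow (hΘ : Θ.transpose = -Θ) (v : Fin d → ℤ) (p : Fin k → ℕ) :
    ∏ j, gibbsRatio Θ r β v j ^ p j =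
      Complex.exp (-β * energy (extendZero d r) (toInt (inK d p))) *
        phase (2 * form Θ (Sum.elim (0 : Fin k → ℤ) v) (toInt (inK d p))) := by
  simp only [gibbsRatio, ← Complex.exp_nat_mul]
  rw [← Complex.exp_sum, phase_coe_eq_exp, ← Complex.exp_add, form_inK hΘ, energy_inK]
  congr 1
  push_cast
  simp only [Finset.mul_sum, Finset.sum_mul, ← Finset.sum_neg_distrib, ← Finset.sum_add_distrib]
  refine Finset.sum_congr rfl fun j _ => ?_
  ring

theorem toInt_eq_add (s : Fin k ⊕ Fin d → ℕ) : toInt s =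
    toInt (inK d fun j => s (Sum.inl j)) + Sum.elim (0 : Fin k → ℤ) fun i => (s (Sum.inr i) : ℤ) := by
  ext i
  rcases i with i | i <;> simp [toInt, inK]

theorem energy_elim_zero (r : Fin k → ℝ) (y : Fin d → ℤ) :
    energy (extendZero d r) (Sum.elim (0 : Fin k → ℤ) y) = 0 := by
  simp [energy, Fintype.sum_sum_type, extendZero]

theorem phase_two_mul_form_elim {v : Fin d → ℤ} (hv : v ∈ degeneracyGroup Θ.toBlocks₂₂)
    (y : Fin d → ℤ) : phase (2 * form Θ (Sum.elim (0 : Fin k → ℤ) v) (Sum.elim (0 : Fin k → ℤ) y)) = 1 := by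
  rw [form_elim_elim, phase_two_mul_form hv]

theorem prod_gibbsRatio_pow_inl (hΘ : Θ.transpose = -Θ) {v : Fin d → ℤ}
    (hv : v ∈ degeneracyGroup Θ.toBlocks₂₂) (s : Fin k ⊕ Fin d → ℕ) :
    ∏ j, gibbsRatio Θ r β v j ^ s (Sum.inl j) =
      Complex.exp (-β * energy (extendZero d r) (toInt s)) *
        phase (2 * form Θ (Sum.elim (0 : Fin k → ℤ) v) (toInt s)) := by
  rw [prod_gibbsRatio_pow hΘ, toInt_eq_add s, energy_add, energy_elim_zero, add_zero,
    form_add_right, mul_add, coe_phase_add, phase_two_mul_form_elim hv, Circle.coe_one, mul_one]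

theorem eq_elim_zero {w : Fin k ⊕ Fin d → ℤ} (hw : ∀ j, w (Sum.inl j) = 0) :
    w = Sum.elim (0 : Fin k → ℤ) fun i => w (Sum.inr i) := by
  ext i
  rcases i with i | i <;> simp [hw]

variable (h : Module.Basis (Fin m) ℤ (degeneracyGroup Θ.toBlocks₂₂)) (ε : (Fin m → ℤ) → Circle)
  (r β)

open Classical in
/-- The value of the KMS state attached to `z` at the monomial `σ(s,t) L_s L_t^*`,
where `w = s - t`. -/
def kmsCoeff (z : Torus m) (s : Fin k ⊕ Fin d → ℕ) (w : Fin k ⊕ Fin d → ℤ) : ℂ :=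
  if ∀ j, w (Sum.inl j) = 0 then
    torusValue h ε z (fun i => w (Sum.inr i)) * (gibbsFactor Θ r β (fun i => w (Sum.inr i)) *
      ∏ j, gibbsRatio Θ r β (fun i => w (Sum.inr i)) j ^ s (Sum.inl j))
  else 0

variable {h ε r β}

theorem kmsCoeff_of_mem (hΘ : Θ.transpose = -Θ) (z : Torus m) (s : Fin k ⊕ Fin d → ℕ)
    {w : Fin k ⊕ Fin d → ℤ} (hw : ∀ j, w (Sum.inl j) = 0)
    (hv : (fun i => w (Sum.inr i)) ∈ degeneracyGroup Θ.toBlocks₂₂) :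
    kmsCoeff r β h ε z s w = torusValue h ε z (fun i => w (Sum.inr i)) *
      (gibbsFactor Θ r β (fun i => w (Sum.inr i)) *
        (Complex.exp (-β * energy (extendZero d r) (toInt s)) *
          phase (2 * form Θ w (toInt s)))) := by
  rw [kmsCoeff, if_pos hw, prod_gibbsRatio_pow_inl hΘ hv, ← eq_elim_zero hw]

theorem kmsCoeff_of_not (z : Torus m) (s : Fin k ⊕ Fin d → ℕ) {w : Fin k ⊕ Fin d → ℤ}
    (hw : ¬ ((∀ j, w (Sum.inl j) = 0) ∧
      (fun i => w (Sum.inr i)) ∈ degeneracyGroup Θ.toBlocks₂₂)) :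
    kmsCoeff r β h ε z s w = 0 := by
  rw [kmsCoeff]
  split_ifs with h1
  · rw [torusValue_of_notMem h ε z fun h2 => hw ⟨h1, h2⟩, zero_mul]
  · rfl

/-- The KMS condition for the explicit coefficients. Both products have the same total displacement
w, so only the dependence on the first index matters. -/
theorem kmsCoeff_swap (hΘ : Θ.transpose = -Θ) (z : Torus m) (s t u v : Fin k ⊕ Fin d → ℕ) :
    (phase (form Θ (toInt s - toInt t) (toInt u - toInt v)) : ℂ) *
        kmsCoeff r β h ε z (s + (u - t)) (toInt s - toInt t + (toInt u - toInt v)) =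
      Complex.exp (β * energy (extendZero d r) (toInt u - toInt v)) *
        ((phase (form Θ (toInt u - toInt v) (toInt s - toInt t)) : ℂ) *
          kmsCoeff r β h ε z (u + (s - v)) (toInt s - toInt t + (toInt u - toInt v))) := by
  set w := toInt s - toInt t + (toInt u - toInt v) with hw
  by_cases hmem : (∀ j, w (Sum.inl j) = 0) ∧
      (fun i => w (Sum.inr i)) ∈ degeneracyGroup Θ.toBlocks₂₂
  swap
  · rw [kmsCoeff_of_not z _ hmem, kmsCoeff_of_not z _ hmem]
    simp
  rw [kmsCoeff_of_mem hΘ z _ hmem.1 hmem.2, kmsCoeff_of_mem hΘ z _ hmem.1 hmem.2]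
  set v' : Fin d → ℤ := fun i => w (Sum.inr i)
  -- Because w has no ℕ^k part, the two first indices differ there by exactly u - v. The remaining
  -- difference y lies in ℤ^d, where it carries no energy and, paired with H, no phase.
  obtain ⟨y, hy⟩ : ∃ y : Fin d → ℤ, toInt (s + (u - t)) =
      toInt (u + (s - v)) - (toInt u - toInt v) + Sum.elim (0 : Fin k → ℤ) y := by
    refine ⟨fun i => (toInt (s + (u - t)) - (toInt (u + (s - v)) - (toInt u - toInt v)))
      (Sum.inr i), funext fun i => ?_⟩
    rcases i with j | i
    · have := hmem.1 j
      simp only [hw, toInt, Pi.add_apply, Pi.sub_apply, Sum.elim_inl, Pi.zero_apply] at this ⊢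
      omega
    · simp only [Pi.add_apply, Pi.sub_apply, Sum.elim_inr]
      ring
  have hE : energy (extendZero d r) (toInt (s + (u - t))) =
      energy (extendZero d r) (toInt (u + (s - v))) -
        energy (extendZero d r) (toInt u - toInt v) := by
    rw [hy, energy_add, energy_elim_zero, add_zero, energy_sub _ (toInt (u + (s - v)))]
  have hP : phase (2 * form Θ w (toInt (s + (u - t)))) =
      phase (2 * form Θ w (toInt (u + (s - v)))) *
        phase (-(2 * form Θ (toInt s - toInt t) (toInt u - toInt v))) := by
    have h1 : phase (2 * form Θ w (Sum.elim (0 : Fin k → ℤ) y)) = 1 := by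
      conv_lhs => rw [eq_elim_zero hmem.1]
      exact phase_two_mul_form_elim hmem.2 y
    have h2 : form Θ w (toInt u - toInt v) = form Θ (toInt s - toInt t) (toInt u - toInt v) := by
      rw [hw, form_add_left, form_self _ hΘ, add_zero]
    rw [hy, form_add_right, form_sub_right _ w, h2, mul_add, mul_sub, phase_add, h1, mul_one,
      sub_eq_add_neg, phase_add]
  have hQ : phase (form Θ (toInt s - toInt t) (toInt u - toInt v)) *
      phase (-(2 * form Θ (toInt s - toInt t) (toInt u - toInt v))) =
      phase (form Θ (toInt u - toInt v) (toInt s - toInt t)) := by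
    rw [← phase_add, form_swap (toInt s - toInt t) _ hΘ]
    congr 1
    ring
  have hX : Complex.exp (-β * (energy (extendZero d r) (toInt (s + (u - t))) : ℝ)) =
      Complex.exp (β * energy (extendZero d r) (toInt u - toInt v)) *
        Complex.exp (-β * energy (extendZero d r) (toInt (u + (s - v)))) := by
    rw [hE, ← Complex.exp_add]
    congr 1
    push_cast
    ring
  rw [hP, hX, ← hQ, Circle.coe_mul, Circle.coe_mul]
  ring

theorem toInt_mono_mul (s t u v : Fin k ⊕ Fin d → ℕ) :
    toInt (s + (u - t)) - toInt (v + (t - u)) = toInt s - toInt t + (toInt u - toInt v) := by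
  ext i
  simp only [toInt, Pi.add_apply, Pi.sub_apply]
  omega

/-! ### Existence of the KMS states attached to points of the torus -/

theorem norm_L_le {ι : Type*} [Fintype ι] (Θ : Matrix ι ι ℝ) (p : ι → ℕ) : ‖L Θ p‖ ≤ 1 :=
  LinearIsometry.norm_toContinuousLinearMap_le _

theorem norm_mul_mul_le_of_norm_le_one {R : Type*} [NormedRing R] {a b : R} (ha : ‖a‖ ≤ 1)
    (hb : ‖b‖ ≤ 1) (x : R) : ‖a * x * b‖ ≤ ‖x‖ :=
  calc ‖a * x * b‖ ≤ ‖a‖ * ‖x‖ * ‖b‖ := (norm_mul_le _ _).trans (by gcongr; exact norm_mul_le _ _)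
    _ ≤ 1 * ‖x‖ * 1 := by gcongr
    _ = ‖x‖ := by ring

/-- The compression `A ↦ L_p^* A L_p`. -/
def compress (Θ : Matrix (Fin k ⊕ Fin d) (Fin k ⊕ Fin d) ℝ) (p : Fin k → ℕ) :
    Toeplitz Θ →L[ℂ] Toeplitz Θ :=
  ContinuousLinearMap.mulLeftRight ℂ (Toeplitz Θ) (star (L Θ (inK d p))) (L Θ (inK d p))

theorem compress_apply (p : Fin k → ℕ) (A : Toeplitz Θ) :
    compress Θ p A = star (L Θ (inK d p)) * A * L Θ (inK d p) := rfl

theorem norm_star_L_le {ι : Type*} [Fintype ι] (Θ : Matrix ι ι ℝ) (p : ι → ℕ) :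
    ‖star (L Θ p)‖ ≤ 1 :=
  (norm_star (leftReg (cocycleNat Θ) p)).le.trans (norm_L_le Θ p)

theorem norm_compress_le (p : Fin k → ℕ) (A : Toeplitz Θ) : ‖compress Θ p A‖ ≤ ‖A‖ :=
  norm_mul_mul_le_of_norm_le_one (norm_star_L_le Θ _) (norm_L_le Θ _) A

theorem compress_star_mul_self (p : Fin k → ℕ) (A : Toeplitz Θ) :
    compress Θ p (star A * A) = star (A * L Θ (inK d p)) * (A * L Θ (inK d p)) := by
  rw [compress_apply, star_mul]
  simp only [mul_assoc]

/-- Moving L_p past a translation by s - t costs the commutation phase, twice the form; the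
truncated differences record how p cancels against s and t. -/
theorem compress_mono (hΘ : Θ.transpose = -Θ) (p : Fin k → ℕ) (s t : Fin k ⊕ Fin d → ℕ) :
    compress Θ p (mono Θ s t) =
      (phase (2 * form Θ (toInt s - toInt t) (toInt (inK d p))) : ℂ) •
        mono Θ ((s - inK d p) + (inK d p - (t + (inK d p - s))))
          (t + (inK d p - s) - inK d p) := by
  have h1 : toInt (0 + (s - inK d p)) - toInt (t + (inK d p - s)) =
      toInt s - toInt t - toInt (inK d p) := by
    rw [toInt_mono_mul]
    simp only [toInt_zero]
    abel
  rw [compress_apply, L_eq_mono, star_mono hΘ, mono_mul hΘ, smul_mul_assoc, mono_mul hΘ,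
    smul_smul, ← coe_phase_add, h1]
  simp only [zero_add, toInt_zero, zero_sub, sub_zero, form_neg_left, form_sub_left,
    form_self _ hΘ]
  congr 3
  rw [form_sub_right, form_swap (toInt s) _ hΘ, form_swap (toInt t) _ hΘ]
  ring

theorem tendsto_sum_range_ite {x : ℂ} (hx : ‖x‖ < 1) (c : ℂ) (s : ℕ) :
    Filter.Tendsto (fun N => ∑ i ∈ Finset.range N, if s ≤ i then c * x ^ i else 0) Filter.atTop
      (nhds (c / (1 - x) * x ^ s)) := by
  have hx1 : x ≠ 1 := by
    rintro rfl
    simp at hx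
  have h1 : Filter.Tendsto (fun N : ℕ => c * ((x ^ N - x ^ s) / (x - 1))) Filter.atTop
      (nhds (c * ((0 - x ^ s) / (x - 1)))) :=
    (((tendsto_pow_atTop_nhds_zero_of_norm_lt_one hx).sub_const _).div_const _).const_mul _
  have h2 : c * ((0 - x ^ s) / (x - 1)) = c / (1 - x) * x ^ s := by
    have := sub_ne_zero.2 hx1
    have := sub_ne_zero.2 hx1.symm
    field_simp
    ring
  rw [h2] at h1
  refine h1.congr' ?_
  filter_upwards [Filter.eventually_ge_atTop s] with N hN
  rw [← geom_sum_Ico hx1 hN, Finset.mul_sum, ← Finset.sum_filter]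
  refine Finset.sum_congr ?_ fun _ _ => rfl
  ext i
  simp only [Finset.mem_Ico, Finset.mem_filter, Finset.mem_range]
  exact and_comm

/-- The truncated Gibbs mean of the compressions of `τ`. -/
def gibbsMean (r : Fin k → ℝ) (β : ℝ) (τ : Toeplitz Θ →L[ℂ] ℂ) (N : ℕ) : Toeplitz Θ →L[ℂ] ℂ :=
  ∑ p ∈ Fintype.piFinset fun _ : Fin k => Finset.range N,
    ((∏ j, (1 - Real.exp (-β * r j)) * Real.exp (-β * r j) ^ p j : ℝ) : ℂ) • τ.comp (compress Θ p)

theorem gibbsMean_apply (τ : Toeplitz Θ →L[ℂ] ℂ) (N : ℕ) (A : Toeplitz Θ) :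
    gibbsMean r β τ N A = ∑ p ∈ Fintype.piFinset fun _ : Fin k => Finset.range N,
      ((∏ j, (1 - Real.exp (-β * r j)) * Real.exp (-β * r j) ^ p j : ℝ) : ℂ) *
        τ (compress Θ p A) := by
  rw [gibbsMean, sum_apply]
  rfl

theorem gibbs_weight_nonneg (hr : ∀ j, 0 < r j) (hβ : 0 < β) (p : Fin k → ℕ) :
    0 ≤ ∏ j, (1 - Real.exp (-β * r j)) * Real.exp (-β * r j) ^ p j := by
  refine Finset.prod_nonneg fun j _ => mul_nonneg ?_ (by positivity)
  have := mul_pos hβ (hr j)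
  rw [sub_nonneg, Real.exp_le_one_iff]
  linarith

/-- The truncated weights factor over the coordinates, and each partial geometric sum is at most
one. -/
theorem norm_gibbsMean_le (hr : ∀ j, 0 < r j) (hβ : 0 < β) {τ : Toeplitz Θ →L[ℂ] ℂ}
    (hτ : ‖τ‖ ≤ 1) (N : ℕ) : ‖gibbsMean r β τ N‖ ≤ 1 := by
  refine ContinuousLinearMap.opNorm_le_bound _ zero_le_one fun A => ?_
  rw [gibbsMean_apply]
  calc _ ≤ ∑ p ∈ Fintype.piFinset fun _ : Fin k => Finset.range N,
        (∏ j, (1 - Real.exp (-β * r j)) * Real.exp (-β * r j) ^ p j) * ‖A‖ := by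
        refine norm_sum_le_of_le _ fun p _ => ?_
        rw [norm_mul, Complex.norm_real, Real.norm_of_nonneg (gibbs_weight_nonneg hr hβ p)]
        gcongr
        · exact gibbs_weight_nonneg hr hβ p
        · exact (τ.le_of_opNorm_le hτ _).trans (by rw [one_mul]; exact norm_compress_le p A)
    _ ≤ 1 * ‖A‖ := by
        rw [← Finset.sum_mul, ← Finset.prod_univ_sum (fun _ : Fin k => Finset.range N)
          fun j i => (1 - Real.exp (-β * r j)) * Real.exp (-β * r j) ^ i]
        gcongr
        refine Finset.prod_le_one (fun j _ => ?_) fun j _ => ?_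
        · refine Finset.sum_nonneg fun i _ => mul_nonneg ?_ (by positivity)
          have := mul_pos hβ (hr j)
          rw [sub_nonneg, Real.exp_le_one_iff]
          linarith
        · rw [← Finset.mul_sum, mul_neg_geom_sum]
          have : 0 < Real.exp (-β * r j) ^ N := by positivity
          linarith

theorem gibbsMean_star_mul_self (hr : ∀ j, 0 < r j) (hβ : 0 < β) {τ : Toeplitz Θ →L[ℂ] ℂ}
    (hτ : ∀ a, 0 ≤ τ (star a * a)) (N : ℕ) (A : Toeplitz Θ) :
    0 ≤ gibbsMean r β τ N (star A * A) := by
  rw [gibbsMean_apply]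
  refine Finset.sum_nonneg fun p _ => mul_nonneg ?_ ?_
  · exact_mod_cast gibbs_weight_nonneg hr hβ p
  · rw [compress_star_mul_self]
    exact hτ _

-- The sum over the cube of p factors into one geometric series per coordinate, with the twisted
-- ratio; the limits multiply to the Euler product.
open Classical in
theorem tendsto_gibbsMean (hΘ : Θ.transpose = -Θ) (hr : ∀ j, 0 < r j) (hβ : 0 < β) (z : Torus m)
    {τ : Toeplitz Θ →L[ℂ] ℂ}
    (hτ : ∀ s t, τ (mono Θ s t) = if ∀ j, s (Sum.inl j) = 0 ∧ t (Sum.inl j) = 0 then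
      torusValue h ε z (fun i => (toInt s - toInt t) (Sum.inr i)) else 0)
    (s t : Fin k ⊕ Fin d → ℕ) :
    Filter.Tendsto (fun N => gibbsMean r β τ N (mono Θ s t)) Filter.atTop
      (nhds (kmsCoeff r β h ε z s (toInt s - toInt t))) := by
  set v : Fin d → ℤ := fun i => (toInt s - toInt t) (Sum.inr i) with hv
  have hval : ∀ p, τ (compress Θ p (mono Θ s t)) =
      if ∀ j, (toInt s - toInt t) (Sum.inl j) = 0 ∧ s (Sum.inl j) ≤ p j then
        (phase (2 * form Θ (toInt s - toInt t) (toInt (inK d p))) : ℂ) * torusValue h ε z v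
      else 0 := by
    intro p
    rw [compress_mono hΘ, map_smul, hτ, smul_eq_mul, mul_ite, mul_zero]
    -- Compression by p removes the ℕ^k part exactly when s and t agree there and lie below p, so
    -- each geometric series starts at s_j.
    have h1 : (∀ j : Fin k, ((s - inK d p) + (inK d p - (t + (inK d p - s)))) (Sum.inl j) = 0 ∧
        (t + (inK d p - s) - inK d p) (Sum.inl j) = 0) ↔
        ∀ j, (toInt s - toInt t) (Sum.inl j) = 0 ∧ s (Sum.inl j) ≤ p j := by
      refine forall_congr' fun j => ?_
      simp only [inK, toInt, Pi.add_apply, Pi.sub_apply, Sum.elim_inl]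
      omega
    have h2 : (fun i => (toInt ((s - inK d p) + (inK d p - (t + (inK d p - s)))) -
        toInt (t + (inK d p - s) - inK d p)) (Sum.inr i)) = v := by
      ext i
      simp only [hv, inK, toInt, Pi.add_apply, Pi.sub_apply, Sum.elim_inr, Pi.zero_apply]
      omega
    rw [h2]
    simp only [h1]
  by_cases hw : ∀ j, (toInt s - toInt t) (Sum.inl j) = 0
  · rw [kmsCoeff, if_pos hw, gibbsFactor, ← Finset.prod_mul_distrib]
    have hlim := tendsto_finsetProd (Finset.univ : Finset (Fin k)) fun j _ =>
      tendsto_sum_range_ite (norm_gibbsRatio_lt_one (Θ := Θ) hr hβ v j)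
        (1 - Complex.exp (-β * r j)) (s (Sum.inl j))
    refine (hlim.const_mul (torusValue h ε z v)).congr fun N => ?_
    rw [gibbsMean_apply, Finset.prod_univ_sum, Finset.mul_sum]
    refine Finset.sum_congr rfl fun p _ => ?_
    rw [hval, Finset.prod_ite_zero]
    simp only [Finset.mem_univ, true_imp_iff, hw, true_and]
    split_ifs with hsp
    · rw [Finset.prod_mul_distrib, prod_gibbsRatio_pow hΘ, energy_inK, eq_elim_zero hw]
      have h1 : (∏ j, Real.exp (-β * r j) ^ p j) = Real.exp (-β * ∑ j, p j * r j) := by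
        simp only [← Real.exp_nat_mul]
        rw [← Real.exp_sum, Finset.mul_sum]
        congr 1
        refine Finset.sum_congr rfl fun j _ => ?_
        ring
      rw [Finset.prod_mul_distrib, h1]
      push_cast
      ring
    · simp
  · rw [kmsCoeff, if_neg hw]
    refine tendsto_const_nhds.congr fun N => ?_
    rw [gibbsMean_apply, Finset.sum_eq_zero fun p _ => ?_]
    rw [hval, if_neg fun hc => hw fun j => (hc j).1, mul_zero]

theorem exists_kms_functional (hΘ : Θ.transpose = -Θ) (hε : IsLatticeSign h ε)
    (hr : ∀ j, 0 < r j) (hβ : 0 < β) (z : Torus m) :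
    ∃ φ : Toeplitz Θ →L[ℂ] ℂ, (∀ a, 0 ≤ φ (star a * a)) ∧ ‖φ‖ ≤ 1 ∧
      ∀ s t, φ (mono Θ s t) = kmsCoeff r β h ε z s (toInt s - toInt t) := by
  obtain ⟨τ, hpos, hnorm, hτ⟩ := exists_tracial_functional hΘ hε z
  exact exists_positive_of_tendsto (gibbsMean r β τ) (gibbsMean_star_mul_self hr hβ hpos)
    (norm_gibbsMean_le hr hβ hnorm) (tendsto_gibbsMean hΘ hr hβ z hτ)

theorem kmsCoeff_zero_zero (hε : IsLatticeSign h ε) (hr : ∀ j, 0 < r j) (hβ : 0 < β)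
    (z : Torus m) : kmsCoeff r β h ε z 0 0 = 1 := by
  have h1 : torusValue h ε z 0 = 1 := by
    have := torusValue_lat h ε z 0
    rw [lat_zero] at this
    rw [this, hε.zero, torusChar_eq, circleChar_zero, Circle.coe_one, mul_one]
  have h2 : (fun i => (0 : Fin k ⊕ Fin d → ℤ) (Sum.inr i)) = (0 : Fin d → ℤ) := rfl
  rw [kmsCoeff, if_pos (by simp), h2, h1, gibbsFactor_zero hr hβ]
  simp

end

/-! ### The Herglotz–Bochner theorem on the torus -/

section

variable {m : ℕ}

/-! ### Probability measures on the torus and their Fourier coefficients -/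

theorem integrable_of_continuous_torus (μ : Measure (Torus m)) [IsFiniteMeasure μ]
    {f : Torus m → ℂ} (hf : Continuous f) : Integrable f μ :=
  hf.integrable_of_hasCompactSupport (HasCompactSupport.of_compactSpace f)

/-- The bounded continuous function `z ↦ z^c`. -/
def charBCF (c : Fin m → ℤ) : BoundedContinuousFunction (Torus m) ℂ :=
  BoundedContinuousFunction.mkOfCompact ⟨fun z => torusChar z c, continuous_torusChar c⟩

/-- The linear span of the characters. -/
def trigSpan (m : ℕ) : Submodule ℂ (BoundedContinuousFunction (Torus m) ℂ) :=
  Submodule.span ℂ (Set.range charBCF)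

theorem charBCF_mem_trigSpan (c : Fin m → ℤ) : charBCF c ∈ trigSpan m :=
  Submodule.subset_span ⟨c, rfl⟩

/-- The trigonometric polynomials. -/
def trigPoly (m : ℕ) : StarSubalgebra ℂ (BoundedContinuousFunction (Torus m) ℂ) where
  carrier := trigSpan m
  mul_mem' := by
    intro f g hf hg
    have h : f * g ∈ trigSpan m * trigSpan m := Submodule.mul_mem_mul hf hg
    rw [trigSpan, Submodule.span_mul_span] at h
    refine Submodule.span_le.2 ?_ h
    rintro _ ⟨_, ⟨a, rfl⟩, _, ⟨b, rfl⟩, rfl⟩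
    refine Submodule.subset_span ⟨a + b, ?_⟩
    ext z
    change torusChar z (a + b) = torusChar z a * torusChar z b
    rw [torusChar_eq, circleChar_add, Circle.coe_mul]
    rfl
  add_mem' := add_mem
  algebraMap_mem' := fun c => by
    rw [Algebra.algebraMap_eq_smul_one]
    have h0 : (1 : BoundedContinuousFunction (Torus m) ℂ) = charBCF 0 := by
      ext z
      change 1 = torusChar z 0
      rw [torusChar_eq, circleChar_zero, Circle.coe_one]
    rw [h0]
    exact (trigSpan m).smul_mem _ (charBCF_mem_trigSpan 0)
  star_mem' := by
    intro f hf
    change star f ∈ trigSpan m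
    change f ∈ trigSpan m at hf
    induction hf using Submodule.span_induction with
    | mem x hx =>
      obtain ⟨c, rfl⟩ := hx
      refine Submodule.subset_span ⟨-c, ?_⟩
      ext z
      change torusChar z (-c) = (starRingEnd ℂ) (torusChar z c)
      rw [torusChar_eq, circleChar_neg, Circle.coe_inv_eq_conj]
      rfl
    | zero => simp
    | add x y _ _ hx hy => rw [star_add]; exact add_mem hx hy
    | smul c x _ hx => rw [star_smul]; exact Submodule.smul_mem _ _ hx

/-- Trigonometric polynomials form a point-separating *-algebra, which determines a finite measure.
-/
theorem measure_torus_ext {μ ν : Measure (Torus m)} [IsFiniteMeasure μ] [IsFiniteMeasure ν]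
    (h : ∀ c, ∫ z, torusChar z c ∂μ = ∫ z, torusChar z c ∂ν) : μ = ν := by
  refine ext_of_forall_mem_subalgebra_integral_eq_of_polish (𝕜 := ℂ) (A := trigPoly m) ?_ ?_
  · intro z w hzw
    obtain ⟨j, hj⟩ := Function.ne_iff.1 hzw
    refine ⟨_, ⟨_, ⟨charBCF (Pi.single j 1), charBCF_mem_trigSpan _, rfl⟩, rfl⟩, ?_⟩
    have hval : ∀ z : Torus m, torusChar z (Pi.single j 1) = z j := by
      intro z
      rw [torusChar_eq, circleChar, Finset.prod_eq_single j]
      · simp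
      · intro i _ hi; simp [Pi.single_eq_of_ne hi]
      · simp
    change torusChar z (Pi.single j 1) ≠ torusChar w (Pi.single j 1)
    rw [hval, hval]
    exact fun e => hj (Circle.ext e)
  · intro g hg
    change g ∈ trigSpan m at hg
    induction hg using Submodule.span_induction with
    | mem x hx => obtain ⟨c, rfl⟩ := hx; exact h c
    | zero => simp
    | add x y _ _ hx hy =>
      simp only [BoundedContinuousFunction.coe_add, Pi.add_apply]
      rw [integral_add (x.integrable _) (y.integrable _),
        integral_add (x.integrable _) (y.integrable _), hx, hy]
    | smul c x _ hx =>
      simp only [BoundedContinuousFunction.coe_smul, integral_smul, hx]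

theorem continuous_integral_torus {f : Torus m → ℂ} (hf : Continuous f) :
    Continuous fun μ : ProbabilityMeasure (Torus m) => ∫ z, f z ∂(μ : Measure (Torus m)) := by
  refine continuous_iff_continuousAt.2 fun μ => ?_
  exact (ProbabilityMeasure.tendsto_iff_forall_integral_rclike_tendsto ℂ).1 Filter.tendsto_id
    (BoundedContinuousFunction.mkOfCompact ⟨f, hf⟩)

/-- The Haar probability measure of the torus. -/
def torusHaar (m : ℕ) : Measure (Torus m) := Measure.haarMeasure ⊤

instance : IsProbabilityMeasure (torusHaar m) :=
  ⟨by simpa [torusHaar] using Measure.haarMeasure_self (K₀ := (⊤ : TopologicalSpace.PositiveCompacts (Torus m)))⟩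

instance : (torusHaar m).IsMulLeftInvariant := by unfold torusHaar; infer_instance

theorem exists_circleChar_ne_one {c : Fin m → ℤ} (hc : c ≠ 0) : ∃ g : Torus m,
    circleChar g c ≠ 1 := by
  obtain ⟨j, hj⟩ := Function.ne_iff.1 hc
  refine ⟨Pi.mulSingle j (Circle.exp (Real.pi / c j)), ?_⟩
  have h1 : circleChar (Pi.mulSingle j (Circle.exp (Real.pi / c j))) c =
      Circle.exp (Real.pi / c j) ^ c j := by
    rw [circleChar, Finset.prod_eq_single j]
    · simp
    · intro i _ hi; simp [Pi.mulSingle_eq_of_ne hi]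
    · simp
  have h2 : Circle.exp (Real.pi / c j) ^ c j = Circle.exp Real.pi := by
    rw [← Circle.exp_zsmul, zsmul_eq_mul]
    congr 1
    have : (c j : ℝ) ≠ 0 := by exact_mod_cast hj
    field_simp
  rw [h1, h2]
  intro h3
  have h4 := congrArg (fun w : Circle => (w : ℂ)) h3
  simp only [Circle.coe_exp, Complex.exp_pi_mul_I, Circle.coe_one] at h4
  norm_num at h4

/-- Translation by an element on which the character is not 1 leaves the integral fixed but
multiplies it by that value. -/
theorem integral_torusChar_haar (c : Fin m → ℤ) :
    ∫ z, torusChar z c ∂torusHaar m = if c = 0 then 1 else 0 := by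
  split_ifs with hc
  · subst hc
    simp [torusChar_eq]
  · obtain ⟨g, hg⟩ := exists_circleChar_ne_one hc
    have h1 := integral_mul_left_eq_self (μ := torusHaar m) (fun z => torusChar z c) g
    have h2 : ∀ z : Torus m, torusChar (g * z) c = circleChar g c * torusChar z c := by
      intro z
      rw [torusChar_eq, torusChar_eq, ← Circle.coe_mul]
      congr 1
      simp only [circleChar]
      rw [← Finset.prod_mul_distrib]
      exact Finset.prod_congr rfl fun j _ => by rw [Pi.mul_apply, mul_zpow]
    simp only [h2, integral_const_mul] at h1
    by_contra h0
    refine hg (Circle.ext ?_)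
    rw [Circle.coe_one]
    exact mul_right_cancel₀ h0 (by rw [h1, one_mul])

/-- The Fejér density of a function on `ℤ^m`. -/
def fejer (ψ : (Fin m → ℤ) → ℂ) (N : ℕ) (z : Torus m) : ℂ :=
  ((1 / (N : ℝ) ^ m : ℝ) : ℂ) * ∑ a ∈ box m N, ∑ b ∈ box m N, ψ (a - b) * torusChar z (b - a)

theorem continuous_fejer (ψ : (Fin m → ℤ) → ℂ) (N : ℕ) : Continuous (fejer ψ N) := by
  have := continuous_torusChar (m := m)
  unfold fejer
  fun_prop

theorem integral_torusChar_mul_fejer (ψ : (Fin m → ℤ) → ℂ) (N : ℕ) (c : Fin m → ℤ) :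
    ∫ z, fejer ψ N z * torusChar z c ∂torusHaar m =
      (((box m N).filter fun b => b + c ∈ box m N).card / (N : ℝ) ^ m : ℝ) * ψ c := by
  have hcont := continuous_torusChar (m := m)
  have h1 : ∀ z : Torus m, fejer ψ N z * torusChar z c = ((1 / (N : ℝ) ^ m : ℝ) : ℂ) *
      ∑ b ∈ box m N, ∑ a ∈ box m N, ψ (a - b) * torusChar z (b - a + c) := by
    intro z
    rw [fejer, mul_assoc, Finset.sum_mul, Finset.sum_comm]
    congr 1
    refine Finset.sum_congr rfl fun a _ => ?_
    rw [Finset.sum_mul]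
    refine Finset.sum_congr rfl fun b _ => ?_
    rw [torusChar_eq z (_ + c), circleChar_add, Circle.coe_mul, mul_assoc]
    rfl
  simp only [h1]
  rw [integral_const_mul, integral_finsetSum _ fun b _ =>
    integrable_of_continuous_torus _ (by fun_prop)]
  have h2 : ∀ b ∈ box m N, ∫ z, ∑ a ∈ box m N, ψ (a - b) * torusChar z (b - a + c) ∂torusHaar m =
      if b + c ∈ box m N then ψ c else 0 := by
    intro b _
    rw [integral_finsetSum _ fun a _ => integrable_of_continuous_torus _ (by fun_prop)]
    simp only [integral_const_mul, integral_torusChar_haar]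
    have h3 : ∀ a ∈ box m N, ψ (a - b) * (if b - a + c = 0 then 1 else 0) =
        if a = b + c then ψ c else 0 := by
      intro a _
      by_cases h : a = b + c
      · subst h
        simp
      · rw [if_neg h, if_neg fun h0 => h ?_, mul_zero]
        have : a = b + c - (b - a + c) := by abel
        rw [this, h0, sub_zero]
    rw [Finset.sum_congr rfl h3, Finset.sum_ite_eq']
  rw [Finset.sum_congr rfl h2, ← Finset.sum_filter, Finset.sum_const, nsmul_eq_mul]
  push_cast
  ring

/-- Positive definiteness tested on the vector a ↦ z^{-a}. -/
theorem fejer_nonneg {ψ : (Fin m → ℤ) → ℂ}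
    (hψ : ∀ (N : ℕ) (u : (Fin m → ℤ) → ℂ),
      0 ≤ ∑ a ∈ box m N, ∑ b ∈ box m N, u a * (starRingEnd ℂ) (u b) * ψ (a - b))
    (N : ℕ) (z : Torus m) : 0 ≤ fejer ψ N z := by
  refine mul_nonneg (by exact_mod_cast (by positivity : (0 : ℝ) ≤ 1 / (N : ℝ) ^ m)) ?_
  refine (hψ N fun a => torusChar z (-a)).trans_eq ?_
  refine Finset.sum_congr rfl fun a _ => Finset.sum_congr rfl fun b _ => ?_
  rw [torusChar_eq, torusChar_eq, torusChar_eq, ← Circle.coe_inv_eq_conj, ← circleChar_neg,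
    neg_neg, ← Circle.coe_mul, ← circleChar_add, mul_comm]
  congr 3
  abel

/-- The Fejér densities are nonnegative with Fourier coefficients ψ(c) times a Følner ratio. A
cluster point of these measures, which exists since the probability measures on the torus form a
compact space, has coefficients exactly ψ. -/
theorem exists_measure_of_posDef {ψ : (Fin m → ℤ) → ℂ}
    (hψ : ∀ (N : ℕ) (u : (Fin m → ℤ) → ℂ),
      0 ≤ ∑ a ∈ box m N, ∑ b ∈ box m N, u a * (starRingEnd ℂ) (u b) * ψ (a - b))
    (h1 : ψ 0 = 1) :
    ∃ μ : ProbabilityMeasure (Torus m), ∀ c, ∫ z, torusChar z c ∂(μ : Measure (Torus m)) = ψ c := by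
  let f : ℕ → Torus m → ℝ≥0 := fun N z => (fejer ψ N z).re.toNNReal
  have hf : ∀ N z, ((f N z : ℝ) : ℂ) = fejer ψ N z := fun N z => by
    have h := fejer_nonneg hψ N z
    have h2 := Complex.nonneg_iff.1 h
    apply Complex.ext
    · simp [f, h2.1]
    · simp [h2.2]
  have hfm : ∀ N, Measurable (f N) := fun N =>
    ((Complex.continuous_re.comp (continuous_fejer ψ N)).measurable).real_toNNReal
  have hint : ∀ N c, ∫ z, torusChar z c ∂((torusHaar m).withDensity fun z => f N z) =
      (((box m N).filter fun b => b + c ∈ box m N).card / (N : ℝ) ^ m : ℝ) * ψ c := by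
    intro N c
    rw [integral_withDensity_eq_integral_smul (hfm N), ← integral_torusChar_mul_fejer]
    refine integral_congr_ae (Filter.Eventually.of_forall fun z => ?_)
    change ((f N z : ℝ) : ℂ) * torusChar z c = _
    rw [hf]
  have hfin : ∀ N, IsFiniteMeasure ((torusHaar m).withDensity fun z => f N z) := fun N => by
    have hc : Continuous (f N) :=
      continuous_real_toNNReal.comp (Complex.continuous_re.comp (continuous_fejer ψ N))
    obtain ⟨C, hC⟩ := (isCompact_range hc).bddAbove
    refine isFiniteMeasure_withDensity (ne_of_lt ?_)
    calc ∫⁻ z, f N z ∂torusHaar m ≤ ∫⁻ _, C ∂torusHaar m :=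
          lintegral_mono fun z => ENNReal.coe_le_coe.2 (hC ⟨z, rfl⟩)
      _ < ⊤ := by simp
  -- The index is shifted because the box of side 0 is empty when m is positive and would give total
  -- mass zero.
  have hprob : ∀ N, IsProbabilityMeasure ((torusHaar m).withDensity fun z => f (N + 1) z) := by
    intro N
    have h2 := hint (N + 1) 0
    have h3 := hfin (N + 1)
    simp only [torusChar_eq, circleChar_zero, Circle.coe_one, integral_const, add_zero,
      Finset.filter_mem_eq_inter, Finset.inter_self, card_box, h1, mul_one] at h2
    refine ⟨?_⟩
    have h4 : ((torusHaar m).withDensity fun z => f (N + 1) z).real Set.univ = 1 := by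
      have h5 : ((((N + 1 : ℕ) : ℝ) ^ m) : ℝ) ≠ 0 := by positivity
      have h6 : ((((N + 1) ^ m : ℕ) : ℝ) / ((N + 1 : ℕ) : ℝ) ^ m) = 1 := by
        rw [Nat.cast_pow, div_self h5]
      rw [h6] at h2
      have h7 : ((((torusHaar m).withDensity fun z => f (N + 1) z).real Set.univ : ℝ) : ℂ) =
        ((1 : ℝ) : ℂ) := by simpa using h2
      exact_mod_cast h7
    rw [Measure.real, ENNReal.toReal_eq_one_iff] at h4
    exact h4
  let μ : ℕ → ProbabilityMeasure (Torus m) := fun N => ⟨_, hprob N⟩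
  let F : Ultrafilter ℕ := Filter.hyperfilter ℕ
  have hF : (F : Filter ℕ) ≤ Filter.atTop := Nat.cofinite_eq_atTop ▸ Filter.hyperfilter_le_cofinite
  obtain ⟨μ₀, -, hμ₀⟩ := isCompact_univ.ultrafilter_le_nhds (F.map μ) (by simp)
  refine ⟨μ₀, fun c => ?_⟩
  have hlim1 : Filter.Tendsto (fun N => ∫ z, torusChar z c ∂(μ N : Measure (Torus m))) F
      (nhds (∫ z, torusChar z c ∂(μ₀ : Measure (Torus m)))) :=
    ((continuous_integral_torus (continuous_torusChar c)).tendsto μ₀).comp hμ₀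
  have hlim2 : Filter.Tendsto (fun N => ∫ z, torusChar z c ∂(μ N : Measure (Torus m))) F
      (nhds (ψ c)) := by
    have h2 := (((Complex.continuous_ofReal.tendsto 1).comp (tendsto_card_box_inter c)).comp
      (Filter.tendsto_add_atTop_nat 1)).mul_const (ψ c)
    rw [Complex.ofReal_one, one_mul] at h2
    exact (h2.congr fun N => (hint (N + 1) c).symm).mono_left hF
  exact tendsto_nhds_unique hlim1 hlim2

end

section

variable {k d m : ℕ} {Θ : Matrix (Fin k ⊕ Fin d) (Fin k ⊕ Fin d) ℝ} {r : Fin k → ℝ} {β : ℝ}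
  {h : Module.Basis (Fin m) ℤ (degeneracyGroup Θ.toBlocks₂₂)} {ε : (Fin m → ℤ) → Circle}

/-! ### The KMS state of a probability measure -/

theorem continuous_torusValue (v : Fin d → ℤ) : Continuous fun z => torusValue h ε z v := by
  by_cases hv : v ∈ degeneracyGroup Θ.toBlocks₂₂
  · simp only [torusValue_of_mem h ε _ hv]
    exact (continuous_torusChar _).const_mul _
  · simp only [torusValue_of_notMem h ε _ hv]
    exact continuous_const

theorem continuous_kmsCoeff (s : Fin k ⊕ Fin d → ℕ) (w : Fin k ⊕ Fin d → ℤ) :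
    Continuous fun z => kmsCoeff r β h ε z s w := by
  unfold kmsCoeff
  split_ifs
  · exact (continuous_torusValue _).mul_const _
  · exact continuous_const

section
variable (hΘ : Θ.transpose = -Θ) (hε : IsLatticeSign h ε) (hr : ∀ j, 0 < r j) (hβ : 0 < β)

/-- The KMS functional attached to a point of the torus. -/
def kmsPoint (z : Torus m) : Toeplitz Θ →L[ℂ] ℂ :=
  (exists_kms_functional (r := r) (β := β) hΘ hε hr hβ z).choose

theorem kmsPoint_star_mul_self (z : Torus m) (a : Toeplitz Θ) :
    0 ≤ kmsPoint hΘ hε hr hβ z (star a * a) :=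
  (exists_kms_functional hΘ hε hr hβ z).choose_spec.1 a

theorem norm_kmsPoint_apply_le (z : Torus m) (a : Toeplitz Θ) :
    ‖kmsPoint hΘ hε hr hβ z a‖ ≤ ‖a‖ := by
  have h1 := (exists_kms_functional (r := r) (β := β) hΘ hε hr hβ z).choose_spec.2.1
  simpa using (kmsPoint hΘ hε hr hβ z).le_of_opNorm_le h1 a

theorem kmsPoint_mono (z : Torus m) (s t : Fin k ⊕ Fin d → ℕ) :
    kmsPoint hΘ hε hr hβ z (mono Θ s t) = kmsCoeff r β h ε z s (toInt s - toInt t) :=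
  (exists_kms_functional hΘ hε hr hβ z).choose_spec.2.2 s t

/-- The functionals are contractive uniformly in z, so continuity on monomials, where the values are
explicit, passes to norm limits. -/
theorem continuous_kmsPoint (a : Toeplitz Θ) :
    Continuous fun z => kmsPoint hΘ hε hr hβ z a := by
  refine toeplitz_induction hΘ (P := fun a => Continuous fun z => kmsPoint hΘ hε hr hβ z a)
    ?_ (fun s t => ?_) (by simpa using continuous_const) (fun a b ha hb => ?_)
    (fun c a ha => ?_) a
  · rw [← closure_subset_iff_isClosed]
    intro a ha
    refine continuous_of_uniform_approx_of_continuous fun u hu => ?_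
    obtain ⟨δ, hδ, hu⟩ := Metric.mem_uniformity_dist.1 hu
    obtain ⟨b, hb, hab⟩ := Metric.mem_closure_iff.1 ha δ hδ
    refine ⟨_, hb, fun z => hu ?_⟩
    rw [dist_eq_norm, ← map_sub]
    exact (norm_kmsPoint_apply_le hΘ hε hr hβ z _).trans_lt (by rwa [← dist_eq_norm])
  · simp only [kmsPoint_mono]
    exact continuous_kmsCoeff _ _
  · simp only [map_add]
    exact ha.add hb
  · simp only [map_smul]
    exact ha.const_smul c

theorem integrable_kmsPoint (μ : Measure (Torus m)) [IsFiniteMeasure μ] (a : Toeplitz Θ) :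
    Integrable (fun z => kmsPoint hΘ hε hr hβ z a) μ :=
  integrable_of_continuous_torus μ (continuous_kmsPoint hΘ hε hr hβ a)

/-- The KMS functional of a probability measure. -/
def kmsOf (μ : ProbabilityMeasure (Torus m)) : WeakDual ℂ (Toeplitz Θ) :=
  StrongDual.toWeakDual <| LinearMap.mkContinuous
    { toFun := fun a => ∫ z, kmsPoint hΘ hε hr hβ z a ∂(μ : Measure (Torus m))
      map_add' := fun a b => by
        simp only [map_add]
        exact integral_add (integrable_kmsPoint hΘ hε hr hβ _ a)
          (integrable_kmsPoint hΘ hε hr hβ _ b)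
      map_smul' := fun c a => by
        simp only [map_smul, RingHom.id_apply]
        exact integral_smul c _ }
    1 fun a => by
      change ‖∫ z, kmsPoint hΘ hε hr hβ z a ∂(μ : Measure (Torus m))‖ ≤ 1 * ‖a‖
      refine (norm_integral_le_of_norm_le_const (Filter.Eventually.of_forall fun z =>
        norm_kmsPoint_apply_le hΘ hε hr hβ z a)).trans ?_
      simp

theorem kmsOf_apply (μ : ProbabilityMeasure (Torus m)) (a : Toeplitz Θ) :
    kmsOf hΘ hε hr hβ μ a = ∫ z, kmsPoint hΘ hε hr hβ z a ∂(μ : Measure (Torus m)) := rfl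

theorem kmsOf_mono (μ : ProbabilityMeasure (Torus m)) (s t : Fin k ⊕ Fin d → ℕ) :
    kmsOf hΘ hε hr hβ μ (mono Θ s t) =
      ∫ z, kmsCoeff r β h ε z s (toInt s - toInt t) ∂(μ : Measure (Torus m)) := by
  simp only [kmsOf_apply, kmsPoint_mono]

theorem kmsOf_mem (μ : ProbabilityMeasure (Torus m)) :
    kmsOf hΘ hε hr hβ μ ∈ kmsStates (dynamics Θ (extendZero d r)) β := by
  rw [mem_kmsStates_iff hΘ _ _ hβ]
  refine ⟨⟨fun a => ?_, ?_⟩, fun s t u v => ?_⟩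
  · rw [kmsOf_apply]
    exact integral_nonneg fun z => kmsPoint_star_mul_self hΘ hε hr hβ z a
  · rw [← mono_zero_zero, kmsOf_mono]
    simp [kmsCoeff_zero_zero hε hr hβ]
  · rw [mono_mul hΘ, mono_mul hΘ, map_smul, map_smul, kmsOf_mono, kmsOf_mono, toInt_mono_mul,
      toInt_mono_mul, smul_eq_mul, smul_eq_mul, ← integral_const_mul, ← integral_const_mul,
      ← integral_const_mul, add_comm (toInt u - toInt v)]
    simp only [kmsCoeff_swap hΘ]

theorem continuous_kmsOf : Continuous (kmsOf (h := h) hΘ hε hr hβ) := by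
  refine WeakDual.continuous_of_continuous_eval fun a => ?_
  simp only [kmsOf_apply]
  exact continuous_integral_torus (continuous_kmsPoint hΘ hε hr hβ a)

theorem kmsOf_affine : IsAffineOnMeasures (kmsOf (h := h) hΘ hε hr hβ) := by
  intro μ ν ρ s t _ hρ
  refine DFunLike.ext _ _ fun a => ?_
  change kmsOf hΘ hε hr hβ ρ a = s * kmsOf hΘ hε hr hβ μ a + t * kmsOf hΘ hε hr hβ ν a
  rw [kmsOf_apply, kmsOf_apply, kmsOf_apply, hρ,
    integral_add_measure (integrable_kmsPoint hΘ hε hr hβ _ a)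
      (integrable_kmsPoint hΘ hε hr hβ _ a), integral_smul_nnreal_measure,
    integral_smul_nnreal_measure]
  rfl

theorem toInt_pos_sub_neg (v : Fin d → ℤ) :
    toInt (inD k fun i => (v i).toNat) - toInt (inD k fun i => (-v i).toNat) =
      Sum.elim (0 : Fin k → ℤ) v := by
  ext i
  rcases i with i | i
  · simp [toInt, inD]
  · simp only [toInt, inD, Pi.sub_apply, Sum.elim_inr]
    omega

theorem kmsCoeff_elim (z : Torus m) (s : Fin k ⊕ Fin d → ℕ) (v : Fin d → ℤ) :
    kmsCoeff r β h ε z s (Sum.elim (0 : Fin k → ℤ) v) = torusValue h ε z v *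
      (gibbsFactor Θ r β v * ∏ j, gibbsRatio Θ r β v j ^ s (Sum.inl j)) := by
  rw [kmsCoeff, if_pos (by simp)]
  rfl

/-- On a monomial of displacement h·c without ℕ^k part, the state is the c-th Fourier coefficient of
the measure times a nonzero constant. -/
theorem kmsOf_injective : Function.Injective (kmsOf (h := h) hΘ hε hr hβ) := by
  intro μ ν he
  suffices hμν : (μ : Measure (Torus m)) = ν from Subtype.ext hμν
  refine measure_torus_ext fun c => ?_
  have h1 := DFunLike.congr_fun he (mono Θ (inD k fun i => (lat h c i).toNat)
    (inD k fun i => (-lat h c i).toNat))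
  rw [kmsOf_mono, kmsOf_mono, toInt_pos_sub_neg] at h1
  have h2 : ∀ z : Torus m, kmsCoeff r β h ε z (inD k fun i => (lat h c i).toNat)
      (Sum.elim (0 : Fin k → ℤ) (lat h c)) =
      (ε c * gibbsFactor Θ r β (lat h c)) * torusChar z c := by
    intro z
    rw [kmsCoeff_elim, torusValue_lat]
    simp only [inD, Sum.elim_inl, Pi.zero_apply, pow_zero, Finset.prod_const_one]
    ring
  simp only [h2, integral_const_mul] at h1
  exact mul_left_cancel₀ (mul_ne_zero (Circle.coe_ne_zero _) (gibbsFactor_ne_zero hr hβ _)) h1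

end

end

/-! ### Rigidity of KMS states -/

section

/-! ### Positive functionals and projections of measure zero -/

theorem nonneg_of_forall_pos_add_mul {x c : ℝ} (hc : 0 ≤ c) (h : ∀ s : ℝ, 0 < s → 0 ≤ x + s * c) :
    0 ≤ x := by
  by_contra hx
  push Not at hx
  have hs : 0 < -x / (2 * (c + 1)) := div_pos (by linarith) (by linarith)
  have h1 := h _ hs
  have h2 : -x / (2 * (c + 1)) * c ≤ -x / 2 := by
    rw [div_mul_eq_mul_div, div_le_div_iff₀ (by linarith) (by norm_num)]
    nlinarith
  linarith

/-- The Cauchy–Schwarz argument for null vectors, by expanding φ on (q + t b^*)^*(q + t b^*) and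
letting t shrink. -/
theorem apply_mul_eq_zero_of_projection {A : Type*} [NormedRing A] [StarRing A] [NormedAlgebra ℂ A]
    [StarModule ℂ A] {φ : WeakDual ℂ A} (hφ : ∀ a : A, 0 ≤ φ (star a * a)) {q : A}
    (hq : star q = q) (hqq : q * q = q) (h0 : φ q = 0) (b : A) : φ (b * q) = 0 := by
  have hC := Complex.nonneg_iff.1 (hφ (star b))
  rw [star_star] at hC
  have key : ∀ t : ℂ, 0 ≤ t * φ (q * star b) + (starRingEnd ℂ) t * φ (b * q) +
      (starRingEnd ℂ) t * t * φ (b * star b) := by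
    intro t
    have h1 := hφ (q + t • star b)
    have h2 : star (q + t • star b) * (q + t • star b) = q + t • (q * star b) +
        (starRingEnd ℂ) t • (b * q) + ((starRingEnd ℂ) t * t) • (b * star b) := by
      rw [star_add, star_smul, star_star, hq, add_mul, mul_add, mul_add, hqq, mul_smul_comm,
        smul_mul_assoc, smul_mul_smul_comm]
      simp only [← add_assoc]
      rfl
    rw [h2] at h1
    simpa [h0] using h1
  -- With t = s u and s > 0, dividing by s leaves the linear term plus O(s). Applying this to u and
  -- -u kills the linear term; u = 1 and u = i then isolate φ(bq).
  have hz : ∀ u : ℂ, ‖u‖ = 1 → u * φ (q * star b) + (starRingEnd ℂ) u * φ (b * q) = 0 := by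
    intro u hu
    have huu : (starRingEnd ℂ) u * u = 1 := by
      rw [mul_comm, Complex.mul_conj, Complex.normSq_eq_norm_sq, hu]
      simp
    have key' : ∀ u : ℂ, (starRingEnd ℂ) u * u = 1 → ∀ s : ℝ, 0 < s →
        0 ≤ (u * φ (q * star b) + (starRingEnd ℂ) u * φ (b * q)).re + s * (φ (b * star b)).re ∧
        (u * φ (q * star b) + (starRingEnd ℂ) u * φ (b * q)).im = 0 := by
      intro u huu s hs
      have h1 := key (s * u)
      have h2 : (s * u) * φ (q * star b) + (starRingEnd ℂ) (s * u) * φ (b * q) +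
          (starRingEnd ℂ) (s * u) * (s * u) * φ (b * star b) =
          (s : ℂ) * ((u * φ (q * star b) + (starRingEnd ℂ) u * φ (b * q)) +
            s * φ (b * star b)) := by
        rw [map_mul (starRingEnd ℂ) (s : ℂ) u, Complex.conj_ofReal]
        linear_combination (s : ℂ) * s * φ (b * star b) * huu
      rw [h2] at h1
      have h3 := Complex.nonneg_iff.1 h1
      rw [Complex.re_ofReal_mul, Complex.im_ofReal_mul, Complex.add_re, Complex.add_im,
        Complex.re_ofReal_mul, Complex.im_ofReal_mul, ← hC.2, mul_zero, add_zero] at h3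
      exact ⟨(mul_nonneg_iff_of_pos_left hs).1 h3.1,
        (mul_eq_zero.1 h3.2.symm).resolve_left hs.ne'⟩
    have hpos := nonneg_of_forall_pos_add_mul hC.1 fun s hs => (key' u huu s hs).1
    have hneg := nonneg_of_forall_pos_add_mul hC.1 fun s hs =>
      (key' (-u) (by simpa using huu) s hs).1
    have hre : (-u * φ (q * star b) + (starRingEnd ℂ) (-u) * φ (b * q)).re =
        -(u * φ (q * star b) + (starRingEnd ℂ) u * φ (b * q)).re := by
      rw [← Complex.neg_re, map_neg]
      congr 1
      ring
    rw [hre] at hneg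
    exact Complex.ext (le_antisymm (neg_nonneg.1 hneg) hpos) (key' u huu 1 one_pos).2
  have h1 := hz 1 (by simp)
  have h2 := hz Complex.I (by simp)
  simp only [map_one, Complex.conj_I] at h1 h2
  have h3 : Complex.I * (2 * φ (b * q)) = 0 := by linear_combination Complex.I * h1 - h2
  simpa using h3

variable {k d m : ℕ} {Θ : Matrix (Fin k ⊕ Fin d) (Fin k ⊕ Fin d) ℝ} {r : Fin k → ℝ} {β : ℝ}

/-! ### The structure of KMS states -/

/-- The KMS condition on monomials. -/
def MonoKMS (Θ : Matrix (Fin k ⊕ Fin d) (Fin k ⊕ Fin d) ℝ) (r : Fin k → ℝ) (β : ℝ)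
    (φ : WeakDual ℂ (Toeplitz Θ)) : Prop :=
  φ ∈ states (Toeplitz Θ) ∧ ∀ s t u v, φ (mono Θ s t * mono Θ u v) =
    Complex.exp (β * energy (extendZero d r) (toInt u - toInt v)) * φ (mono Θ u v * mono Θ s t)

variable {φ : WeakDual ℂ (Toeplitz Θ)}

/-- Cycling the trailing L_a^* to the front makes it cancel the leading L_a, at the price of a
Boltzmann factor and a commutation phase. -/
theorem MonoKMS.shift (hφ : MonoKMS Θ r β φ) (hΘ : Θ.transpose = -Θ)
    (a s t : Fin k ⊕ Fin d → ℕ) : φ (mono Θ (a + s) (a + t)) =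
      Complex.exp (-β * energy (extendZero d r) (toInt a)) *
        phase (2 * form Θ (toInt s - toInt t) (toInt a)) * φ (mono Θ s t) := by
  have h1 := hφ.2 (a + s) t 0 a
  have e1 : a + s + (0 - t) = a + s := by ext i; simp
  have e2 : a + (t - 0) = a + t := by simp
  have e3 : 0 + (a + s - a) = s := by ext i; simp
  have e4 : t + (a - (a + s)) = t := by
    ext i
    simp only [Pi.add_apply, Pi.sub_apply]
    omega
  rw [mono_mul hΘ, mono_mul hΘ, e1, e2, e3, e4, map_smul, map_smul, toInt_zero, zero_sub,
    energy_neg, smul_eq_mul, smul_eq_mul] at h1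
  have h2 : phase (2 * form Θ (toInt s - toInt t) (toInt a)) =
      phase (-form Θ (toInt (a + s) - toInt t) (-toInt a)) *
        phase (form Θ (-toInt a) (toInt (a + s) - toInt t)) := by
    have hs := form_swap (toInt a) (toInt s) hΘ
    have ht := form_swap (toInt a) (toInt t) hΘ
    rw [← phase_add]
    congr 1
    simp only [toInt_add, form_neg_left, form_neg_right, form_sub_left, form_sub_right,
      form_add_left, form_add_right, form_self _ hΘ]
    linarith
  rw [h2, phase_neg, Circle.coe_mul, Circle.coe_inv]
  have h3 : (phase (form Θ (toInt (a + s) - toInt t) (-toInt a)) : ℂ) ≠ 0 := Circle.coe_ne_zero _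
  have h4 : φ (mono Θ (a + s) (a + t)) =
      (phase (form Θ (toInt (a + s) - toInt t) (-toInt a)) : ℂ)⁻¹ *
        ((phase (form Θ (toInt (a + s) - toInt t) (-toInt a)) : ℂ) *
          φ (mono Θ (a + s) (a + t))) := by
    rw [← mul_assoc, inv_mul_cancel₀ h3, one_mul]
  rw [h4, h1]
  push_cast
  rw [neg_mul, mul_neg]
  ring

theorem eq_zero_of_eq_exp_mul {E : ℝ} (hE : E ≠ 0) {x y : ℂ} (hxy : ‖x‖ = ‖y‖)
    (h : x = Complex.exp E * y) : x = 0 := by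
  rw [← norm_eq_zero]
  have h1 := congrArg (fun z : ℂ => ‖z‖) h
  simp only [norm_mul, Complex.norm_exp, Complex.ofReal_re, ← hxy] at h1
  have h2 : (Real.exp E - 1) * ‖x‖ = 0 := by linarith
  refine (mul_eq_zero.1 h2).resolve_left (sub_ne_zero.2 ?_)
  rwa [ne_eq, Real.exp_eq_one_iff]

theorem MonoKMS.eq_zero_of_energy (hφ : MonoKMS Θ r β φ) (hβ : 0 < β)
    {s t : Fin k ⊕ Fin d → ℕ} (hE : energy (extendZero d r) (toInt s - toInt t) ≠ 0) :
    φ (mono Θ s t) = 0 := by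
  have h1 := hφ.2 0 0 s t
  rw [mono_zero_zero, one_mul, mul_one] at h1
  exact eq_zero_of_eq_exp_mul (mul_ne_zero hβ.ne' hE) rfl (by rw [Complex.ofReal_mul]; exact h1)

theorem energy_toInt (r : Fin k → ℝ) (s : Fin k ⊕ Fin d → ℕ) :
    energy (extendZero d r) (toInt s) = ∑ j, s (Sum.inl j) * r j := by
  simp [energy, Fintype.sum_sum_type, toInt, extendZero]

theorem energy_toInt_pos (hr : ∀ j, 0 < r j) {s : Fin k ⊕ Fin d → ℕ} {j : Fin k}
    (hj : s (Sum.inl j) ≠ 0) : 0 < energy (extendZero d r) (toInt s) := by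
  rw [energy_toInt]
  refine Finset.sum_pos' (fun i _ => by have := hr i; positivity) ⟨j, Finset.mem_univ _, ?_⟩
  have := hr j
  have : 0 < s (Sum.inl j) := Nat.pos_of_ne_zero hj
  positivity

/-- Total energy alone does not suffice, since the r_j may be rationally dependent and the energies
of s and t may coincide. Instead only part of the monomial is cycled. -/
theorem MonoKMS.eq_zero_of_disjoint (hφ : MonoKMS Θ r β φ) (hΘ : Θ.transpose = -Θ)
    (hr : ∀ j, 0 < r j) (hβ : 0 < β) {s t : Fin k ⊕ Fin d → ℕ}
    (hd : ∀ j, s (Sum.inl j) = 0 ∨ t (Sum.inl j) = 0) {j : Fin k}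
    (hj : s (Sum.inl j) ≠ t (Sum.inl j)) : φ (mono Θ s t) = 0 := by
  by_cases ht : ∃ i, t (Sum.inl i) ≠ 0
  · obtain ⟨i, hi⟩ := ht
    set P : Fin k ⊕ Fin d → ℕ := inK d fun j => s (Sum.inl j) with hP
    have hPl : ∀ j, P (Sum.inl j) = s (Sum.inl j) := fun j => rfl
    have hPr : ∀ j, P (Sum.inr j) = 0 := fun j => rfl
    -- Splitting off the ℕ^k part P of s: as P and t are disjoint, both orders of the product give
    -- the same monomial up to a phase, while the KMS factor has modulus e^{-βE(t)} < 1.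
    have h1 := hφ.2 P 0 (s - P) t
    have e1 : P + (s - P - 0) = s := by
      ext (i | i)
      · simp only [Pi.add_apply, Pi.sub_apply, Pi.zero_apply, hPl]; omega
      · simp only [Pi.add_apply, Pi.sub_apply, Pi.zero_apply, hPr]; omega
    have e2 : t + (0 - (s - P)) = t := by
      ext i; simp
    have e3 : s - P + (P - t) = s := by
      ext (i | i)
      · have := hd i
        simp only [Pi.add_apply, Pi.sub_apply, hPl]; omega
      · simp only [Pi.add_apply, Pi.sub_apply, hPr]; omega
    have e4 : 0 + (t - P) = t := by
      ext (i | i)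
      · have := hd i
        simp only [Pi.add_apply, Pi.sub_apply, Pi.zero_apply, hPl]; omega
      · simp only [Pi.add_apply, Pi.sub_apply, Pi.zero_apply, hPr]; omega
    rw [mono_mul hΘ, mono_mul hΘ, e1, e2, e3, e4, map_smul, map_smul] at h1
    have hE : energy (extendZero d r) (toInt (s - P) - toInt t) < 0 := by
      have h2 : energy (extendZero d r) (toInt (s - P)) = 0 := by
        rw [energy_toInt]
        refine Finset.sum_eq_zero fun j _ => ?_
        simp [hPl]
      rw [energy_sub, h2, zero_sub, neg_lt_zero]
      exact energy_toInt_pos hr hi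
    rw [← Complex.ofReal_mul] at h1
    have h2 := eq_zero_of_eq_exp_mul (mul_ne_zero hβ.ne' hE.ne)
      (by rw [norm_smul, norm_smul, Circle.norm_coe, Circle.norm_coe]) h1
    exact (smul_eq_zero.1 h2).resolve_left (Circle.coe_ne_zero _)
  · push Not at ht
    refine hφ.eq_zero_of_energy hβ ?_
    have h2 : energy (extendZero d r) (toInt t) = 0 := by
      rw [energy_toInt]
      refine Finset.sum_eq_zero fun j _ => ?_
      simp [ht]
    rw [energy_sub, h2, sub_zero]
    exact (energy_toInt_pos hr (by rw [ht j] at hj; exact hj)).ne'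

/-- Factoring out the infimum of s and t by `MonoKMS.shift` reduces to disjoint ℕ^k parts. -/
theorem MonoKMS.eq_zero_of_ne (hφ : MonoKMS Θ r β φ) (hΘ : Θ.transpose = -Θ)
    (hr : ∀ j, 0 < r j) (hβ : 0 < β) {s t : Fin k ⊕ Fin d → ℕ} {j : Fin k}
    (hj : s (Sum.inl j) ≠ t (Sum.inl j)) : φ (mono Θ s t) = 0 := by
  set a : Fin k ⊕ Fin d → ℕ := s ⊓ t with ha
  have has : a + (s - a) = s := add_tsub_cancel_of_le inf_le_left
  have hat : a + (t - a) = t := add_tsub_cancel_of_le inf_le_right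
  rw [← has, ← hat, hφ.shift hΘ, hφ.eq_zero_of_disjoint hΘ hr hβ (j := j), mul_zero]
  · intro i
    simp only [ha, Pi.sub_apply, Pi.inf_apply]
    omega
  · simp only [ha, Pi.sub_apply, Pi.inf_apply]
    omega

theorem MonoKMS.apply_diag (hφ : MonoKMS Θ r β φ) (hΘ : Θ.transpose = -Θ)
    {b : Fin k ⊕ Fin d → ℕ} (hb : ∀ j, b (Sum.inl j) = 0) : φ (mono Θ b b) = 1 := by
  have h1 := hφ.shift hΘ b 0 0
  rw [add_zero, mono_zero_zero, hφ.1.2, energy_toInt] at h1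
  rw [h1]
  simp [hb]

theorem mono_diag_mul_self (hΘ : Θ.transpose = -Θ) (b : Fin k ⊕ Fin d → ℕ) :
    mono Θ b b * mono Θ b b = mono Θ b b := by
  rw [mono_mul hΘ]
  simp

/-- Zero-energy range projections have mass one, so their complements are null and can be inserted
freely: under φ the isometries of ℕ^d behave as unitaries. -/
theorem MonoKMS.apply_add (hφ : MonoKMS Θ r β φ) (hΘ : Θ.transpose = -Θ)
    {a x y : Fin k ⊕ Fin d → ℕ} (ha : ∀ j, a (Sum.inl j) = 0) (hy : ∀ j, y (Sum.inl j) = 0) :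
    φ (mono Θ (a + x) (a + y)) = φ (mono Θ x y) := by
  have hb : ∀ j, (a + y) (Sum.inl j) = 0 := fun j => by simp [ha, hy]
  have h1 := apply_mul_eq_zero_of_projection (q := 1 - mono Θ (a + y) (a + y)) hφ.1.1
    (by rw [star_sub, star_one, star_mono hΘ])
    (by rw [sub_mul, one_mul, mul_sub, mul_one, mono_diag_mul_self hΘ, sub_self, sub_zero])
    (by rw [map_sub, hφ.1.2, hφ.apply_diag hΘ hb, sub_self]) (mono Θ x y)
  rw [mul_sub, mul_one, map_sub, sub_eq_zero, mono_mul hΘ] at h1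
  have e1 : x + (a + y - y) = a + x := by
    rw [add_tsub_cancel_right, add_comm]
  have e2 : a + y + (y - (a + y)) = a + y := by
    ext i
    simp only [Pi.add_apply, Pi.sub_apply]
    omega
  rw [e1, e2, sub_self, form_zero_right, phase_zero, Circle.coe_one, one_smul] at h1
  exact h1.symm

/-- The value of `φ` at `L_x L_y^*` with `x - y = v`, up to a phase. -/
def degValue (φ : WeakDual ℂ (Toeplitz Θ)) (v : Fin d → ℤ) : ℂ :=
  φ (mono Θ (inD k fun i => (v i).toNat) (inD k fun i => (-v i).toNat))

/-- Two pairs in ℕ^d with the same difference have a common translate, so the value depends on the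
difference alone. -/
theorem MonoKMS.apply_inD (hφ : MonoKMS Θ r β φ) (hΘ : Θ.transpose = -Θ)
    {s t : Fin k ⊕ Fin d → ℕ} (hs : ∀ j, s (Sum.inl j) = 0) (ht : ∀ j, t (Sum.inl j) = 0) :
    φ (mono Θ s t) = degValue φ fun i => (toInt s - toInt t) (Sum.inr i) := by
  set x : Fin k ⊕ Fin d → ℕ := inD k fun i => ((toInt s - toInt t) (Sum.inr i)).toNat with hx
  set y : Fin k ⊕ Fin d → ℕ := inD k fun i => (-(toInt s - toInt t) (Sum.inr i)).toNat with hy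
  have e : y + s = t + x := by
    ext (i | i)
    · simp [hx, hy, inD, hs, ht]
    · simp only [hx, hy, inD, Pi.add_apply, Sum.elim_inr, toInt, Pi.sub_apply]
      omega
  change φ (mono Θ s t) = φ (mono Θ x y)
  rw [← hφ.apply_add hΘ (a := y) (fun j => rfl) ht, e, add_comm y t,
    hφ.apply_add hΘ ht fun j => rfl]

/-- Translating both indices by w ∈ ℕ^d changes the value by a commutation phase according to
`MonoKMS.shift`, and not at all according to `MonoKMS.apply_add`. A nonzero value makes all these
phases trivial, which means v ∈ H. -/
theorem MonoKMS.degValue_eq_zero (hφ : MonoKMS Θ r β φ) (hΘ : Θ.transpose = -Θ)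
    {v : Fin d → ℤ} (hv : v ∉ degeneracyGroup Θ.toBlocks₂₂) : degValue φ v = 0 := by
  by_contra h0
  refine hv (mem_degeneracyGroup_of_phase fun w => ?_)
  have hw : ∀ j, inD k w (Sum.inl j) = 0 := fun _ => rfl
  have h1 := hφ.shift hΘ (inD k w) (inD k fun i => (v i).toNat) (inD k fun i => (-v i).toNat)
  have hE : energy (extendZero d r) (toInt (inD k w)) = 0 := by
    rw [energy_toInt]
    simp [hw]
  have hwI : toInt (inD k w) = Sum.elim (0 : Fin k → ℤ) (toInt w) := by
    ext (i | i) <;> simp [toInt, inD]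
  rw [hφ.apply_add hΘ hw fun _ => rfl, hE, toInt_pos_sub_neg, hwI, form_elim_elim] at h1
  change degValue φ v = _ * degValue φ v at h1
  apply Circle.ext
  rw [Circle.coe_one]
  refine mul_right_cancel₀ h0 ?_
  rw [one_mul]
  conv_rhs => rw [h1]
  simp

theorem MonoKMS.apply_mono (hφ : MonoKMS Θ r β φ) (hΘ : Θ.transpose = -Θ)
    {s t : Fin k ⊕ Fin d → ℕ} (hst : ∀ j, s (Sum.inl j) = t (Sum.inl j)) :
    φ (mono Θ s t) = degValue φ (fun i => (toInt s - toInt t) (Sum.inr i)) *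
      ∏ j, gibbsRatio Θ r β (fun i => (toInt s - toInt t) (Sum.inr i)) j ^ s (Sum.inl j) := by
  set a : Fin k ⊕ Fin d → ℕ := inK d fun j => s (Sum.inl j) with ha
  have hal : ∀ j, a (Sum.inl j) = s (Sum.inl j) := fun j => rfl
  have har : ∀ j, a (Sum.inr j) = 0 := fun j => rfl
  have has : a + (s - a) = s := by
    ext (i | i)
    · simp only [Pi.add_apply, Pi.sub_apply, hal]; omega
    · simp only [Pi.add_apply, Pi.sub_apply, har]; omega
  have hat : a + (t - a) = t := by
    ext (i | i)
    · simp only [Pi.add_apply, Pi.sub_apply, hal, hst]; omega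
    · simp only [Pi.add_apply, Pi.sub_apply, har]; omega
  have hsub : toInt (s - a) - toInt (t - a) = toInt s - toInt t := by
    conv_rhs => rw [← has, ← hat]
    simp only [toInt_add]
    abel
  have hw : ∀ j, (toInt s - toInt t) (Sum.inl j) = 0 := fun j => by
    simp [toInt, hst]
  have h1 := hφ.shift hΘ a (s - a) (t - a)
  rw [has, hat, hφ.apply_inD hΘ (s := s - a) (t := t - a) (fun j => by simp [hal])
    (fun j => by simp [hal, hst]), hsub] at h1
  rw [h1, prod_gibbsRatio_pow hΘ, ← eq_elim_zero hw, mul_comm]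

end

/-! ### Recovering the measure from a KMS state -/

section

variable {k d m : ℕ} {Θ : Matrix (Fin k ⊕ Fin d) (Fin k ⊕ Fin d) ℝ} {r : Fin k → ℝ} {β : ℝ}
  {φ : WeakDual ℂ (Toeplitz Θ)}

/-! ### The vacuum projection -/

/-- The indicator vector of a set of generators of `ℕ^k`. -/
def indK (d : ℕ) (S : Finset (Fin k)) : Fin k ⊕ Fin d → ℕ := inK d fun j => if j ∈ S then 1 else 0

/-- The projection `∏_{j ≤ k} (1 - L_{e_j} L_{e_j}^*)`, in expanded form. -/
def vacProj (Θ : Matrix (Fin k ⊕ Fin d) (Fin k ⊕ Fin d) ℝ) : Toeplitz Θ :=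
  ∑ S ∈ (Finset.univ : Finset (Fin k)).powerset,
    ((-1 : ℂ) ^ S.card) • mono Θ (indK d S) (indK d S)

theorem star_vacProj (hΘ : Θ.transpose = -Θ) : star (vacProj Θ) = vacProj Θ := by
  rw [vacProj, star_sum]
  refine Finset.sum_congr rfl fun S _ => ?_
  rw [star_smul, star_mono hΘ]
  simp

-- Inclusion–exclusion: the alternating sum over subsets of the support of the ℕ^k part of q
-- vanishes unless that support is empty.
open Classical in
theorem vacProj_delta (hΘ : Θ.transpose = -Θ) (q : Fin k ⊕ Fin d → ℕ) :
    (vacProj Θ : BddOp (Fin k ⊕ Fin d → ℕ)) (delta q) =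
      if ∀ j, q (Sum.inl j) = 0 then delta q else 0 := by
  have hcoe : (vacProj Θ : BddOp (Fin k ⊕ Fin d → ℕ)) =
      ∑ S ∈ (Finset.univ : Finset (Fin k)).powerset,
        ((-1 : ℂ) ^ S.card) • (mono Θ (indK d S) (indK d S) : BddOp (Fin k ⊕ Fin d → ℕ)) := by
    simp [vacProj]
  set Z : Finset (Fin k) := Finset.univ.filter fun j => q (Sum.inl j) ≠ 0 with hZ
  have hle : ∀ S : Finset (Fin k), indK d S ≤ q ↔ S ⊆ Z := by
    intro S
    constructor
    · intro hS j hj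
      have h1 : (if j ∈ S then 1 else 0) ≤ q (Sum.inl j) := hS (Sum.inl j)
      rw [if_pos hj] at h1
      simp only [hZ, Finset.mem_filter, Finset.mem_univ, true_and]
      omega
    · rintro hS (j | i)
      · change (if j ∈ S then 1 else 0) ≤ q (Sum.inl j)
        split_ifs with hj
        · have := hS hj
          simp only [hZ, Finset.mem_filter, Finset.mem_univ, true_and] at this
          omega
        · exact Nat.zero_le _
      · exact Nat.zero_le _
  have hterm : ∀ S ∈ (Finset.univ : Finset (Fin k)).powerset,
      (((-1 : ℂ) ^ S.card) • (mono Θ (indK d S) (indK d S) : BddOp (Fin k ⊕ Fin d → ℕ)))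
        (delta q) = if S ∈ Z.powerset then ((-1 : ℂ) ^ S.card) • delta q else 0 := by
    intro S _
    rw [smul_apply, mono_delta hΘ]
    by_cases hS : indK d S ≤ q
    · rw [if_pos hS, if_pos (Finset.mem_powerset.2 ((hle S).1 hS)), sub_self, form_zero_left,
        phase_zero, Circle.coe_one, one_smul, tsub_add_cancel_of_le hS]
    · rw [if_neg hS, if_neg fun hc => hS ((hle S).2 (Finset.mem_powerset.1 hc)), smul_zero]
  have hsum : (∑ S ∈ Z.powerset, (-1 : ℂ) ^ S.card) = if Z = ∅ then 1 else 0 := by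
    have := Finset.sum_powerset_neg_one_pow_card (x := Z)
    have h2 := congrArg (fun n : ℤ => (n : ℂ)) this
    push_cast at h2
    exact h2
  rw [hcoe, sum_apply, Finset.sum_congr rfl hterm, ← Finset.sum_filter,
    Finset.powerset_univ, Finset.filter_mem_eq_inter, Finset.univ_inter, ← Finset.sum_smul, hsum]
  have hZe : Z = ∅ ↔ ∀ j, q (Sum.inl j) = 0 := by
    simp [hZ, Finset.filter_eq_empty_iff]
  simp only [hZe]
  split_ifs <;> simp

theorem vacProj_mul_self (hΘ : Θ.transpose = -Θ) : vacProj Θ * vacProj Θ = vacProj Θ := by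
  classical
  apply Subtype.ext
  refine ext_delta fun q => ?_
  change (vacProj Θ : BddOp (Fin k ⊕ Fin d → ℕ))
    ((vacProj Θ : BddOp (Fin k ⊕ Fin d → ℕ)) (delta q)) = _
  rw [vacProj_delta hΘ]
  split_ifs with hq
  · rw [vacProj_delta hΘ, if_pos hq]
  · simp

theorem mono_vacProj_mono (hΘ : Θ.transpose = -Θ) (x y : Fin k ⊕ Fin d → ℕ) :
    mono Θ x 0 * vacProj Θ * mono Θ 0 y =
      ∑ S ∈ (Finset.univ : Finset (Fin k)).powerset, ((-1 : ℂ) ^ S.card) •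
        ((phase (-form Θ (toInt x) (toInt y)) : ℂ) • mono Θ (x + indK d S) (y + indK d S)) := by
  rw [vacProj, Finset.mul_sum, Finset.sum_mul]
  refine Finset.sum_congr rfl fun S _ => ?_
  have e1 : indK d S + (0 - indK d S) = indK d S := by simp
  have e2 : x + indK d S + (0 - indK d S) = x + indK d S := by simp
  rw [mul_smul_comm, smul_mul_assoc, mono_mul hΘ, smul_mul_assoc, tsub_zero, e1, mono_mul hΘ,
    tsub_zero, e2, sub_self, form_zero_right, phase_zero, Circle.coe_one, one_smul]
  congr 3
  rw [toInt_add, toInt_zero, zero_sub, form_neg_right, add_sub_cancel_right]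

/-- The alternating sum of products of Gibbs ratios is the expansion of ∏(1 - ratio), the
denominator of the Euler product. -/
theorem MonoKMS.apply_vacProj (hφ : MonoKMS Θ r β φ) (hΘ : Θ.transpose = -Θ)
    {x y : Fin k ⊕ Fin d → ℕ} (hx : ∀ j, x (Sum.inl j) = 0) (hy : ∀ j, y (Sum.inl j) = 0) :
    φ (mono Θ x 0 * vacProj Θ * mono Θ 0 y) = phase (-form Θ (toInt x) (toInt y)) *
      (degValue φ (fun i => (toInt x - toInt y) (Sum.inr i)) *
        ∏ j, (1 - gibbsRatio Θ r β (fun i => (toInt x - toInt y) (Sum.inr i)) j)) := by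
  set v : Fin d → ℤ := fun i => (toInt x - toInt y) (Sum.inr i) with hv
  have hprod : ∏ j, (1 - gibbsRatio Θ r β v j) =
      ∑ S ∈ (Finset.univ : Finset (Fin k)).powerset,
        (-1 : ℂ) ^ S.card * ∏ j ∈ S, gibbsRatio Θ r β v j := by
    simp only [sub_eq_add_neg]
    rw [Finset.prod_one_add]
    exact Finset.sum_congr rfl fun S _ => Finset.prod_neg _
  rw [mono_vacProj_mono hΘ, map_sum, hprod, Finset.mul_sum, Finset.mul_sum]
  refine Finset.sum_congr rfl fun S _ => ?_
  have e : toInt (x + indK d S) - toInt (y + indK d S) = toInt x - toInt y := by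
    rw [toInt_add, toInt_add]
    abel
  rw [map_smul, map_smul, hφ.apply_mono hΘ fun j => by simp [hx, hy], e]
  have hpow : ∏ j, gibbsRatio Θ r β v j ^ (x + indK d S) (Sum.inl j) =
      ∏ j ∈ S, gibbsRatio Θ r β v j := by
    rw [← Finset.prod_subset (Finset.subset_univ S)]
    · refine Finset.prod_congr rfl fun j hj => ?_
      simp [hx, indK, inK, hj]
    · intro j _ hj
      simp [hx, indK, inK, hj]
  rw [hpow, smul_eq_mul, smul_eq_mul]
  ring

/-! ### Every KMS state comes from a probability measure -/

section
variable {h : Module.Basis (Fin m) ℤ (degeneracyGroup Θ.toBlocks₂₂)} {ε : (Fin m → ℤ) → Circle}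

/-- The Fourier coefficients of the measure of a KMS state. -/
def kmsFourier (h : Module.Basis (Fin m) ℤ (degeneracyGroup Θ.toBlocks₂₂))
    (ε : (Fin m → ℤ) → Circle) (r : Fin k → ℝ) (β : ℝ) (φ : WeakDual ℂ (Toeplitz Θ))
    (c : Fin m → ℤ) : ℂ :=
  ε c * degValue φ (lat h c) / gibbsFactor Θ r β (lat h c)

theorem kmsFourier_mul (hε : IsLatticeSign h ε) (hr : ∀ j, 0 < r j) (hβ : 0 < β)
    (c : Fin m → ℤ) : degValue φ (lat h c) =
      ε c * kmsFourier h ε r β φ c * gibbsFactor Θ r β (lat h c) := by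
  have h1 := gibbsFactor_ne_zero (Θ := Θ) hr hβ (lat h c)
  have h2 : (ε c : ℂ) * ε c = 1 := by
    rw [← Circle.coe_mul, ← sq, hε.sq_eq_one, Circle.coe_one]
  rw [kmsFourier, mul_assoc, div_mul_cancel₀ _ h1, ← mul_assoc, h2, one_mul]

theorem gibbsFactor_mul_prod (hr : ∀ j, 0 < r j) (hβ : 0 < β) (v : Fin d → ℤ) :
    gibbsFactor Θ r β v * ∏ j, (1 - gibbsRatio Θ r β v j) =
      ((∏ j, (1 - Real.exp (-β * r j)) : ℝ) : ℂ) := by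
  rw [gibbsFactor, ← Finset.prod_mul_distrib]
  push_cast
  exact Finset.prod_congr rfl fun j _ => div_mul_cancel₀ _ (one_sub_gibbsRatio_ne_zero hr hβ v j)

/-- Positivity of φ on (Q X^*)^*(Q X^*), with Q the vacuum projection and X a combination of
isometries along H, is the required inequality: Q cancels the v-dependent denominators and leaves
the positive constant Z. -/
theorem MonoKMS.kmsFourier_posDef (hφ : MonoKMS Θ r β φ) (hΘ : Θ.transpose = -Θ)
    (hε : IsLatticeSign h ε) (hr : ∀ j, 0 < r j) (hβ : 0 < β) (N : ℕ) (u : (Fin m → ℤ) → ℂ) :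
    0 ≤ ∑ a ∈ box m N, ∑ b ∈ box m N, u a * (starRingEnd ℂ) (u b) *
      kmsFourier h ε r β φ (a - b) := by
  set Z : ℝ := ∏ j, (1 - Real.exp (-β * r j)) with hZ
  have hZpos : 0 < Z := Finset.prod_pos fun j _ => by
    have := mul_pos hβ (hr j)
    rw [sub_pos, Real.exp_lt_one_iff]
    linarith
  -- Lattice points may have negative coordinates, so they are translated into ℕ^d; only differences
  -- matter, and the even translation leaves no phase.
  let x : (Fin m → ℤ) → Fin k ⊕ Fin d → ℕ := fun a => boxPoint h N a
  let X : Toeplitz Θ := ∑ a ∈ box m N, (u a * ε a) • mono Θ (x a) 0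
  have hpos := hφ.1.1 (vacProj Θ * star X)
  have hX : star (vacProj Θ * star X) * (vacProj Θ * star X) =
      ∑ a ∈ box m N, ∑ b ∈ box m N, (u a * ε a * (starRingEnd ℂ) (u b * ε b)) •
        (mono Θ (x a) 0 * vacProj Θ * mono Θ 0 (x b)) := by
    rw [star_mul, star_star, star_vacProj hΘ, mul_assoc, ← mul_assoc (vacProj Θ),
      vacProj_mul_self hΘ, ← mul_assoc]
    simp only [X, star_sum, star_smul, star_mono hΘ, Finset.sum_mul, Finset.mul_sum,
      smul_mul_assoc, mul_smul_comm, Finset.smul_sum]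
    rw [Finset.sum_comm]
    refine Finset.sum_congr rfl fun a _ => Finset.sum_congr rfl fun b _ => ?_
    rw [smul_smul]
    congr 1
    rw [mul_comm]
    rfl
  have hval : ∀ a ∈ box m N, ∀ b ∈ box m N, φ (mono Θ (x a) 0 * vacProj Θ * mono Θ 0 (x b)) =
      ε a * ε b * (Z * kmsFourier h ε r β φ (a - b)) := by
    intro a ha b hb
    have hv : (fun i => (toInt (x a) - toInt (x b)) (Sum.inr i)) = lat h (a - b) := by
      rw [toInt_boxPoint h ha, toInt_boxPoint h hb, sub_eq_add_neg a, lat_add, lat_neg]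
      ext i
      simp only [Pi.sub_apply, Sum.elim_inr, Pi.add_apply, Pi.neg_apply]
      ring
    rw [hφ.apply_vacProj hΘ (fun _ => rfl) fun _ => rfl, hv, kmsFourier_mul hε hr hβ, hZ,
      ← gibbsFactor_mul_prod (Θ := Θ) hr hβ (lat h (a - b))]
    have hD := toBlocks_transpose hΘ
    have hph : phase (-form Θ (toInt (x a)) (toInt (x b))) * ε (a - b) = ε a * ε b := by
      rw [toInt_boxPoint h ha, toInt_boxPoint h hb, form_elim_elim, sub_eq_add_neg,
        hε.map_add_eq, hε.neg hD, lat_neg, form_neg_right]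
      set M : Fin d → ℤ := fun _ => (boxShift h N : ℤ) with hM
      have e1 : form Θ.toBlocks₂₂ ((2 : ℤ) • M + lat h a) ((2 : ℤ) • M + lat h b) =
          -(2 * form Θ.toBlocks₂₂ (lat h b) M) + 2 * form Θ.toBlocks₂₂ (lat h a) M +
            form Θ.toBlocks₂₂ (lat h a) (lat h b) := by
        simp only [two_smul, form_add_left, form_add_right, form_self M hD,
          form_swap (lat h b) M hD]
        ring
      have e2 : phase (-(form Θ.toBlocks₂₂ (lat h a) (lat h b))) *
          phase (-(form Θ.toBlocks₂₂ (lat h a) (lat h b))) = 1 := by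
        rw [phase_neg, ← mul_inv, ← phase_add, ← two_mul, phase_two_mul_form (lat_mem h a),
          inv_one]
      rw [e1, neg_add, neg_add, neg_neg, phase_add, phase_add, phase_neg (2 * _),
        phase_two_mul_form (lat_mem h b), phase_two_mul_form (lat_mem h a), inv_one, one_mul,
        one_mul, mul_left_comm, e2, mul_one]
    have hphC := congrArg (fun w : Circle => (w : ℂ)) hph
    simp only [Circle.coe_mul] at hphC
    rw [← hphC]
    ring
  have hfin : φ (star (vacProj Θ * star X) * (vacProj Θ * star X)) =
      Z * ∑ a ∈ box m N, ∑ b ∈ box m N, u a * (starRingEnd ℂ) (u b) *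
        kmsFourier h ε r β φ (a - b) := by
    rw [hX, map_sum, Finset.mul_sum]
    refine Finset.sum_congr rfl fun a ha => ?_
    rw [map_sum, Finset.mul_sum]
    refine Finset.sum_congr rfl fun b hb => ?_
    rw [map_smul, hval a ha b hb, smul_eq_mul, map_mul (starRingEnd ℂ) (u b),
      ← Circle.coe_inv_eq_conj, hε.inv]
    have h2 : ∀ c, (ε c : ℂ) * ε c = 1 := fun c => by
      rw [← Circle.coe_mul, ← sq, hε.sq_eq_one, Circle.coe_one]
    linear_combination (u a * (starRingEnd ℂ) (u b) * (Z * kmsFourier h ε r β φ (a - b)) *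
      (ε b * ε b)) * h2 a + (u a * (starRingEnd ℂ) (u b) *
      (Z * kmsFourier h ε r β φ (a - b))) * h2 b
  rw [hfin] at hpos
  have h3 := Complex.nonneg_iff.1 hpos
  rw [Complex.re_ofReal_mul, Complex.im_ofReal_mul] at h3
  exact Complex.nonneg_iff.2 ⟨(mul_nonneg_iff_of_pos_left hZpos).1 h3.1,
    ((mul_eq_zero.1 h3.2.symm).resolve_left hZpos.ne').symm⟩

theorem MonoKMS.kmsFourier_zero (hφ : MonoKMS Θ r β φ) (hε : IsLatticeSign h ε)
    (hr : ∀ j, 0 < r j) (hβ : 0 < β) : kmsFourier h ε r β φ 0 = 1 := by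
  have h1 : degValue φ 0 = 1 := by
    have e : inD k (fun i : Fin d => ((0 : Fin d → ℤ) i).toNat) = 0 := by
      ext (i | i) <;> simp [inD]
    have e' : inD k (fun i : Fin d => (-(0 : Fin d → ℤ) i).toNat) = 0 := by
      ext (i | i) <;> simp [inD]
    rw [degValue, e, e', mono_zero_zero, hφ.1.2]
  rw [kmsFourier, lat_zero, h1, hε.zero, gibbsFactor_zero hr hβ]
  simp

/-- The measure with the Fourier coefficients of φ gives a state agreeing with φ on monomials:
rigidity determines both from values on H. -/
theorem kmsOf_surjective (hΘ : Θ.transpose = -Θ) (hε : IsLatticeSign h ε)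
    (hr : ∀ j, 0 < r j) (hβ : 0 < β)
    (hφ : φ ∈ kmsStates (dynamics Θ (extendZero d r)) β) :
    ∃ μ, kmsOf hΘ hε hr hβ μ = φ := by
  have hK : MonoKMS Θ r β φ := (mem_kmsStates_iff hΘ _ _ hβ _).1 hφ
  obtain ⟨μ, hμ⟩ := exists_measure_of_posDef (hK.kmsFourier_posDef hΘ hε hr hβ)
    (hK.kmsFourier_zero hε hr hβ)
  refine ⟨μ, ?_⟩
  have hext : WeakDual.toStrongDual (kmsOf hΘ hε hr hβ μ) = WeakDual.toStrongDual φ := by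
    refine toeplitz_clm_ext hΘ fun s t => ?_
    change kmsOf hΘ hε hr hβ μ (mono Θ s t) = φ (mono Θ s t)
    rw [kmsOf_mono]
    by_cases hw : ∀ j, s (Sum.inl j) = t (Sum.inl j)
    · have hw' : ∀ j, (toInt s - toInt t) (Sum.inl j) = 0 := fun j => by simp [toInt, hw]
      rw [hK.apply_mono hΘ hw]
      set v : Fin d → ℤ := fun i => (toInt s - toInt t) (Sum.inr i) with hv
      have h1 : ∀ z : Torus m, kmsCoeff r β h ε z s (toInt s - toInt t) =
          (gibbsFactor Θ r β v * ∏ j, gibbsRatio Θ r β v j ^ s (Sum.inl j)) *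
            torusValue h ε z v := fun z => by
        rw [kmsCoeff, if_pos hw', mul_comm]
      simp only [h1]
      rw [integral_const_mul]
      by_cases hmem : v ∈ degeneracyGroup Θ.toBlocks₂₂
      · obtain ⟨c, hc⟩ : ∃ c, lat h c = v := ⟨_, lat_repr h hmem⟩
        simp only [← hc, torusValue_lat]
        rw [integral_const_mul, hμ, kmsFourier_mul hε hr hβ]
        ring
      · simp [torusValue_of_notMem h ε _ hmem, hK.degValue_eq_zero hΘ hmem]
    · push Not at hw
      obtain ⟨j, hj⟩ := hw
      rw [hK.eq_zero_of_ne hΘ hr hβ hj]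
      have h1 : ∀ z : Torus m, kmsCoeff r β h ε z s (toInt s - toInt t) = 0 := fun z => by
        refine kmsCoeff_of_not z s fun hc => hj ?_
        have := hc.1 j
        simpa [toInt, sub_eq_zero] using this
      simp [h1]
  exact WeakDual.toStrongDual.injective hext

end

end

/-! ### The homeomorphism, extreme points and explicit values -/

section

variable {k d m : ℕ} {Θ : Matrix (Fin k ⊕ Fin d) (Fin k ⊕ Fin d) ℝ} {r : Fin k → ℝ} {β : ℝ}
  {h : Module.Basis (Fin m) ℤ (degeneracyGroup Θ.toBlocks₂₂)} {ε : (Fin m → ℤ) → Circle}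

/-! ### The affine homeomorphism -/

theorem exists_kms_homeomorph (hΘ : Θ.transpose = -Θ) (hε : IsLatticeSign h ε)
    (hr : ∀ j, 0 < r j) (hβ : 0 < β) :
    ∃ Φ : ProbabilityMeasure (Torus m) ≃ₜ kmsStates (dynamics Θ (extendZero d r)) β,
      ∀ μ, (Φ μ : WeakDual ℂ (Toeplitz Θ)) = kmsOf hΘ hε hr hβ μ := by
  let f : ProbabilityMeasure (Torus m) → kmsStates (dynamics Θ (extendZero d r)) β :=
    fun μ => ⟨kmsOf hΘ hε hr hβ μ, kmsOf_mem hΘ hε hr hβ μ⟩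
  have hf : Function.Bijective f := by
    refine ⟨fun μ ν e => kmsOf_injective hΘ hε hr hβ (congrArg Subtype.val e), fun φ => ?_⟩
    obtain ⟨μ, hμ⟩ := kmsOf_surjective hΘ hε hr hβ φ.2
    exact ⟨μ, Subtype.ext hμ⟩
  have hc : Continuous (Equiv.ofBijective f hf) :=
    (continuous_kmsOf hΘ hε hr hβ).subtype_mk _
  exact ⟨hc.homeoOfEquivCompactToT2, fun μ => rfl⟩

/-! ### Extremality -/

theorem eq_dirac_of_compl_null (z : Torus m) {μ : ProbabilityMeasure (Torus m)}
    (hμ : (μ : Measure (Torus m)) {z}ᶜ = 0) : (μ : Measure (Torus m)) = Measure.dirac z := by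
  refine measure_torus_ext fun c => ?_
  have hae : ∀ᵐ x ∂(μ : Measure (Torus m)), x = z := by
    rw [ae_iff]
    exact hμ
  rw [integral_dirac, integral_congr_ae (hae.mono fun x hx => by rw [hx] :
    (fun x => torusChar x c) =ᵐ[(μ : Measure (Torus m))] fun _ => torusChar z c)]
  simp

/-- A convex decomposition of the state pulls back, by surjectivity, affinity and injectivity, to
one of the point mass. A component with positive weight then gives the complement of z measure zero.
-/
theorem kmsOf_dirac_mem_extremePoints (hΘ : Θ.transpose = -Θ) (hε : IsLatticeSign h ε)
    (hr : ∀ j, 0 < r j) (hβ : 0 < β) (z : Torus m) :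
    kmsOf hΘ hε hr hβ ⟨Measure.dirac z, inferInstance⟩ ∈
      Set.extremePoints ℝ (kmsStates (dynamics Θ (extendZero d r)) β) := by
  rw [mem_extremePoints_iff_left]
  refine ⟨kmsOf_mem hΘ hε hr hβ _, fun φ₁ h₁ φ₂ h₂ hseg => ?_⟩
  obtain ⟨μ, rfl⟩ := kmsOf_surjective hΘ hε hr hβ h₁
  obtain ⟨ν, rfl⟩ := kmsOf_surjective hΘ hε hr hβ h₂
  obtain ⟨a, b, ha, hb, hab, he⟩ := hseg
  lift a to ℝ≥0 using ha.le
  lift b to ℝ≥0 using hb.le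
  have hab' : a + b = 1 := by exact_mod_cast hab
  have ha0 : a ≠ 0 := by
    rintro rfl
    simp at ha
  have hprob : IsProbabilityMeasure (a • (μ : Measure (Torus m)) + b • (ν : Measure (Torus m))) := by
    refine ⟨?_⟩
    rw [Measure.add_apply, Measure.smul_apply, Measure.smul_apply, measure_univ, measure_univ]
    simp only [ENNReal.smul_def, smul_eq_mul, mul_one]
    exact_mod_cast hab'
  let ρ : ProbabilityMeasure (Torus m) := ⟨_, hprob⟩
  have hρ : kmsOf hΘ hε hr hβ ρ = kmsOf hΘ hε hr hβ ⟨Measure.dirac z, inferInstance⟩ := by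
    rw [kmsOf_affine hΘ hε hr hβ μ ν ρ a b hab' rfl, ← he]
    rfl
  have hρ' := congrArg (fun μ : ProbabilityMeasure (Torus m) => (μ : Measure (Torus m)) {z}ᶜ)
    (kmsOf_injective hΘ hε hr hβ hρ)
  change (a • (μ : Measure (Torus m)) + b • (ν : Measure (Torus m))) {z}ᶜ =
    Measure.dirac z {z}ᶜ at hρ'
  rw [Measure.dirac_apply' _ (measurableSet_singleton z).compl, Measure.add_apply,
    Measure.smul_apply] at hρ'
  simp only [Set.mem_compl_iff, Set.mem_singleton_iff, not_true_eq_false, not_false_eq_true,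
    Set.indicator_of_notMem, add_eq_zero, ENNReal.smul_def, smul_eq_mul, mul_eq_zero,
    ENNReal.coe_eq_zero, ha0, false_or] at hρ'
  congr 1
  exact Subtype.ext (eq_dirac_of_compl_null z hρ'.1)

/-! ### The values of the extreme states -/

theorem L_mul {ι : Type*} [Fintype ι] {Θ : Matrix ι ι ℝ} (hΘ : Θ.transpose = -Θ)
    (s t : ι → ℕ) :
    L Θ s * L Θ t = (phase (form Θ (toInt s) (toInt t)) : ℂ) • L Θ (s + t) := by
  rw [L_eq_mono, L_eq_mono, mono_mul hΘ, L_eq_mono]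
  simp

theorem L_mul_star {ι : Type*} [Fintype ι] (Θ : Matrix ι ι ℝ) (s t : ι → ℕ) :
    L Θ s * star (L Θ t) = (phase (-form Θ (toInt s) (toInt t)) : ℂ) • mono Θ s t := by
  rw [mono, smul_smul, ← coe_phase_add]
  simp

theorem word_eq_mono (hΘ : Θ.transpose = -Θ) (p q : Fin k → ℕ) (x y : Fin d → ℕ) :
    L Θ (inK d p) * L Θ (inD k x) * star (L Θ (inD k y)) * star (L Θ (inK d q)) =
      (phase (form Θ (toInt (inK d p)) (toInt (inD k x)) -
        form Θ (toInt (inK d q)) (toInt (inD k y)) -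
        form Θ (toInt (inK d p + inD k x)) (toInt (inK d q + inD k y))) : ℂ) •
      mono Θ (inK d p + inD k x) (inK d q + inD k y) := by
  rw [mul_assoc, ← star_mul, L_mul hΘ, L_mul hΘ, star_smul, smul_mul_smul_comm, L_mul_star,
    smul_smul, star_coe_phase, ← coe_phase_add, ← coe_phase_add]
  rfl

theorem toInt_inD (x : Fin d → ℕ) : toInt (inD k x) = Sum.elim (0 : Fin k → ℤ) (toInt x) := by
  ext (i | i) <;> simp [toInt, inD]

theorem natDiff_eq (x y : Fin d → ℕ) : natDiff x y = toInt x - toInt y := rfl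

theorem toInt_word_sub (p q : Fin k → ℕ) (x y : Fin d → ℕ) :
    toInt (inK d p + inD k x) - toInt (inK d q + inD k y) =
      Sum.elim (toInt p - toInt q) (natDiff x y) := by
  ext (i | i) <;> simp [toInt, inK, inD, natDiff]

theorem eulerProduct_eq (p : Fin k → ℕ) (v : Fin d → ℤ) :
    eulerProduct Θ r β p v = Complex.exp (-β * energy (extendZero d r) (toInt (inK d p))) *
      gibbsFactor Θ r β v := by
  have h1 : Complex.exp (-β * energy (extendZero d r) (toInt (inK d p))) =
      ∏ j, Complex.exp (-β * r j * p j) := by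
    rw [energy_inK, ← Complex.exp_sum]
    congr 1
    push_cast
    rw [Finset.mul_sum]
    exact Finset.sum_congr rfl fun j _ => by ring
  rw [h1, gibbsFactor, ← Finset.prod_mul_distrib, eulerProduct]
  exact Finset.prod_congr rfl fun j _ => mul_div_assoc _ _ _

theorem kmsOf_dirac_smul_mono (hΘ : Θ.transpose = -Θ) (hε : IsLatticeSign h ε)
    (hr : ∀ j, 0 < r j) (hβ : 0 < β) (z : Torus m) (c : ℂ) (s t : Fin k ⊕ Fin d → ℕ) :
    kmsOf hΘ hε hr hβ ⟨Measure.dirac z, inferInstance⟩ (c • mono Θ s t) =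
      c * kmsCoeff r β h ε z s (toInt s - toInt t) := by
  rw [map_smul, smul_eq_mul]
  exact congrArg (c * ·) ((kmsOf_mono hΘ hε hr hβ _ s t).trans (integral_dirac _ _))

theorem kmsOf_dirac_word_of_not (hΘ : Θ.transpose = -Θ) (hε : IsLatticeSign h ε)
    (hr : ∀ j, 0 < r j) (hβ : 0 < β) (z : Torus m) (p q : Fin k → ℕ) (x y : Fin d → ℕ)
    (hpq : p ≠ q ∨ natDiff x y ∉ degeneracyGroup Θ.toBlocks₂₂) :
    kmsOf hΘ hε hr hβ ⟨Measure.dirac z, inferInstance⟩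
      (L Θ (inK d p) * L Θ (inD k x) * star (L Θ (inD k y)) * star (L Θ (inK d q))) = 0 := by
  rw [word_eq_mono hΘ, kmsOf_dirac_smul_mono, toInt_word_sub, kmsCoeff_of_not, mul_zero]
  rintro ⟨h1, h2⟩
  rcases hpq with hpq | hpq
  · refine hpq (toInt_injective (sub_eq_zero.1 (funext fun j => ?_)))
    simpa using h1 j
  · exact hpq h2

/-- The phase from reordering the word into a monomial cancels the commutation phase carried by the
Gibbs ratios, so p enters only through its Boltzmann factor. -/
theorem kmsOf_dirac_word (hΘ : Θ.transpose = -Θ) (hε : IsLatticeSign h ε)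
    (hr : ∀ j, 0 < r j) (hβ : 0 < β) (z : Torus m) (p : Fin k → ℕ) (x y : Fin d → ℕ)
    (hxy : natDiff x y ∈ degeneracyGroup Θ.toBlocks₂₂) :
    kmsOf hΘ hε hr hβ ⟨Measure.dirac z, inferInstance⟩
      (L Θ (inK d p) * L Θ (inD k x) * star (L Θ (inD k y)) * star (L Θ (inK d p))) =
      (phase (-form Θ.toBlocks₂₂ (toInt x) (toInt y)) * ε (h.repr ⟨natDiff x y, hxy⟩) : ℂ) *
        torusChar z (h.repr ⟨natDiff x y, hxy⟩) * eulerProduct Θ r β p (natDiff x y) := by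
  rw [word_eq_mono hΘ, kmsOf_dirac_smul_mono, toInt_word_sub, sub_self]
  have hpow : ∏ j, gibbsRatio Θ r β (natDiff x y) j ^ (inK d p + inD k x) (Sum.inl j) =
      ∏ j, gibbsRatio Θ r β (natDiff x y) j ^ p j := by
    refine Finset.prod_congr rfl fun j _ => ?_
    simp [inK, inD]
  have hph : phase (form Θ (toInt (inK d p)) (toInt (inD k x)) -
        form Θ (toInt (inK d p)) (toInt (inD k y)) -
        form Θ (toInt (inK d p + inD k x)) (toInt (inK d p + inD k y))) *
      phase (2 * form Θ (Sum.elim (0 : Fin k → ℤ) (natDiff x y)) (toInt (inK d p))) =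
      phase (-form Θ.toBlocks₂₂ (toInt x) (toInt y)) := by
    have e : Sum.elim (0 : Fin k → ℤ) (natDiff x y) = toInt (inD k x) - toInt (inD k y) := by
      ext (i | i) <;> simp [toInt, inD, natDiff]
    rw [← phase_add, e, ← form_elim_elim, ← toInt_inD, ← toInt_inD]
    congr 1
    have h1 := form_swap (toInt (inK d p)) (toInt (inD k x)) hΘ
    have h2 := form_swap (toInt (inK d p)) (toInt (inD k y)) hΘ
    simp only [toInt_add, form_add_left, form_add_right, form_sub_left, form_self _ hΘ]
    linarith
  rw [kmsCoeff_elim, torusValue_of_mem h ε z hxy, hpow, prod_gibbsRatio_pow hΘ,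
    eulerProduct_eq, ← hph, Circle.coe_mul]
  ring

theorem exists_int_sign {w : Circle} (hw : w ^ 2 = 1) :
    ∃ l : ℤ, (l = 1 ∨ l = -1) ∧ (l : ℂ) = w := by
  have h1 : (w : ℂ) * w = 1 := by rw [← Circle.coe_mul, ← sq, hw, Circle.coe_one]
  rcases mul_self_eq_one_iff.1 h1 with h2 | h2
  · exact ⟨1, Or.inl rfl, by rw [h2]; simp⟩
  · exact ⟨-1, Or.inr rfl, by rw [h2]; simp⟩

/-- By antisymmetry ⟨x, Dy⟩ = ⟨x - y, Dy⟩, an integer when x - y ∈ H, so the phase is a sign.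
Outside H the value 1 is arbitrary. -/
theorem exists_word_sign {D : Matrix (Fin d) (Fin d) ℝ} (hD : D.transpose = -D)
    {h : Module.Basis (Fin m) ℤ (degeneracyGroup D)} (hε : IsLatticeSign h ε) (x y : Fin d → ℕ) :
    ∃ l : ℤ, ∀ hxy : natDiff x y ∈ degeneracyGroup D, (l = 1 ∨ l = -1) ∧
      (l : ℂ) = phase (-form D (toInt x) (toInt y)) * ε (h.repr ⟨natDiff x y, hxy⟩) := by
  by_cases hxy : natDiff x y ∈ degeneracyGroup D
  · have h1 : phase (-form D (toInt x) (toInt y)) ^ 2 = 1 := by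
      have h2 := phase_two_mul_form hxy (toInt y)
      rw [natDiff_eq, form_sub_left, form_self _ hD, sub_zero] at h2
      rw [sq, phase_neg, ← mul_inv, ← phase_add, ← two_mul, h2, inv_one]
    obtain ⟨l, hl, hlw⟩ := exists_int_sign
      (w := phase (-form D (toInt x) (toInt y)) * ε (h.repr ⟨natDiff x y, hxy⟩))
      (by rw [mul_pow, h1, hε.sq_eq_one, one_mul])
    exact ⟨l, fun _ => ⟨hl, by rw [hlw, Circle.coe_mul]⟩⟩
  · exact ⟨1, fun hc => absurd hc hxy⟩

theorem toTorus_L_mul_star {D : Matrix (Fin d) (Fin d) ℝ} (hD : D.transpose = -D)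
    (x y : Fin d → ℕ) : toTorus hD (L D x * star (L D y)) =
      (phase (-form D (toInt x) (toInt y)) : ℂ) • (U D (natDiff x y) : NCTorus D) := by
  rw [L_mul_star, map_smul, toTorus_mono, natDiff_eq]

end

end ToeplitzTorus

end

/-! ### The main theorem -/

theorem mainTheorem1 (k d : ℕ) (r : Fin k → ℝ) (hr : ∀ j, 0 < r j)
    (Θ : Matrix (Fin k ⊕ Fin d) (Fin k ⊕ Fin d) ℝ) (hΘ : Θ.transpose = -Θ)
    (Θd : Matrix (Fin d) (Fin d) ℝ) (hΘd : Θd = Θ.toBlocks₂₂)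
    (m : ℕ) (hm : m = degeneracyIndex Θd)
    (β : ℝ) (hβ : 0 < β) :
    -- the affine weak* homeomorphism
    (∃ Φ : ProbabilityMeasure (Torus m) ≃ₜ
        kmsStates
          (dynamics Θ (extendZero d r)) β,
      IsAffineOnMeasures
        (fun μ => (Φ μ : WeakDual ℂ (Toeplitz Θ)))) ∧
    -- the canonical homomorphism onto the noncommutative torus of `Θd`, with `L_{e_i} ↦ U_{e_i}`
    ∃ π : Toeplitz Θd →⋆ₐ[ℂ] NCTorus Θd,
      (∀ i : Fin d, π (L Θd (Pi.single i 1)) =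
        (U Θd (Pi.single i 1) : NCTorus Θd)) ∧
      -- bases `b` of `ℤ^d` and `h` of `H` with `h_j = a_j b_j`
      ∀ (b : Module.Basis (Fin d) ℤ (Fin d → ℤ)) (a : Fin m → ℕ)
        (h : Module.Basis (Fin m) ℤ (degeneracyGroup Θd)),
        (∀ j, 0 < a j) →
        (∀ j, (h j : Fin d → ℤ) = (a j : ℤ) • b (Fin.castLE (hm.trans_le (degeneracyIndex_le Θd)) j)) →
        ∃ lam : (Fin d → ℕ) → (Fin d → ℕ) → ℤ,
          (∀ (x y : Fin d → ℕ)
            (hxy : natDiff x y ∈ degeneracyGroup Θd),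
            (lam x y = 1 ∨ lam x y = -1) ∧
            π (L Θd x * star (L Θd y)) =
              (lam x y : ℂ) •
                (((List.ofFn fun j : Fin m =>
                  U Θd (h j) ^ (h.repr ⟨natDiff x y, hxy⟩ j)).prod :
                    unitary (NCTorus Θd)) : NCTorus Θd)) ∧
          ∃ Φ : ProbabilityMeasure (Torus m) ≃ₜ
              kmsStates
                (dynamics Θ (extendZero d r)) β,
            IsAffineOnMeasures
              (fun μ => (Φ μ : WeakDual ℂ (Toeplitz Θ))) ∧
            ∀ z : Torus m,
              ∃ φ : WeakDual ℂ (Toeplitz Θ),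
                φ = Φ ⟨Measure.dirac z, inferInstance⟩ ∧
                φ ∈ Set.extremePoints ℝ (kmsStates
                  (dynamics Θ (extendZero d r)) β) ∧
                ∀ (p q : Fin k → ℕ) (x y : Fin d → ℕ),
                  ((p ≠ q ∨ natDiff x y ∉ degeneracyGroup Θd) →
                    φ (L Θ (inK d p) *
                      L Θ (inD k x) *
                      star (L Θ (inD k y)) *
                      star (L Θ (inK d q))) = 0) ∧
                  ∀ hxy : natDiff x y ∈ degeneracyGroup Θd,
                    p = q →
                    φ (L Θ (inK d p) *
                      L Θ (inD k x) *
                      star (L Θ (inD k y)) *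
                      star (L Θ (inK d q))) =
                    lam x y *
                      torusChar z (h.repr ⟨natDiff x y, hxy⟩) *
                      eulerProduct Θ r β p (natDiff x y) := by
  subst hΘd
  have hD := toBlocks_transpose hΘ
  refine ⟨?_, toTorus hD, fun i => ?_, fun b a h _ _ => ?_⟩
  · let h : Module.Basis (Fin m) ℤ (degeneracyGroup Θ.toBlocks₂₂) :=
      Module.finBasisOfFinrankEq ℤ _ hm.symm
    obtain ⟨ε, hε, -⟩ := exists_latticeSign h hD
    obtain ⟨Φ, hΦ⟩ := exists_kms_homeomorph (r := r) (β := β) hΘ hε hr hβ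
    refine ⟨Φ, ?_⟩
    simp only [hΦ]
    exact kmsOf_affine hΘ hε hr hβ
  · rw [toTorus_L]
    congr 2
    ext j
    by_cases hij : j = i
    · subst hij; simp [toInt]
    · simp [toInt, hij]
  · have hex := exists_latticeSign h hD
    obtain ⟨ε, hε, hW⟩ := hex
    have hex2 := exists_kms_homeomorph (r := r) (β := β) hΘ hε hr hβ
    obtain ⟨Φ, hΦ⟩ := hex2
    choose lam hlam using fun x y => exists_word_sign hD hε x y
    refine ⟨lam, fun x y hxy => ⟨(hlam x y hxy).1, ?_⟩, Φ, ?_, fun z => ?_⟩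
    -- The ordered word is ε(c) U_{x-y} and λ contains the same ε(c); the two signs cancel to leave
    -- the cocycle phase of L_x L_y^*.
    · rw [hW, toTorus_L_mul_star, (hlam x y hxy).2, smul_smul, lat_repr, mul_assoc,
        ← Circle.coe_mul, ← sq, hε.sq_eq_one, Circle.coe_one, mul_one]
    · simp only [hΦ]
      exact kmsOf_affine hΘ hε hr hβ
    · refine ⟨kmsOf hΘ hε hr hβ ⟨Measure.dirac z, inferInstance⟩, (hΦ _).symm,
        kmsOf_dirac_mem_extremePoints hΘ hε hr hβ z, fun p q x y =>
        ⟨kmsOf_dirac_word_of_not hΘ hε hr hβ z p q x y, fun hxy hpq => ?_⟩⟩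
      subst hpq
      rw [(hlam x y hxy).2]
      exact kmsOf_dirac_word hΘ hε hr hβ z p x y hxy
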